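/- Let $d>2$, let $V=\mathbb{C}$ and let $s\in \mathrm{GL}(V)=\mathbb{C}^\times$ be a reflection of order $d$, i.e. multiplication by a primitive $d$-th root of unity. Let $W=\{1,s,\dots,s^{d-1}\}$ be the cyclic group generated by $s$, and let $R=\mathcal{O}(V)\cong\mathbb{C}[X]$, graded with $\deg X=2$. For $A\subseteq W$ let $\mathcal{O}(A)$ be the ring of regular functions on $\bigcup_{x\in A}\{(xv,v)\mid v\in V\}\subseteq V\times V$, regarded as a graded $R$-bimodule: $R$ acts on the left through the first projection to $V$ and on the right through the second. Put $\mathcal{O}(s)=\mathcal{O}(\{s\})$ and $\mathcal{O}(s^{\le i})=\mathcal{O}(\{1,s,\dots,s^i\})$. Let $[n]$ denote the grading shift, $M[n]_i=M_{i+n}$. Let $\mathcal{B}_W$ be the full subcategory of the category of graded $R$-bimodules (with the same action of $\mathbb{C}$ on both sides, and degree $0$ bimodule maps as morphisms) generated by $\mathcal{O}(s^{\le 1})$, i.e. the smallest one which contains $\mathcal{O}(s^{\le 1})$, $R$ and $0$ and is closed under isomorphisms, grading shifts, finite direct sums, tensor products $\otimes_R$ and direct summands. Let $A_W$ be its split Grothendieck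 ring: the free abelian group on the isomorphism classes $\langle M\rangle$ of objects of $\mathcal{B}_W$ modulo the relations $\langle M\oplus N\rangle=\langle M\rangle+\langle N\rangle$, with the product $\langle M\rangle\langle N\rangle=\langle M\otimes_R N\rangle$; it is a $\mathbb{Z}[v,v^{-1}]$-algebra via $v\langle M\rangle=\langle M[1]\rangle$. Then $\mathcal{O}(s)$ and $\mathcal{O}(s^{\le i})[i]$ $(1\le i\le d-1)$ belong to $\mathcal{B}_W$, and, writing $s$ and $C_i$ for their classes in $A_W$, the $\mathbb{Z}[v,v^{-1}]$-algebra $A_W$ has the presentation with generators $s, C_1,\dots,C_{d-1}$ and relations $$\begin{cases} s^d=1,\\ C_iC_j=C_jC_i \ \text{ for } 1\le i,j\le d-1, \text{ and } sC_i=C_is \ \text{ for } 1\le i\le d-1,\\ C_1C_i=C_{i+1}+sC_{i-1}\ \text{ for } 1\le i\le d-2,\\ C_1C_{d-1}=(v+v^{-1})\,C_{d-1},\\ sC_{d-1}=C_{d-1}, \end{cases}$$ with the convention $C_0=1$. In particular, $A_W$ is commutative, and the group algebra $\mathbb{Z}[v,v^{-1}][W]$ embeds as a $\mathbb{Z}[v,v^{-1}]$-subalgebra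 of $A_W$, the generator $s$ of $W$ being sent to the class $s=\langle\mathcal{O}(s)\rangle$. -/

import Mathlib

open CategoryTheory TensorProduct

noncomputable section

namespace RankOne

/-- The ring `R = 𝒪(V)` of regular functions on the one-dimensional space `V = ℂ`,
with the coordinate function `X` placed in degree `2`. -/
abbrev R : Type := Polynomial ℂ

/-- A graded `R`-bimodule with the same action of `ℂ` on both sides: a complex vector space with
two commuting actions of the commutative `ℂ`-algebra `R`, and a `ℤ`-grading by subspaces for
which both actions of `X` are homogeneous of degree `2`. -/
structure GrBimod : Type 1 where
  carrier : Type
  [addCommGroup : AddCommGroup carrier]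
  [module : Module ℂ carrier]
  left : R →ₐ[ℂ] Module.End ℂ carrier
  right : R →ₐ[ℂ] Module.End ℂ carrier
  left_right : ∀ (a b : R) (m : carrier), left a (right b m) = right b (left a m)
  gr : ℤ → Submodule ℂ carrier
  isInternal : DirectSum.IsInternal gr
  left_mem : ∀ (i : ℤ) (m : carrier), m ∈ gr i → left Polynomial.X m ∈ gr (i + 2)
  right_mem : ∀ (i : ℤ) (m : carrier), m ∈ gr i → right Polynomial.X m ∈ gr (i + 2)

attribute [instance] GrBimod.addCommGroup GrBimod.module

namespace GrBimod

@[simp] theorem left_C (M : GrBimod) (c : ℂ) (m : M.carrier) : M.left (Polynomial.C c) m = c • m :=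
  LinearMap.congr_fun (M.left.commutes c) m

@[simp] theorem right_C (M : GrBimod) (c : ℂ) (m : M.carrier) :
    M.right (Polynomial.C c) m = c • m :=
  LinearMap.congr_fun (M.right.commutes c) m

/-! ### The category of graded bimodules -/

/-- Morphisms of graded bimodules: bimodule maps which are homogeneous of degree `0`. -/
@[ext] structure Hom (M N : GrBimod) : Type where
  toLin : M.carrier →ₗ[ℂ] N.carrier
  map_left : ∀ (a : R) (m : M.carrier), toLin (M.left a m) = N.left a (toLin m)
  map_right : ∀ (a : R) (m : M.carrier), toLin (M.right a m) = N.right a (toLin m)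
  map_gr : ∀ (i : ℤ) (m : M.carrier), m ∈ M.gr i → toLin m ∈ N.gr i

instance : Category GrBimod where
  Hom := Hom
  id M := ⟨LinearMap.id, fun _ _ => rfl, fun _ _ => rfl, fun _ _ h => h⟩
  comp f g := ⟨g.toLin ∘ₗ f.toLin,
    fun a m => by simp [f.map_left, g.map_left],
    fun a m => by simp [f.map_right, g.map_right],
    fun i m h => g.map_gr i _ (f.map_gr i m h)⟩

/-- An isomorphism from two mutually inverse morphisms. -/
def mkIso {M N : GrBimod} (f : Hom M N) (g : Hom N M)
    (h₁ : ∀ m, g.toLin (f.toLin m) = m) (h₂ : ∀ n, f.toLin (g.toLin n) = n) : M ≅ N where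
  hom := f
  inv := g
  hom_inv_id := Hom.ext (LinearMap.ext h₁)
  inv_hom_id := Hom.ext (LinearMap.ext h₂)

theorem iso_hom_inv {M N : GrBimod} (e : M ≅ N) (m : M.carrier) :
    Hom.toLin e.inv (Hom.toLin e.hom m) = m :=
  LinearMap.congr_fun (congrArg Hom.toLin e.hom_inv_id) m

theorem iso_inv_hom {M N : GrBimod} (e : M ≅ N) (n : N.carrier) :
    Hom.toLin e.hom (Hom.toLin e.inv n) = n :=
  LinearMap.congr_fun (congrArg Hom.toLin e.inv_hom_id) n

/-! ### Facts on gradings -/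

theorem isInternal_of_components {M : Type} [AddCommGroup M] [Module ℂ M]
    (gr : ℤ → Submodule ℂ M) (c : M →ₗ[ℂ] (ℤ →₀ M))
    (hc : ∀ i, ∀ m ∈ gr i, c m = Finsupp.single i m) (htop : ⨆ i, gr i = ⊤) :
    DirectSum.IsInternal gr := by
  classical
  refine DirectSum.isInternal_submodule_of_iSupIndep_of_iSup_eq_top ?_ htop
  intro i
  rw [Submodule.disjoint_def]
  intro x hx hx'
  have h1 : c x i = x := by rw [hc i x hx]; simp
  have h2 : (⨆ j, ⨆ (_ : j ≠ i), gr j) ≤ LinearMap.ker (Finsupp.lapply i ∘ₗ c) := by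
    refine iSup₂_le fun j hj y hy => ?_
    simp [hc j y hy, hj]
  have h3 := h2 hx'
  simp only [LinearMap.mem_ker, LinearMap.comp_apply, Finsupp.lapply_apply] at h3
  rw [← h1, h3]

/-- The homogeneous components of an element of a graded bimodule. -/
def components (M : GrBimod) : M.carrier →ₗ[ℂ] (ℤ →₀ M.carrier) :=
  (DirectSum.toModule ℂ ℤ (ℤ →₀ M.carrier)
    (fun i => Finsupp.lsingle i ∘ₗ (M.gr i).subtype)) ∘ₗ
  (LinearEquiv.ofBijective (DirectSum.coeLinearMap M.gr) M.isInternal).symm.toLinearMap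

theorem components_of_mem (M : GrBimod) {i : ℤ} {m : M.carrier} (hm : m ∈ M.gr i) :
    M.components m = Finsupp.single i m := by
  have : (LinearEquiv.ofBijective (DirectSum.coeLinearMap M.gr) M.isInternal).symm m =
      DirectSum.lof ℂ ℤ (fun i => M.gr i) i ⟨m, hm⟩ := by
    rw [LinearEquiv.symm_apply_eq]
    exact (DirectSum.coeLinearMap_lof M.gr i ⟨m, hm⟩).symm
  rw [components, LinearMap.comp_apply, LinearEquiv.coe_coe, this, DirectSum.toModule_lof]
  rfl

theorem iSup_gr (M : GrBimod) : ⨆ i, M.gr i = ⊤ := M.isInternal.submodule_iSup_eq_top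

theorem hom_induction (M : GrBimod) {p : M.carrier → Prop} (m : M.carrier)
    (h : ∀ i, ∀ m ∈ M.gr i, p m) (h0 : p 0) (hadd : ∀ x y, p x → p y → p (x + y)) : p m :=
  Submodule.iSup_induction M.gr (motive := p) (by rw [M.iSup_gr]; trivial) h h0 hadd

/-! ### Shift, direct sum, zero -/

/-- The grading shift `M[n]`, with `M[n]_i = M_{i + n}`. -/
@[reducible] def shift (M : GrBimod) (n : ℤ) : GrBimod where
  carrier := M.carrier
  left := M.left
  right := M.right
  left_right := M.left_right
  gr i := M.gr (i + n)
  isInternal := by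
    refine isInternal_of_components _
      (Finsupp.lmapDomain M.carrier ℂ (fun i => i - n) ∘ₗ M.components) ?_ ?_
    · intro i m hm
      simp [components_of_mem M hm, Finsupp.mapDomain_single]
    · rw [← M.iSup_gr]
      exact (Equiv.addRight n).iSup_comp (g := M.gr)
  left_mem i m h := by
    have := M.left_mem _ m h
    rwa [add_right_comm] at this
  right_mem i m h := by
    have := M.right_mem _ m h
    rwa [add_right_comm] at this

/-- The direct sum of two graded bimodules. -/
@[reducible] def sum (M N : GrBimod) : GrBimod where
  carrier := M.carrier × N.carrier
  left :=
    { toFun := fun a => (M.left a).prodMap (N.left a)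
      map_one' := by ext <;> simp
      map_mul' := by intro a b; ext <;> simp
      map_zero' := by ext <;> simp
      map_add' := by intro a b; ext <;> simp
      commutes' := by intro a; ext <;> simp }
  right :=
    { toFun := fun a => (M.right a).prodMap (N.right a)
      map_one' := by ext <;> simp
      map_mul' := by intro a b; ext <;> simp
      map_zero' := by ext <;> simp
      map_add' := by intro a b; ext <;> simp
      commutes' := by intro a; ext <;> simp }
  left_right a b m := by simp [M.left_right, N.left_right]
  gr i := (M.gr i).prod (N.gr i)
  isInternal := by
    refine isInternal_of_components _
      ((Finsupp.mapRange.linearMap (LinearMap.inl ℂ _ _) ∘ₗ M.components).coprod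
        (Finsupp.mapRange.linearMap (LinearMap.inr ℂ _ _) ∘ₗ N.components)) ?_ ?_
    · rintro i ⟨m, n⟩ ⟨hm, hn⟩
      simp [components_of_mem M hm, components_of_mem N hn, ← Finsupp.single_add]
    · rw [eq_top_iff]
      rintro ⟨m, n⟩ -
      have hm : ((m, 0) : M.carrier × N.carrier) ∈ ⨆ i, (M.gr i).prod (N.gr i) := by
        refine M.hom_induction (p := fun m => ((m, 0) : M.carrier × N.carrier) ∈ _) m ?_ ?_ ?_
        · intro i m hm
          exact Submodule.mem_iSup_of_mem i ⟨hm, Submodule.zero_mem _⟩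
        · exact Submodule.zero_mem _
        · intro x y hx hy
          simpa using Submodule.add_mem _ hx hy
      have hn : ((0, n) : M.carrier × N.carrier) ∈ ⨆ i, (M.gr i).prod (N.gr i) := by
        refine N.hom_induction (p := fun n => ((0, n) : M.carrier × N.carrier) ∈ _) n ?_ ?_ ?_
        · intro i m hm
          exact Submodule.mem_iSup_of_mem i ⟨Submodule.zero_mem _, hm⟩
        · exact Submodule.zero_mem _
        · intro x y hx hy
          simpa using Submodule.add_mem _ hx hy
      simpa using Submodule.add_mem _ hm hn
  left_mem i m h := ⟨M.left_mem i _ h.1, N.left_mem i _ h.2⟩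
  right_mem i m h := ⟨M.right_mem i _ h.1, N.right_mem i _ h.2⟩

/-- The zero bimodule. -/
@[reducible] def zero : GrBimod where
  carrier := PUnit
  left :=
    { toFun := fun _ => 0
      map_one' := by ext
      map_mul' := by intro a b; ext
      map_zero' := by ext
      map_add' := by intro a b; ext
      commutes' := by intro a; ext }
  right :=
    { toFun := fun _ => 0
      map_one' := by ext
      map_mul' := by intro a b; ext
      map_zero' := by ext
      map_add' := by intro a b; ext
      commutes' := by intro a; ext }
  left_right a b m := rfl
  gr _ := ⊤
  isInternal := isInternal_of_components _ 0
    (fun i m _ => (Finsupp.single_zero i).symm) (by simp)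
  left_mem i m h := trivial
  right_mem i m h := trivial

/-! ### Tensor product over `R` -/

/-- The subspace spanned by all `m r ⊗ n - m ⊗ r n`. -/
def balance (M N : GrBimod) : Submodule ℂ (M.carrier ⊗[ℂ] N.carrier) :=
  Submodule.span ℂ {t | ∃ (r : R) (m : M.carrier) (n : N.carrier),
    t = (M.right r m) ⊗ₜ[ℂ] n - m ⊗ₜ[ℂ] (N.left r n)}

/-- The vector space `M ⊗_R N`, for the right action of `R` on `M` and the left action on `N`. -/
abbrev Tens (M N : GrBimod) : Type := (M.carrier ⊗[ℂ] N.carrier) ⧸ balance M N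

/-- The pure tensor `m ⊗ n` in `M ⊗_R N`. -/
def tmk {M N : GrBimod} (m : M.carrier) (n : N.carrier) : Tens M N :=
  (balance M N).mkQ (m ⊗ₜ[ℂ] n)

section tens
variable {M N : GrBimod} {P : Type} [AddCommGroup P] [Module ℂ P]

theorem tmk_add_left (m m' : M.carrier) (n : N.carrier) :
    (tmk (m + m') n : Tens M N) = tmk m n + tmk m' n := by
  simp only [tmk, TensorProduct.add_tmul, map_add]

theorem tmk_add_right (m : M.carrier) (n n' : N.carrier) :
    (tmk m (n + n') : Tens M N) = tmk m n + tmk m n' := by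
  simp only [tmk, TensorProduct.tmul_add, map_add]

theorem tmk_smul_left (c : ℂ) (m : M.carrier) (n : N.carrier) :
    (tmk (c • m) n : Tens M N) = c • tmk m n := by
  simp only [tmk, ← TensorProduct.smul_tmul', map_smul]

theorem tmk_smul_right (c : ℂ) (m : M.carrier) (n : N.carrier) :
    (tmk m (c • n) : Tens M N) = c • tmk m n := by
  simp only [tmk, TensorProduct.tmul_smul, map_smul]

theorem tmk_zero_left (n : N.carrier) : (tmk 0 n : Tens M N) = 0 := by
  simp only [tmk, TensorProduct.zero_tmul, map_zero]

theorem tmk_zero_right (m : M.carrier) : (tmk m 0 : Tens M N) = 0 := by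
  simp only [tmk, TensorProduct.tmul_zero, map_zero]

theorem tmk_balance (r : R) (m : M.carrier) (n : N.carrier) :
    (tmk (M.right r m) n : Tens M N) = tmk m (N.left r n) :=
  (Submodule.Quotient.eq _).2 (Submodule.subset_span ⟨r, m, n, rfl⟩)

/-- The pure tensor as a bilinear map. -/
def tmkL (M N : GrBimod) : M.carrier →ₗ[ℂ] N.carrier →ₗ[ℂ] Tens M N :=
  LinearMap.mk₂ ℂ tmk tmk_add_left tmk_smul_left tmk_add_right tmk_smul_right

@[simp] theorem tmkL_apply (m : M.carrier) (n : N.carrier) : tmkL M N m n = tmk m n := rfl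

/-- The universal property of `M ⊗_R N`. -/
def tlift (f : M.carrier →ₗ[ℂ] N.carrier →ₗ[ℂ] P)
    (h : ∀ r m n, f (M.right r m) n = f m (N.left r n)) : Tens M N →ₗ[ℂ] P :=
  (balance M N).liftQ (TensorProduct.lift f) (by
    rw [balance, Submodule.span_le]
    rintro _ ⟨r, m, n, rfl⟩
    simp [h])

@[simp] theorem tlift_tmk (f : M.carrier →ₗ[ℂ] N.carrier →ₗ[ℂ] P)
    (h : ∀ r m n, f (M.right r m) n = f m (N.left r n)) (m : M.carrier) (n : N.carrier) :
    tlift f h (tmk m n) = f m n := rfl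

theorem tens_induction {p : Tens M N → Prop} (t : Tens M N) (h : ∀ m n, p (tmk m n))
    (hadd : ∀ x y, p x → p y → p (x + y)) : p t := by
  obtain ⟨t, rfl⟩ := Submodule.mkQ_surjective _ t
  induction t using TensorProduct.induction_on with
  | zero => simpa only [tmk, TensorProduct.zero_tmul] using h 0 0
  | tmul m n => exact h m n
  | add x y hx hy => rw [map_add]; exact hadd _ _ hx hy

theorem tens_ext {f g : Tens M N →ₗ[ℂ] P} (h : ∀ m n, f (tmk m n) = g (tmk m n)) : f = g :=
  LinearMap.ext fun t => tens_induction (p := fun t => f t = g t) t h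
    fun x y hx hy => by rw [map_add, map_add, hx, hy]

/-- A bilinear map which is balanced for `X` is balanced for all of `R`. -/
theorem balanced_of_X (f : M.carrier →ₗ[ℂ] N.carrier →ₗ[ℂ] P)
    (h : ∀ m n, f (M.right Polynomial.X m) n = f m (N.left Polynomial.X n)) (r : R) :
    ∀ m n, f (M.right r m) n = f m (N.left r n) := by
  induction r using Polynomial.induction_on' with
  | add p q hp hq => intro m n; simp [hp, hq]
  | monomial k a =>
    have hX : ∀ m n, f (M.right (Polynomial.X ^ k) m) n = f m (N.left (Polynomial.X ^ k) n) := by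
      induction k with
      | zero => intro m n; simp
      | succ k ih =>
        intro m n
        rw [pow_succ, map_mul, Module.End.mul_apply, ih, h, ← Module.End.mul_apply, ← map_mul,
          ← pow_succ, ← pow_succ']
    intro m n
    rw [← mul_one a, ← smul_eq_mul, ← Polynomial.smul_monomial, Polynomial.monomial_one_right_eq_X_pow]
    simp only [map_smul, LinearMap.smul_apply, hX]

end tens

/-- The action on `M ⊗_R N` induced by the left action on `M`. -/
def tensLeft (M N : GrBimod) : R →ₐ[ℂ] Module.End ℂ (Tens M N) where
  toFun a := tlift (tmkL M N ∘ₗ M.left a) (by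
    intro r m n; simp [M.left_right, tmk_balance])
  map_one' := tens_ext fun m n => by
    change tmk (M.left 1 m) n = tmk m n; simp
  map_mul' a b := tens_ext fun m n => by
    change tmk (M.left (a * b) m) n = tmk (M.left a (M.left b m)) n; simp
  map_zero' := tens_ext fun m n => by
    change tmk (M.left 0 m) n = 0; simp [tmk_zero_left]
  map_add' a b := tens_ext fun m n => by
    change tmk (M.left (a + b) m) n = tmk (M.left a m) n + tmk (M.left b m) n
    simp [tmk_add_left]
  commutes' c := tens_ext fun m n => by
    change tmk (M.left (Polynomial.C c) m) n = c • tmk m n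
    rw [left_C, tmk_smul_left]

/-- The action on `M ⊗_R N` induced by the right action on `N`. -/
def tensRight (M N : GrBimod) : R →ₐ[ℂ] Module.End ℂ (Tens M N) where
  toFun a := tlift ((tmkL M N).compl₂ (N.right a)) (by
    intro r m n; simp [← N.left_right, tmk_balance])
  map_one' := tens_ext fun m n => by
    change tmk m (N.right 1 n) = tmk m n; simp
  map_mul' a b := tens_ext fun m n => by
    change tmk m (N.right (a * b) n) = tmk m (N.right a (N.right b n)); simp
  map_zero' := tens_ext fun m n => by
    change tmk m (N.right 0 n) = 0; simp [tmk_zero_right]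
  map_add' a b := tens_ext fun m n => by
    change tmk m (N.right (a + b) n) = tmk m (N.right a n) + tmk m (N.right b n)
    simp [tmk_add_right]
  commutes' c := tens_ext fun m n => by
    change tmk m (N.right (Polynomial.C c) n) = c • tmk m n
    rw [right_C, tmk_smul_right]

@[simp] theorem tensLeft_tmk {M N : GrBimod} (a : R) (m : M.carrier) (n : N.carrier) :
    tensLeft M N a (tmk m n) = tmk (M.left a m) n := rfl

@[simp] theorem tensRight_tmk {M N : GrBimod} (a : R) (m : M.carrier) (n : N.carrier) :
    tensRight M N a (tmk m n) = tmk m (N.right a n) := rfl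

/-- The degree `k` part of `M ⊗_R N`, spanned by the `m ⊗ n` with `m`, `n` homogeneous of degrees
with sum `k`. -/
def tensGr (M N : GrBimod) (k : ℤ) : Submodule ℂ (Tens M N) :=
  Submodule.span ℂ {t | ∃ i j, i + j = k ∧ ∃ m ∈ M.gr i, ∃ n ∈ N.gr j, t = tmk m n}

theorem tmk_mem {M N : GrBimod} {i j : ℤ} {m : M.carrier} {n : N.carrier} (hm : m ∈ M.gr i)
    (hn : n ∈ N.gr j) : (tmk m n : Tens M N) ∈ tensGr M N (i + j) :=
  Submodule.subset_span ⟨i, j, rfl, m, hm, n, hn, rfl⟩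

theorem tensGr_le {M N : GrBimod} {k : ℤ} {S : Submodule ℂ (Tens M N)}
    (h : ∀ i j, i + j = k → ∀ m ∈ M.gr i, ∀ n ∈ N.gr j, tmk m n ∈ S) : tensGr M N k ≤ S := by
  rw [tensGr, Submodule.span_le]
  rintro _ ⟨i, j, hij, m, hm, n, hn, rfl⟩
  exact h i j hij m hm n hn

/-- A bilinear map on homogeneous components. -/
def tensComponents₂ (M N : GrBimod) : M.carrier →ₗ[ℂ] N.carrier →ₗ[ℂ] (ℤ →₀ Tens M N) :=
  ((Finsupp.lsum ℂ (fun i : ℤ => LinearMap.flip (Finsupp.lsum ℂ (fun j : ℤ =>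
    LinearMap.flip ((tmkL M N).compr₂ (Finsupp.lsingle (i + j))))))).compl₂ N.components) ∘ₗ
    M.components

theorem tensComponents₂_of_mem {M N : GrBimod} {i j : ℤ} {m : M.carrier} {n : N.carrier}
    (hm : m ∈ M.gr i) (hn : n ∈ N.gr j) :
    tensComponents₂ M N m n = Finsupp.single (i + j) (tmk m n) := by
  simp [tensComponents₂, components_of_mem M hm, components_of_mem N hn]

/-- The tensor product over `R` of graded bimodules. -/
@[reducible] def tensor (M N : GrBimod) : GrBimod where
  carrier := Tens M N
  left := tensLeft M N
  right := tensRight M N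
  left_right a b t := by
    refine tens_induction (p := fun t => tensLeft M N a (tensRight M N b t) =
      tensRight M N b (tensLeft M N a t)) t (fun m n => by simp) fun x y hx hy => ?_
    simp only [map_add, hx, hy]
  gr := tensGr M N
  isInternal := by
    have hb : ∀ (m : M.carrier) (n : N.carrier),
        tensComponents₂ M N (M.right Polynomial.X m) n =
          tensComponents₂ M N m (N.left Polynomial.X n) := by
      intro m n
      refine M.hom_induction (p := fun m => tensComponents₂ M N (M.right Polynomial.X m) n =
          tensComponents₂ M N m (N.left Polynomial.X n)) m ?_ (by simp) ?_
      · intro i m hm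
        refine N.hom_induction (p := fun n => tensComponents₂ M N (M.right Polynomial.X m) n =
          tensComponents₂ M N m (N.left Polynomial.X n)) n ?_ (by simp) ?_
        · intro j n hn
          rw [tensComponents₂_of_mem (M.right_mem i m hm) hn,
            tensComponents₂_of_mem hm (N.left_mem j n hn), tmk_balance]
          congr 1
          ring
        · intro x y hx hy
          simp only [map_add, hx, hy]
      · intro x y hx hy
        simp only [map_add, LinearMap.add_apply, hx, hy]
    refine isInternal_of_components _
      (tlift (tensComponents₂ M N) (balanced_of_X _ hb)) ?_ ?_
    · intro k t ht
      have : tensGr M N k ≤ LinearMap.eqLocus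
          (tlift (tensComponents₂ M N) (balanced_of_X _ hb)) (Finsupp.lsingle k) := by
        refine tensGr_le ?_
        rintro i j rfl m hm n hn
        simp [LinearMap.mem_eqLocus, tensComponents₂_of_mem hm hn]
      exact this ht
    · rw [eq_top_iff]
      rintro t -
      refine tens_induction t (fun m n => ?_) fun x y hx hy => Submodule.add_mem _ hx hy
      refine M.hom_induction (p := fun m => tmk m n ∈ ⨆ i, tensGr M N i) m ?_ ?_ ?_
      · intro i m hm
        refine N.hom_induction (p := fun n => tmk m n ∈ ⨆ i, tensGr M N i) n ?_ ?_ ?_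
        · intro j n hn
          exact Submodule.mem_iSup_of_mem (i + j) (tmk_mem hm hn)
        · rw [tmk_zero_right]; exact Submodule.zero_mem _
        · intro x y hx hy; rw [tmk_add_right]; exact Submodule.add_mem _ hx hy
      · rw [tmk_zero_left]; exact Submodule.zero_mem _
      · intro x y hx hy; rw [tmk_add_left]; exact Submodule.add_mem _ hx hy
  left_mem k t ht := by
    have : tensGr M N k ≤ (tensGr M N (k + 2)).comap (tensLeft M N Polynomial.X) := by
      refine tensGr_le ?_
      rintro i j rfl m hm n hn
      rw [Submodule.mem_comap, tensLeft_tmk, add_right_comm]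
      exact tmk_mem (M.left_mem i m hm) hn
    exact this ht
  right_mem k t ht := by
    have : tensGr M N k ≤ (tensGr M N (k + 2)).comap (tensRight M N Polynomial.X) := by
      refine tensGr_le ?_
      rintro i j rfl m hm n hn
      rw [Submodule.mem_comap, tensRight_tmk, add_assoc]
      exact tmk_mem hm (N.right_mem j n hn)
    exact this ht

/-! ### The unit bimodule and the bimodules of regular functions on unions of graphs -/

/-- The homogeneous components of an element of `R`. -/
def unitComponents : R →ₗ[ℂ] (ℤ →₀ R) :=
  Polynomial.lsum fun k : ℕ => Finsupp.lsingle (2 * (k : ℤ)) ∘ₗ Polynomial.monomial k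

/-- The bimodule `R`, the monoidal unit; `X ^ k` has degree `2 k`. -/
@[reducible] def unit : GrBimod where
  carrier := R
  left := Algebra.lmul ℂ R
  right := Algebra.lmul ℂ R
  left_right a b m := by simp [mul_left_comm]
  gr i := Submodule.span ℂ {p | ∃ k : ℕ, i = 2 * k ∧ p = Polynomial.X ^ k}
  isInternal := by
    have key : ∀ k : ℕ, unitComponents (Polynomial.X ^ k) =
        Finsupp.single (2 * (k : ℤ)) (Polynomial.X ^ k : R) := by
      intro k
      simp [unitComponents, ← Polynomial.monomial_one_right_eq_X_pow]
    refine isInternal_of_components _ unitComponents ?_ ?_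
    · intro i m hm
      have : Submodule.span ℂ {p : R | ∃ k : ℕ, i = 2 * k ∧ p = Polynomial.X ^ k} ≤
          LinearMap.eqLocus unitComponents (Finsupp.lsingle i) := by
        rw [Submodule.span_le]
        rintro _ ⟨k, rfl, rfl⟩
        exact key k
      exact this hm
    · rw [eq_top_iff]
      rintro p -
      induction p using Polynomial.induction_on' with
      | add p q hp hq => exact Submodule.add_mem _ hp hq
      | monomial k a =>
        rw [← mul_one a, ← smul_eq_mul, ← Polynomial.smul_monomial,
          Polynomial.monomial_one_right_eq_X_pow]
        exact Submodule.smul_mem _ _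
          (Submodule.mem_iSup_of_mem (2 * (k : ℤ)) (Submodule.subset_span ⟨k, rfl, rfl⟩))
  left_mem i m hm := by
    refine (Submodule.span_le (p := (Submodule.span ℂ _).comap
      (Algebra.lmul ℂ R Polynomial.X))).2 ?_ hm
    rintro _ ⟨k, rfl, rfl⟩
    refine Submodule.subset_span ⟨k + 1, by push_cast; ring, ?_⟩
    simp [pow_succ']
  right_mem i m hm := by
    refine (Submodule.span_le (p := (Submodule.span ℂ _).comap
      (Algebra.lmul ℂ R Polynomial.X))).2 ?_ hm
    rintro _ ⟨k, rfl, rfl⟩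
    refine Submodule.subset_span ⟨k + 1, by push_cast; ring, ?_⟩
    simp [pow_succ']

/-- The union of the reversed graphs `Gr(x) = {(x v, v) | v ∈ V}` for `x ∈ A`, inside `V × V`,
where `A ⊆ GL(V) = ℂˣ` and `V = ℂ`. -/
def graphs (A : Set ℂˣ) : Set (Fin 2 → ℂ) :=
  {p | ∃ x ∈ A, ∃ v : ℂ, p = ![(x : ℂ) * v, v]}

/-- The ideal of polynomial functions on `V × V` vanishing on the union of graphs. -/
def graphIdeal (A : Set ℂˣ) : Ideal (MvPolynomial (Fin 2) ℂ) :=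
  MvPolynomial.vanishingIdeal ℂ (graphs A)

theorem eval_smul_of_isHomogeneous {p : MvPolynomial (Fin 2) ℂ} {n : ℕ} (hp : p.IsHomogeneous n)
    (t : ℂ) (z : Fin 2 → ℂ) :
    MvPolynomial.eval (t • z) p = t ^ n * MvPolynomial.eval z p := by
  rw [MvPolynomial.eval_eq', MvPolynomial.eval_eq', Finset.mul_sum]
  refine Finset.sum_congr rfl fun d hd => ?_
  have h1 : d 0 + d 1 = n := by
    have := hp (MvPolynomial.mem_support_iff.1 hd)
    simpa [Finsupp.weight_apply, Finsupp.sum_fintype] using this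
  simp only [Fin.prod_univ_two, Pi.smul_apply, smul_eq_mul, mul_pow, ← h1, pow_add]
  ring

theorem homogeneousComponent_mem_graphIdeal (A : Set ℂˣ) {p : MvPolynomial (Fin 2) ℂ}
    (hp : p ∈ graphIdeal A) (n : ℕ) :
    MvPolynomial.homogeneousComponent n p ∈ graphIdeal A := by
  rintro _ ⟨x, hx, v, rfl⟩
  set z : Fin 2 → ℂ := ![(x : ℂ) * v, v] with hz
  by_cases hn : n < p.totalDegree + 1
  swap
  · rw [MvPolynomial.homogeneousComponent_eq_zero _ _ (by omega), map_zero]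
  -- the one-variable polynomial `t ↦ p (t z)`
  set q : Polynomial ℂ := ∑ i ∈ Finset.range (p.totalDegree + 1),
    Polynomial.monomial i (MvPolynomial.eval z (MvPolynomial.homogeneousComponent i p)) with hq
  have hq0 : q = 0 := by
    refine Polynomial.funext fun t => ?_
    have h1 : MvPolynomial.eval (t • z) p = 0 := by
      have := hp (t • z) ⟨x, hx, t * v, by ext i; fin_cases i <;> (simp [z]; try ring)⟩
      rwa [MvPolynomial.aeval_eq_eval] at this
    rw [← MvPolynomial.sum_homogeneousComponent p, map_sum] at h1
    rw [Polynomial.eval_zero, ← h1, hq, Polynomial.eval_finsetSum]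
    refine Finset.sum_congr rfl fun i _ => ?_
    rw [Polynomial.eval_monomial, eval_smul_of_isHomogeneous
      (MvPolynomial.homogeneousComponent_isHomogeneous i p), mul_comm]
  have h2 : q.coeff n = 0 := by rw [hq0, Polynomial.coeff_zero]
  rw [hq, Polynomial.finsetSum_coeff] at h2
  simp only [Polynomial.coeff_monomial, Finset.sum_ite_eq', Finset.mem_range, hn, if_true] at h2
  rwa [MvPolynomial.aeval_eq_eval]

/-- The ring `𝒪(A)` of regular functions on the union of graphs `Gr(x)`, `x ∈ A`. -/
abbrev FunRing (A : Set ℂˣ) : Type := MvPolynomial (Fin 2) ℂ ⧸ graphIdeal A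

/-- The restriction of polynomial functions from `V × V`. -/
abbrev res (A : Set ℂˣ) : MvPolynomial (Fin 2) ℂ →ₐ[ℂ] FunRing A :=
  Ideal.Quotient.mkₐ ℂ (graphIdeal A)

/-- The homogeneous components of a polynomial, restricted to the union of graphs. -/
def polyComponents (A : Set ℂˣ) : MvPolynomial (Fin 2) ℂ →ₗ[ℂ] (ℤ →₀ FunRing A) :=
  (MvPolynomial.basisMonomials (Fin 2) ℂ).constr ℂ fun d =>
    Finsupp.single (2 * (d.degree : ℤ)) (res A (MvPolynomial.monomial d 1))

theorem polyComponents_of_isHomogeneous (A : Set ℂˣ) {p : MvPolynomial (Fin 2) ℂ} {n : ℕ}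
    (hp : p.IsHomogeneous n) :
    polyComponents A p = Finsupp.single (2 * (n : ℤ)) (res A p) := by
  have hm : ∀ d : Fin 2 →₀ ℕ, ∀ a : ℂ, polyComponents A (MvPolynomial.monomial d a) =
      Finsupp.single (2 * (d.degree : ℤ)) (res A (MvPolynomial.monomial d a)) := by
    intro d a
    have h1 : polyComponents A (MvPolynomial.monomial d 1) =
        Finsupp.single (2 * (d.degree : ℤ)) (res A (MvPolynomial.monomial d 1)) := by
      have := (MvPolynomial.basisMonomials (Fin 2) ℂ).constr_basis ℂ (fun d =>
        (Finsupp.single (2 * (d.degree : ℤ)) (res A (MvPolynomial.monomial d 1)) :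
          ℤ →₀ FunRing A)) d
      rwa [MvPolynomial.coe_basisMonomials] at this
    rw [← mul_one a, ← smul_eq_mul, ← MvPolynomial.smul_monomial, map_smul, h1, map_smul,
      Finsupp.smul_single]
  conv_lhs => rw [p.as_sum]
  conv_rhs => rw [p.as_sum]
  rw [map_sum, map_sum, Finsupp.single_finsetSum]
  refine Finset.sum_congr rfl fun d hd => ?_
  have hd' : d.degree = n := by
    have := hp (MvPolynomial.mem_support_iff.1 hd)
    simpa [Finsupp.weight_apply, Finsupp.degree_eq_sum, Finsupp.sum_fintype] using this
  rw [hm, hd']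

theorem polyComponents_eq_zero (A : Set ℂˣ) {p : MvPolynomial (Fin 2) ℂ}
    (hp : p ∈ graphIdeal A) : polyComponents A p = 0 := by
  rw [← MvPolynomial.sum_homogeneousComponent p, map_sum]
  refine Finset.sum_eq_zero fun i _ => ?_
  rw [polyComponents_of_isHomogeneous A (MvPolynomial.homogeneousComponent_isHomogeneous i p)]
  have : res A (MvPolynomial.homogeneousComponent i p) = 0 :=
    Ideal.Quotient.eq_zero_iff_mem.2 (homogeneousComponent_mem_graphIdeal A hp i)
  rw [this, Finsupp.single_zero]

/-- The graded `R`-bimodule `𝒪(A)`: the ring of regular functions on the union of the graphs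
`Gr(x)`, `x ∈ A`, with `R` acting on the left (resp. right) through the first (resp. second)
projection to `V`; the restriction of a homogeneous polynomial of degree `k` has degree `2 k`. -/
def O (A : Set ℂˣ) : GrBimod where
  carrier := FunRing A
  left := (Algebra.lmul ℂ (FunRing A)).comp
    ((res A).comp (Polynomial.aeval (MvPolynomial.X 0)))
  right := (Algebra.lmul ℂ (FunRing A)).comp
    ((res A).comp (Polynomial.aeval (MvPolynomial.X 1)))
  left_right a b m := mul_left_comm _ _ _
  gr i := Submodule.span ℂ {f | ∃ k : ℕ, i = 2 * k ∧
    ∃ p : MvPolynomial (Fin 2) ℂ, p.IsHomogeneous k ∧ f = res A p}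
  isInternal := by
    let c : FunRing A →ₗ[ℂ] (ℤ →₀ FunRing A) :=
      ((graphIdeal A).restrictScalars ℂ).liftQ (polyComponents A)
        (fun p hp => polyComponents_eq_zero A hp)
    refine isInternal_of_components _ c ?_ ?_
    · intro i m hm
      refine (Submodule.span_le (p := LinearMap.eqLocus c (Finsupp.lsingle i))).2 ?_ hm
      rintro _ ⟨k, rfl, p, hp, rfl⟩
      exact polyComponents_of_isHomogeneous A hp
    · rw [eq_top_iff]
      rintro f -
      obtain ⟨p, rfl⟩ := Ideal.Quotient.mkₐ_surjective ℂ (graphIdeal A) f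
      rw [← MvPolynomial.sum_homogeneousComponent p, map_sum]
      refine Submodule.sum_mem _ fun k _ => Submodule.mem_iSup_of_mem (2 * (k : ℤ)) ?_
      exact Submodule.subset_span
        ⟨k, rfl, _, MvPolynomial.homogeneousComponent_isHomogeneous k p, rfl⟩
  left_mem i m hm := by
    refine (Submodule.span_le (p := (Submodule.span ℂ _).comap
      (Algebra.lmul ℂ (FunRing A) (res A (Polynomial.aeval (MvPolynomial.X 0) Polynomial.X))))).2
      ?_ hm
    rintro _ ⟨k, rfl, p, hp, rfl⟩
    refine Submodule.subset_span ⟨1 + k, by push_cast; ring, MvPolynomial.X 0 * p,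
      (MvPolynomial.isHomogeneous_X ℂ 0).mul hp, ?_⟩
    simp
  right_mem i m hm := by
    refine (Submodule.span_le (p := (Submodule.span ℂ _).comap
      (Algebra.lmul ℂ (FunRing A) (res A (Polynomial.aeval (MvPolynomial.X 1) Polynomial.X))))).2
      ?_ hm
    rintro _ ⟨k, rfl, p, hp, rfl⟩
    refine Submodule.subset_span ⟨1 + k, by push_cast; ring, MvPolynomial.X 1 * p,
      (MvPolynomial.isHomogeneous_X ℂ 1).mul hp, ?_⟩
    simp

/-! ### Isomorphisms expressing that `⊕` and `⊗` satisfy the laws of a semiring -/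

/-- A morphism out of `M ⊗_R N`. -/
def tensHom {M N P : GrBimod} (f : M.carrier →ₗ[ℂ] N.carrier →ₗ[ℂ] P.carrier)
    (hb : ∀ r m n, f (M.right r m) n = f m (N.left r n))
    (hl : ∀ a m n, f (M.left a m) n = P.left a (f m n))
    (hr : ∀ a m n, f m (N.right a n) = P.right a (f m n))
    (hg : ∀ i j, ∀ m ∈ M.gr i, ∀ n ∈ N.gr j, f m n ∈ P.gr (i + j)) : Hom (tensor M N) P where
  toLin := tlift f hb
  map_left a t := by
    refine tens_induction (p := fun t => tlift f hb (tensLeft M N a t) = P.left a (tlift f hb t)) t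
      (fun m n => by simp [hl]) fun x y hx hy => ?_
    simp only [map_add, hx, hy]
  map_right a t := by
    refine tens_induction (p := fun t => tlift f hb (tensRight M N a t) =
      P.right a (tlift f hb t)) t (fun m n => by simp [hr]) fun x y hx hy => ?_
    simp only [map_add, hx, hy]
  map_gr k t ht := by
    have : tensGr M N k ≤ (P.gr k).comap (tlift f hb) := by
      refine tensGr_le ?_
      rintro i j rfl m hm n hn
      exact hg i j m hm n hn
    exact this ht

/-- The tensor product of two morphisms. -/
def tensorMap {M M' N N' : GrBimod} (f : Hom M M') (g : Hom N N') :
    Hom (tensor M N) (tensor M' N') :=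
  tensHom ((tmkL M' N').compl₁₂ f.toLin g.toLin)
    (fun r m n => by simp [f.map_right, g.map_left, tmk_balance])
    (fun a m n => by simp [f.map_left])
    (fun a m n => by simp [g.map_right])
    (fun i j m hm n hn => tmk_mem (f.map_gr i m hm) (g.map_gr j n hn))

/-- An isomorphism between tensor products from morphisms inverse to each other on
generators. -/
def tensIso {M N P : GrBimod} (f : Hom (tensor M N) P) (g : Hom P (tensor M N))
    (h₁ : ∀ m n, g.toLin (f.toLin (tmk m n)) = tmk m n)
    (h₂ : ∀ p, f.toLin (g.toLin p) = p) : tensor M N ≅ P :=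
  mkIso f g (fun t => tens_induction (p := fun t => g.toLin (f.toLin t) = t) t h₁
    fun x y hx hy => by rw [map_add, map_add, hx, hy]) h₂

def tensorCongr {M M' N N' : GrBimod} (e : M ≅ M') (e' : N ≅ N') : tensor M N ≅ tensor M' N' :=
  tensIso (tensorMap e.hom e'.hom) (tensorMap e.inv e'.inv)
    (fun m n => congrArg₂ tmk (iso_hom_inv e m) (iso_hom_inv e' n))
    (fun t => tens_induction (p := fun t => (tensorMap e.hom e'.hom).toLin
      ((tensorMap e.inv e'.inv).toLin t) = t) t
      (fun m n => congrArg₂ tmk (iso_inv_hom e m) (iso_inv_hom e' n))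
      fun x y hx hy => by rw [map_add, map_add, hx, hy])

def sumCongr {M M' N N' : GrBimod} (e : M ≅ M') (e' : N ≅ N') : sum M N ≅ sum M' N' :=
  mkIso
    ⟨(Hom.toLin e.hom).prodMap (Hom.toLin e'.hom),
      fun a m => Prod.ext (Hom.map_left e.hom a m.1) (Hom.map_left e'.hom a m.2),
      fun a m => Prod.ext (Hom.map_right e.hom a m.1) (Hom.map_right e'.hom a m.2),
      fun i _ h => ⟨Hom.map_gr e.hom i _ h.1, Hom.map_gr e'.hom i _ h.2⟩⟩
    ⟨(Hom.toLin e.inv).prodMap (Hom.toLin e'.inv),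
      fun a m => Prod.ext (Hom.map_left e.inv a m.1) (Hom.map_left e'.inv a m.2),
      fun a m => Prod.ext (Hom.map_right e.inv a m.1) (Hom.map_right e'.inv a m.2),
      fun i _ h => ⟨Hom.map_gr e.inv i _ h.1, Hom.map_gr e'.inv i _ h.2⟩⟩
    (fun m => Prod.ext (iso_hom_inv e m.1) (iso_hom_inv e' m.2))
    (fun m => Prod.ext (iso_inv_hom e m.1) (iso_inv_hom e' m.2))

def sumComm (M N : GrBimod) : sum M N ≅ sum N M :=
  mkIso ⟨(LinearEquiv.prodComm ℂ _ _).toLinearMap, fun _ _ => rfl, fun _ _ => rfl,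
      fun _ _ h => ⟨h.2, h.1⟩⟩
    ⟨(LinearEquiv.prodComm ℂ _ _).toLinearMap, fun _ _ => rfl, fun _ _ => rfl,
      fun _ _ h => ⟨h.2, h.1⟩⟩
    (fun _ => rfl) (fun _ => rfl)

def sumAssoc (M N P : GrBimod) : sum (sum M N) P ≅ sum M (sum N P) :=
  mkIso ⟨(LinearEquiv.prodAssoc ℂ _ _ _).toLinearMap, fun _ _ => rfl, fun _ _ => rfl,
      fun _ _ h => ⟨h.1.1, h.1.2, h.2⟩⟩
    ⟨(LinearEquiv.prodAssoc ℂ _ _ _).symm.toLinearMap, fun _ _ => rfl, fun _ _ => rfl,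
      fun _ _ h => ⟨⟨h.1, h.2.1⟩, h.2.2⟩⟩
    (fun _ => rfl) (fun _ => rfl)

def zeroSum (M : GrBimod) : sum zero M ≅ M :=
  mkIso ⟨LinearMap.snd ℂ _ _, fun _ _ => rfl, fun _ _ => rfl, fun _ _ h => h.2⟩
    ⟨LinearMap.inr ℂ _ _, fun _ _ => rfl, fun _ _ => rfl, fun _ _ h => ⟨trivial, h⟩⟩
    (fun _ => rfl) (fun _ => rfl)

/-- The zero morphism. -/
def zeroHom (M N : GrBimod) : Hom M N :=
  ⟨0, fun _ _ => by simp, fun _ _ => by simp, fun _ _ _ => by simp⟩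

def zeroTensor (M : GrBimod) : tensor zero M ≅ zero :=
  tensIso (zeroHom _ _) (zeroHom _ _) (fun _ n => (tmk_zero_left n).symm) (fun _ => rfl)

def tensorZero (M : GrBimod) : tensor M zero ≅ zero :=
  tensIso (zeroHom _ _) (zeroHom _ _) (fun m _ => (tmk_zero_right m).symm) (fun _ => rfl)

/-- Left multiplication `R ⊗ M → M`. -/
def unitTensorHom (M : GrBimod) : Hom (tensor unit M) M :=
  tensHom (M := unit) M.left.toLinearMap
    (fun r m n => by
      change M.left (r * m) n = M.left m (M.left r n)
      rw [mul_comm, map_mul]; rfl)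
    (fun a m n => by
      change M.left (a * m) n = M.left a (M.left m n)
      rw [map_mul]; rfl)
    (fun a m n => M.left_right m a n)
    (by
      intro i j p hp n hn
      have hX : ∀ k : ℕ, M.left (Polynomial.X ^ k) n ∈ M.gr (2 * k + j) := by
        intro k
        induction k with
        | zero => simpa using hn
        | succ k ih =>
          rw [pow_succ', map_mul]
          have := M.left_mem _ _ ih
          rwa [show (2 * (k : ℤ) + j + 2) = 2 * ((k + 1 : ℕ) : ℤ) + j by push_cast; ring] at this
      refine (Submodule.span_le (p := (M.gr (i + j)).comap
        (M.left.toLinearMap.flip n))).2 ?_ hp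
      rintro _ ⟨k, rfl, rfl⟩
      exact hX k)

/-- Right multiplication `M ⊗ R → M`. -/
def tensorUnitHom (M : GrBimod) : Hom (tensor M unit) M :=
  tensHom (N := unit) M.right.toLinearMap.flip
    (fun r m n => by
      change M.right n (M.right r m) = M.right (r * n) m
      rw [mul_comm, map_mul]; rfl)
    (fun a m n => (M.left_right a n m).symm)
    (fun a m n => by
      change M.right (a * n) m = M.right a (M.right n m)
      rw [map_mul]; rfl)
    (by
      intro i j m hm p hp
      have hX : ∀ k : ℕ, M.right (Polynomial.X ^ k) m ∈ M.gr (i + 2 * k) := by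
        intro k
        induction k with
        | zero => simpa using hm
        | succ k ih =>
          rw [pow_succ', map_mul]
          have := M.right_mem _ _ ih
          rwa [show (i + 2 * (k : ℤ) + 2) = i + 2 * ((k + 1 : ℕ) : ℤ) by push_cast; ring] at this
      refine (Submodule.span_le (p := (M.gr (i + j)).comap
        (M.right.toLinearMap.flip m))).2 ?_ hp
      rintro _ ⟨k, rfl, rfl⟩
      exact hX k)

theorem one_mem_unit : (1 : R) ∈ unit.gr 0 := Submodule.subset_span ⟨0, by simp, by simp⟩

def unitTensor (M : GrBimod) : tensor unit M ≅ M :=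
  tensIso (unitTensorHom M)
    ⟨tmkL unit M (1 : R),
      fun a m => by
        change (tmk (1 : R) (M.left a m) : Tens unit M) = tmk (a * 1) m
        rw [← tmk_balance]; rfl,
      fun a m => rfl,
      fun i m h => by
        have := tmk_mem one_mem_unit h
        rwa [zero_add] at this⟩
    (fun p m => by
      change (tmk (1 : R) (M.left p m) : Tens unit M) = tmk p m
      rw [← tmk_balance]
      exact congrArg (fun x => (tmk x m : Tens unit M)) (mul_one p))
    (fun m => by change M.left 1 m = m; simp)

def tensorUnit (M : GrBimod) : tensor M unit ≅ M :=
  tensIso (tensorUnitHom M)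
    ⟨(tmkL M unit).flip (1 : R),
      fun a m => rfl,
      fun a m => by
        change (tmk (M.right a m) (1 : R) : Tens M unit) = tmk m (a * 1)
        rw [tmk_balance]; rfl,
      fun i m h => by
        have := tmk_mem h one_mem_unit
        rwa [add_zero] at this⟩
    (fun m p => by
      change (tmk (M.right p m) (1 : R) : Tens M unit) = tmk m p
      rw [tmk_balance]
      exact congrArg (fun x => (tmk m x : Tens M unit)) (mul_one p))
    (fun m => by change M.right 1 m = m; simp)

def inlHom (M N : GrBimod) : Hom M (sum M N) :=
  ⟨LinearMap.inl ℂ _ _, fun a _ => Prod.ext rfl (map_zero (N.left a)).symm,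
    fun a _ => Prod.ext rfl (map_zero (N.right a)).symm, fun _ _ h => ⟨h, Submodule.zero_mem _⟩⟩

def inrHom (M N : GrBimod) : Hom N (sum M N) :=
  ⟨LinearMap.inr ℂ _ _, fun a _ => Prod.ext (map_zero (M.left a)).symm rfl,
    fun a _ => Prod.ext (map_zero (M.right a)).symm rfl, fun _ _ h => ⟨Submodule.zero_mem _, h⟩⟩

def fstHom (M N : GrBimod) : Hom (sum M N) M :=
  ⟨LinearMap.fst ℂ _ _, fun _ _ => rfl, fun _ _ => rfl, fun _ _ h => h.1⟩

def sndHom (M N : GrBimod) : Hom (sum M N) N :=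
  ⟨LinearMap.snd ℂ _ _, fun _ _ => rfl, fun _ _ => rfl, fun _ _ h => h.2⟩

/-- The morphism into a direct sum with the given components. -/
def pairHom {M N P : GrBimod} (f : Hom P M) (g : Hom P N) : Hom P (sum M N) :=
  ⟨f.toLin.prod g.toLin, fun a m => Prod.ext (f.map_left a m) (g.map_left a m),
    fun a m => Prod.ext (f.map_right a m) (g.map_right a m),
    fun i m h => ⟨f.map_gr i m h, g.map_gr i m h⟩⟩

/-- The morphism out of a direct sum with the given components. -/
def copairHom {M N P : GrBimod} (f : Hom M P) (g : Hom N P) : Hom (sum M N) P :=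
  ⟨f.toLin.coprod g.toLin,
    fun a m => by
      change f.toLin (M.left a m.1) + g.toLin (N.left a m.2) =
        P.left a (f.toLin m.1 + g.toLin m.2)
      rw [map_add, f.map_left, g.map_left],
    fun a m => by
      change f.toLin (M.right a m.1) + g.toLin (N.right a m.2) =
        P.right a (f.toLin m.1 + g.toLin m.2)
      rw [map_add, f.map_right, g.map_right],
    fun i m h => Submodule.add_mem _ (f.map_gr i _ h.1) (g.map_gr i _ h.2)⟩

theorem sum_tens_induction {M N M' N' : GrBimod} {p : Tens M N × Tens M' N' → Prop}
    (x : Tens M N × Tens M' N') (h₁ : ∀ m n, p (tmk m n, 0)) (h₂ : ∀ m n, p (0, tmk m n))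
    (hadd : ∀ x y, p x → p y → p (x + y)) : p x := by
  have h1 : p (x.1, 0) := tens_induction (p := fun t => p (t, 0)) x.1 h₁ fun a b ha hb => by
    have := hadd _ _ ha hb
    rwa [Prod.mk_add_mk, add_zero] at this
  have h2 : p (0, x.2) := tens_induction (p := fun t => p (0, t)) x.2 h₂ fun a b ha hb => by
    have := hadd _ _ ha hb
    rwa [Prod.mk_add_mk, add_zero] at this
  have := hadd _ _ h1 h2
  rwa [Prod.mk_add_mk, add_zero, zero_add] at this

def sumTensor (M N P : GrBimod) : tensor (sum M N) P ≅ sum (tensor M P) (tensor N P) :=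
  tensIso
    (pairHom (tensorMap (fstHom M N) (𝟙 P)) (tensorMap (sndHom M N) (𝟙 P)))
    (copairHom (tensorMap (inlHom M N) (𝟙 P)) (tensorMap (inrHom M N) (𝟙 P)))
    (fun m n => by
      change (tmk (m.1, 0) n + tmk (0, m.2) n : Tens (sum M N) P) = tmk m n
      rw [← tmk_add_left]
      exact congrArg (fun x => tmk x n) (Prod.ext (add_zero _) (zero_add _)))
    (fun x => by
      refine sum_tens_induction (p := fun x =>
        (pairHom (tensorMap (fstHom M N) (𝟙 P)) (tensorMap (sndHom M N) (𝟙 P))).toLin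
        ((copairHom (tensorMap (inlHom M N) (𝟙 P)) (tensorMap (inrHom M N) (𝟙 P))).toLin x) = x)
        x (fun m n => ?_) (fun m n => ?_) fun x y hx hy => by rw [map_add, map_add, hx, hy]
      · change ((pairHom (tensorMap (fstHom M N) (𝟙 P)) (tensorMap (sndHom M N) (𝟙 P))).toLin
          (tmk (m, 0) n + (tensorMap (inrHom M N) (𝟙 P)).toLin 0)) = _
        rw [map_zero, add_zero]
        exact Prod.ext rfl (tmk_zero_left n)
      · change ((pairHom (tensorMap (fstHom M N) (𝟙 P)) (tensorMap (sndHom M N) (𝟙 P))).toLin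
          ((tensorMap (inlHom M N) (𝟙 P)).toLin 0 + tmk (0, m) n)) = _
        rw [map_zero, zero_add]
        exact Prod.ext (tmk_zero_left n) rfl)

def tensorSum (M N P : GrBimod) : tensor M (sum N P) ≅ sum (tensor M N) (tensor M P) :=
  tensIso
    (pairHom (tensorMap (𝟙 M) (fstHom N P)) (tensorMap (𝟙 M) (sndHom N P)))
    (copairHom (tensorMap (𝟙 M) (inlHom N P)) (tensorMap (𝟙 M) (inrHom N P)))
    (fun m n => by
      change (tmk m (n.1, 0) + tmk m (0, n.2) : Tens M (sum N P)) = tmk m n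
      rw [← tmk_add_right]
      exact congrArg (tmk m) (Prod.ext (add_zero _) (zero_add _)))
    (fun x => by
      refine sum_tens_induction (p := fun x =>
        (pairHom (tensorMap (𝟙 M) (fstHom N P)) (tensorMap (𝟙 M) (sndHom N P))).toLin
        ((copairHom (tensorMap (𝟙 M) (inlHom N P)) (tensorMap (𝟙 M) (inrHom N P))).toLin x) = x)
        x (fun m n => ?_) (fun m n => ?_) fun x y hx hy => by rw [map_add, map_add, hx, hy]
      · change ((pairHom (tensorMap (𝟙 M) (fstHom N P)) (tensorMap (𝟙 M) (sndHom N P))).toLin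
          (tmk m (n, 0) + (tensorMap (𝟙 M) (inrHom N P)).toLin 0)) = _
        rw [map_zero, add_zero]
        exact Prod.ext rfl (tmk_zero_right m)
      · change ((pairHom (tensorMap (𝟙 M) (fstHom N P)) (tensorMap (𝟙 M) (sndHom N P))).toLin
          ((tensorMap (𝟙 M) (inlHom N P)).toLin 0 + tmk m (0, n))) = _
        rw [map_zero, zero_add]
        exact Prod.ext (tmk_zero_right m) rfl)

/-- `p ↦ (m ⊗ n ↦ m ⊗ (n ⊗ p))`. -/
def assocAux (M N P : GrBimod) :
    Tens M N →ₗ[ℂ] P.carrier →ₗ[ℂ] Tens M (tensor N P) :=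
  tlift (LinearMap.mk₂ ℂ (fun m n => tmkL M (tensor N P) m ∘ₗ tmkL N P n)
      (fun _ _ _ => LinearMap.ext fun _ => tmk_add_left (N := tensor N P) _ _ _)
      (fun _ _ _ => LinearMap.ext fun _ => tmk_smul_left (N := tensor N P) _ _ _)
      (fun m n n' => LinearMap.ext fun p => by
        change (tmk m (tmk (n + n') p : Tens N P) : Tens M (tensor N P)) =
          tmk m (tmk n p : Tens N P) + tmk m (tmk n' p : Tens N P)
        rw [tmk_add_left]; exact tmk_add_right (N := tensor N P) _ _ _)
      (fun c m n => LinearMap.ext fun p => by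
        change (tmk m (tmk (c • n) p : Tens N P) : Tens M (tensor N P)) =
          c • tmk m (tmk n p : Tens N P)
        rw [tmk_smul_left]; exact tmk_smul_right (N := tensor N P) _ _ _))
    (fun r m n => LinearMap.ext fun p => tmk_balance (N := tensor N P) r m (tmk n p : Tens N P))

def assocHom (M N P : GrBimod) : Hom (tensor (tensor M N) P) (tensor M (tensor N P)) :=
  tensHom (M := tensor M N) (P := tensor M (tensor N P)) (assocAux M N P)
    (fun r t p => by
      refine tens_induction (p := fun t => assocAux M N P (tensRight M N r t) p =
        assocAux M N P t (P.left r p)) t (fun m n => ?_) fun x y hx hy => by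
          simp only [map_add, LinearMap.add_apply, hx, hy]
      change (tmk m (tmk (N.right r n) p : Tens N P) : Tens M (tensor N P)) =
        tmk m (tmk n (P.left r p) : Tens N P)
      rw [tmk_balance])
    (fun a t p => by
      refine tens_induction (p := fun t => assocAux M N P (tensLeft M N a t) p =
        tensLeft M (tensor N P) a (assocAux M N P t p)) t (fun m n => rfl) fun x y hx hy => by
          simp only [map_add, LinearMap.add_apply, hx, hy])
    (fun a t p => by
      refine tens_induction (p := fun t => assocAux M N P t (P.right a p) =
        tensRight M (tensor N P) a (assocAux M N P t p)) t (fun m n => rfl) fun x y hx hy => by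
          simp only [map_add, LinearMap.add_apply, hx, hy])
    (fun k l t ht p hp => by
      have : tensGr M N k ≤ (tensGr M (tensor N P) (k + l)).comap
          ((assocAux M N P).flip p) := by
        refine tensGr_le ?_
        rintro i j rfl m hm n hn
        rw [add_assoc]
        exact tmk_mem (N := tensor N P) hm (tmk_mem hn hp)
      exact this ht)

/-- `(n ⊗ p) ↦ (m ↦ (m ⊗ n) ⊗ p)`. -/
def assocAux' (M N P : GrBimod) :
    Tens N P →ₗ[ℂ] M.carrier →ₗ[ℂ] Tens (tensor M N) P :=
  tlift (LinearMap.mk₂ ℂ (fun n p => (tmkL (tensor M N) P).flip p ∘ₗ (tmkL M N).flip n)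
      (fun n n' p => LinearMap.ext fun m => by
        change (tmk (tmk m (n + n') : Tens M N) p : Tens (tensor M N) P) =
          tmk (tmk m n : Tens M N) p + tmk (tmk m n' : Tens M N) p
        rw [tmk_add_right]; exact tmk_add_left (M := tensor M N) _ _ _)
      (fun c n p => LinearMap.ext fun m => by
        change (tmk (tmk m (c • n) : Tens M N) p : Tens (tensor M N) P) =
          c • tmk (tmk m n : Tens M N) p
        rw [tmk_smul_right]; exact tmk_smul_left (M := tensor M N) _ _ _)
      (fun _ _ _ => LinearMap.ext fun _ => tmk_add_right (M := tensor M N) _ _ _)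
      (fun _ _ _ => LinearMap.ext fun _ => tmk_smul_right (M := tensor M N) _ _ _))
    (fun r n p => LinearMap.ext fun m => tmk_balance (M := tensor M N) r (tmk m n : Tens M N) p)

def assocInv (M N P : GrBimod) : Hom (tensor M (tensor N P)) (tensor (tensor M N) P) :=
  tensHom (N := tensor N P) (P := tensor (tensor M N) P) (assocAux' M N P).flip
    (fun r m t => by
      refine tens_induction (p := fun t => assocAux' M N P t (M.right r m) =
        assocAux' M N P (tensLeft N P r t) m) t (fun n p => ?_) fun x y hx hy => by
          simp only [map_add, LinearMap.add_apply, hx, hy]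
      change (tmk (tmk (M.right r m) n : Tens M N) p : Tens (tensor M N) P) =
        tmk (tmk m (N.left r n) : Tens M N) p
      rw [tmk_balance])
    (fun a m t => by
      refine tens_induction (p := fun t => assocAux' M N P t (M.left a m) =
        tensLeft (tensor M N) P a (assocAux' M N P t m)) t (fun n p => rfl) fun x y hx hy => by
          simp only [map_add, LinearMap.add_apply, hx, hy])
    (fun a m t => by
      refine tens_induction (p := fun t => assocAux' M N P (tensRight N P a t) m =
        tensRight (tensor M N) P a (assocAux' M N P t m)) t (fun n p => rfl) fun x y hx hy => by
          simp only [map_add, LinearMap.add_apply, hx, hy])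
    (fun k l m hm t ht => by
      have : tensGr N P l ≤ (tensGr (tensor M N) P (k + l)).comap
          ((assocAux' M N P).flip m) := by
        refine tensGr_le ?_
        rintro i j rfl n hn p hp
        rw [← add_assoc]
        exact tmk_mem (M := tensor M N) (tmk_mem hm hn) hp
      exact this ht)

def tensorAssoc (M N P : GrBimod) : tensor (tensor M N) P ≅ tensor M (tensor N P) :=
  tensIso (M := tensor M N) (assocHom M N P) (assocInv M N P)
    (fun t p => by
      refine tens_induction (p := fun t => (assocInv M N P).toLin
        ((assocHom M N P).toLin (tmk (M := tensor M N) t p)) = tmk (M := tensor M N) t p) t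
        (fun m n => rfl) fun x y hx hy => ?_
      have h := tmk_add_left (M := tensor M N) x y p
      rw [h, map_add, map_add, hx, hy])
    (fun t => by
      refine tens_induction (M := M) (N := tensor N P) (p := fun t => (assocHom M N P).toLin
        ((assocInv M N P).toLin t) = t) t (fun m u => ?_)
        fun x y hx hy => by rw [map_add, map_add, hx, hy]
      refine tens_induction (p := fun u => (assocHom M N P).toLin
        ((assocInv M N P).toLin (tmk (N := tensor N P) m u)) = tmk (N := tensor N P) m u) u
        (fun m n => rfl) fun x y hx hy => ?_
      have h := tmk_add_right (N := tensor N P) m x y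
      rw [h, map_add, map_add, hx, hy])

/-! ### Shifts -/

def shiftCongr {M N : GrBimod} (e : M ≅ N) (k : ℤ) : shift M k ≅ shift N k :=
  mkIso
    ⟨Hom.toLin (M := M) (N := N) e.hom, Hom.map_left (M := M) (N := N) e.hom,
      Hom.map_right (M := M) (N := N) e.hom,
      fun i m h => Hom.map_gr (M := M) (N := N) e.hom (i + k) m h⟩
    ⟨Hom.toLin (M := N) (N := M) e.inv, Hom.map_left (M := N) (N := M) e.inv,
      Hom.map_right (M := N) (N := M) e.inv,
      fun i m h => Hom.map_gr (M := N) (N := M) e.inv (i + k) m h⟩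
    (iso_hom_inv e) (iso_inv_hom e)

def shiftZero (M : GrBimod) : shift M 0 ≅ M :=
  mkIso ⟨LinearMap.id, fun _ _ => rfl, fun _ _ => rfl,
      fun i m h => by change m ∈ M.gr (i + 0) at h; rwa [add_zero] at h⟩
    ⟨LinearMap.id, fun _ _ => rfl, fun _ _ => rfl,
      fun i m h => by change m ∈ M.gr (i + 0); rwa [add_zero]⟩
    (fun _ => rfl) (fun _ => rfl)

def shiftShift (M : GrBimod) (a b : ℤ) : shift (shift M b) a ≅ shift M (a + b) :=
  mkIso ⟨LinearMap.id, fun _ _ => rfl, fun _ _ => rfl,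
      fun i m h => by change m ∈ M.gr (i + a + b) at h; rwa [add_assoc] at h⟩
    ⟨LinearMap.id, fun _ _ => rfl, fun _ _ => rfl,
      fun i m h => by change m ∈ M.gr (i + a + b); rwa [add_assoc]⟩
    (fun _ => rfl) (fun _ => rfl)

def shiftTensor (M N : GrBimod) (k : ℤ) : tensor (shift M k) N ≅ shift (tensor M N) k :=
  mkIso
    ⟨LinearMap.id, fun _ _ => rfl, fun _ _ => rfl, fun l t ht => by
      refine (tensGr_le (M := shift M k) (S := tensGr M N (l + k)) ?_) ht
      rintro i j rfl m hm n hn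
      rw [add_right_comm]
      exact tmk_mem (M := M) hm hn⟩
    ⟨LinearMap.id, fun _ _ => rfl, fun _ _ => rfl, fun l t ht => by
      refine (tensGr_le (M := M) (S := tensGr (shift M k) N l) ?_) ht
      rintro i j hij m hm n hn
      rw [show l = (i - k) + j by omega]
      refine tmk_mem (M := shift M k) ?_ hn
      change m ∈ M.gr (i - k + k)
      rwa [sub_add_cancel]⟩
    (fun _ => rfl) (fun _ => rfl)

def tensorShift (M N : GrBimod) (k : ℤ) : tensor M (shift N k) ≅ shift (tensor M N) k :=
  mkIso
    ⟨LinearMap.id, fun _ _ => rfl, fun _ _ => rfl, fun l t ht => by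
      refine (tensGr_le (N := shift N k) (S := tensGr M N (l + k)) ?_) ht
      rintro i j rfl m hm n hn
      rw [add_assoc]
      exact tmk_mem (N := N) hm hn⟩
    ⟨LinearMap.id, fun _ _ => rfl, fun _ _ => rfl, fun l t ht => by
      refine (tensGr_le (N := N) (S := tensGr M (shift N k) l) ?_) ht
      rintro i j hij m hm n hn
      rw [show l = i + (j - k) by omega]
      refine tmk_mem (N := shift N k) hm ?_
      change n ∈ N.gr (j - k + k)
      rwa [sub_add_cancel]⟩
    (fun _ => rfl) (fun _ => rfl)

end GrBimod

/-! ### The semiring of isomorphism classes of graded bimodules -/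

open GrBimod

/-- Isomorphism classes of graded `R`-bimodules. -/
def IsoClass : Type 1 := Quotient (isIsomorphicSetoid GrBimod)

/-- The isomorphism class of a graded bimodule. -/
def isoClass (M : GrBimod) : IsoClass := Quotient.mk (isIsomorphicSetoid GrBimod) M

theorem isoClass_eq {M N : GrBimod} (e : M ≅ N) : isoClass M = isoClass N := Quotient.sound ⟨e⟩

instance : Add IsoClass :=
  ⟨Quotient.map₂ GrBimod.sum fun _ _ ⟨e⟩ _ _ ⟨e'⟩ => ⟨sumCongr e e'⟩⟩

instance : Mul IsoClass :=
  ⟨Quotient.map₂ GrBimod.tensor fun _ _ ⟨e⟩ _ _ ⟨e'⟩ => ⟨tensorCongr e e'⟩⟩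

instance : Zero IsoClass := ⟨isoClass GrBimod.zero⟩

instance : One IsoClass := ⟨isoClass GrBimod.unit⟩

/-- Isomorphism classes form a semiring under direct sum and tensor product over `R`. -/
instance : Semiring IsoClass where
  nsmul := nsmulRec
  add_assoc := by rintro ⟨M⟩ ⟨N⟩ ⟨P⟩; exact isoClass_eq (sumAssoc M N P)
  zero_add := by rintro ⟨M⟩; exact isoClass_eq (zeroSum M)
  add_zero := by rintro ⟨M⟩; exact isoClass_eq (sumComm M zero ≪≫ zeroSum M)
  add_comm := by rintro ⟨M⟩ ⟨N⟩; exact isoClass_eq (sumComm M N)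
  mul_assoc := by rintro ⟨M⟩ ⟨N⟩ ⟨P⟩; exact isoClass_eq (tensorAssoc M N P)
  one_mul := by rintro ⟨M⟩; exact isoClass_eq (unitTensor M)
  mul_one := by rintro ⟨M⟩; exact isoClass_eq (tensorUnit M)
  left_distrib := by rintro ⟨M⟩ ⟨N⟩ ⟨P⟩; exact isoClass_eq (tensorSum M N P)
  right_distrib := by rintro ⟨M⟩ ⟨N⟩ ⟨P⟩; exact isoClass_eq (sumTensor M N P)
  zero_mul := by rintro ⟨M⟩; exact isoClass_eq (zeroTensor M)
  mul_zero := by rintro ⟨M⟩; exact isoClass_eq (tensorZero M)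

theorem isoClass_sum (M N : GrBimod) : isoClass (sum M N) = isoClass M + isoClass N := rfl
theorem isoClass_tensor (M N : GrBimod) : isoClass (tensor M N) = isoClass M * isoClass N := rfl
theorem isoClass_zero : isoClass zero = 0 := rfl
theorem isoClass_unit : isoClass unit = 1 := rfl

/-! ### The category `𝓑_W` and its split Grothendieck ring -/

/-- The objects of the (full, replete) subcategory `𝓑_W` of graded bimodules generated by
`𝒪(e, s)`, where `s ∈ GL(V) = ℂˣ`: the smallest class of graded `R`-bimodules which contains
`𝒪(e, s)`, the unit and zero, and is closed under isomorphisms, grading shifts, direct sums,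
tensor products over `R` and direct summands. -/
inductive BW (s : ℂˣ) : GrBimod → Prop
  | gen : BW s (O {1, s})
  | unit : BW s GrBimod.unit
  | zero : BW s GrBimod.zero
  | tensor {M N : GrBimod} : BW s M → BW s N → BW s (M.tensor N)
  | sum {M N : GrBimod} : BW s M → BW s N → BW s (M.sum N)
  | shift {M : GrBimod} (n : ℤ) : BW s M → BW s (M.shift n)
  | summand {M N : GrBimod} : BW s (M.sum N) → BW s M
  | iso {M N : GrBimod} : BW s M → Nonempty (M ≅ N) → BW s N

/-- The semiring of isomorphism classes of objects of `𝓑_W`. -/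
def BWClasses (s : ℂˣ) : Subsemiring IsoClass where
  carrier := {c | ∃ M, BW s M ∧ isoClass M = c}
  mul_mem' := by
    rintro _ _ ⟨M, hM, rfl⟩ ⟨N, hN, rfl⟩
    exact ⟨M.tensor N, hM.tensor hN, rfl⟩
  one_mem' := ⟨_, BW.unit, rfl⟩
  add_mem' := by
    rintro _ _ ⟨M, hM, rfl⟩ ⟨N, hN, rfl⟩
    exact ⟨M.sum N, hM.sum hN, rfl⟩
  zero_mem' := ⟨_, BW.zero, rfl⟩

/-- In the free abelian group on the classes of objects of `𝓑_W` (with the product induced by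
`⊗`), the subgroup generated by all `[M ⊕ N] - [M] - [N]`. -/
def splitRel (s : ℂˣ) : AddSubgroup (MonoidAlgebra ℤ (BWClasses s)) :=
  AddSubgroup.closure {x | ∃ a b : BWClasses s,
    x = MonoidAlgebra.of ℤ _ (a + b) - MonoidAlgebra.of ℤ _ a - MonoidAlgebra.of ℤ _ b}

theorem mul_mem_splitRel (s : ℂˣ) (y : MonoidAlgebra ℤ (BWClasses s))
    {x : MonoidAlgebra ℤ (BWClasses s)} (hx : x ∈ splitRel s) : y * x ∈ splitRel s := by
  induction y using MonoidAlgebra.induction_on with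
  | of c =>
    induction hx using AddSubgroup.closure_induction with
    | mem x hx =>
      obtain ⟨a, b, rfl⟩ := hx
      refine AddSubgroup.subset_closure ⟨c * a, c * b, ?_⟩
      rw [← mul_add, map_mul, map_mul, map_mul, mul_sub, mul_sub]
    | zero => rw [mul_zero]; exact zero_mem _
    | add x y _ _ hx hy => rw [mul_add]; exact add_mem hx hy
    | neg x _ hx => rw [mul_neg]; exact neg_mem hx
  | add f g hf hg => rw [add_mul]; exact add_mem hf hg
  | smul r f hf => rw [smul_mul_assoc]; exact zsmul_mem hf r

theorem splitRel_mul_mem (s : ℂˣ) (y : MonoidAlgebra ℤ (BWClasses s))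
    {x : MonoidAlgebra ℤ (BWClasses s)} (hx : x ∈ splitRel s) : x * y ∈ splitRel s := by
  induction y using MonoidAlgebra.induction_on with
  | of c =>
    induction hx using AddSubgroup.closure_induction with
    | mem x hx =>
      obtain ⟨a, b, rfl⟩ := hx
      refine AddSubgroup.subset_closure ⟨a * c, b * c, ?_⟩
      rw [← add_mul, map_mul, map_mul, map_mul, sub_mul, sub_mul]
    | zero => rw [zero_mul]; exact zero_mem _
    | add x y _ _ hx hy => rw [add_mul]; exact add_mem hx hy
    | neg x _ hx => rw [neg_mul]; exact neg_mem hx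
  | add f g hf hg => rw [mul_add]; exact add_mem hf hg
  | smul r f hf => rw [mul_smul_comm]; exact zsmul_mem hf r

/-- Congruence modulo `splitRel`. -/
def splitCon (s : ℂˣ) : RingCon (MonoidAlgebra ℤ (BWClasses s)) where
  r x y := x - y ∈ splitRel s
  iseqv :=
    { refl := fun x => by simp [zero_mem]
      symm := fun {x y} h => by rw [← neg_sub]; exact neg_mem h
      trans := fun {x y z} h h' => by rw [← sub_add_sub_cancel x y z]; exact add_mem h h' }
  mul' {w x y z} h h' := by
    rw [show w * y - x * z = (w - x) * y + x * (y - z) by rw [sub_mul, mul_sub]; abel]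
    exact add_mem (splitRel_mul_mem s _ h) (mul_mem_splitRel s _ h')
  add' {w x y z} h h' := by
    rw [add_sub_add_comm]; exact add_mem h h'

/-- The split Grothendieck ring `A_W` of `𝓑_W`: the free abelian group on the isomorphism classes
of objects, modulo `[M ⊕ N] = [M] + [N]`, with the product `[M] [N] = [M ⊗_R N]`. -/
def AW (s : ℂˣ) : Type 1 := (splitCon s).Quotient

instance (s : ℂˣ) : Ring (AW s) := inferInstanceAs (Ring (splitCon s).Quotient)

/-- The canonical map from classes of objects to `A_W`. -/
def classHom (s : ℂˣ) : BWClasses s →* AW s :=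
  ((splitCon s).mk' : MonoidAlgebra ℤ (BWClasses s) →* (splitCon s).Quotient).comp
    (MonoidAlgebra.of ℤ (BWClasses s))

theorem classHom_add (s : ℂˣ) (a b : BWClasses s) :
    classHom s (a + b) = classHom s a + classHom s b := by
  refine ((splitCon s).eq.2 ?_).trans (map_add (splitCon s).mk' _ _)
  change _ - (_ + _) ∈ splitRel s
  rw [← sub_sub]
  exact AddSubgroup.subset_closure ⟨a, b, rfl⟩

/-- The class in `A_W` of an object of `𝓑_W`. -/
def cls (s : ℂˣ) (M : GrBimod) (hM : BW s M) : AW s :=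
  classHom s ⟨isoClass M, M, hM, rfl⟩

theorem cls_iso {s : ℂˣ} {M N : GrBimod} (hM : BW s M) (hN : BW s N) (e : M ≅ N) :
    cls s M hM = cls s N hN := by
  have : (⟨isoClass M, M, hM, rfl⟩ : BWClasses s) = ⟨isoClass N, N, hN, rfl⟩ :=
    Subtype.ext (isoClass_eq e)
  rw [cls, cls, this]

theorem cls_tensor {s : ℂˣ} {M N : GrBimod} (hM : BW s M) (hN : BW s N) :
    cls s (M.tensor N) (hM.tensor hN) = cls s M hM * cls s N hN :=
  map_mul (classHom s) ⟨isoClass M, M, hM, rfl⟩ ⟨isoClass N, N, hN, rfl⟩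

theorem cls_sum {s : ℂˣ} {M N : GrBimod} (hM : BW s M) (hN : BW s N) :
    cls s (M.sum N) (hM.sum hN) = cls s M hM + cls s N hN :=
  classHom_add s ⟨isoClass M, M, hM, rfl⟩ ⟨isoClass N, N, hN, rfl⟩

theorem cls_unit (s : ℂˣ) : cls s GrBimod.unit BW.unit = 1 := map_one (classHom s)

/-- Multiplication by the class of `R[n]` is the shift by `n`, on the left ... -/
theorem cls_shift_mul {s : ℂˣ} {M : GrBimod} (hM : BW s M) (n : ℤ) :
    cls s (GrBimod.unit.shift n) (BW.unit.shift n) * cls s M hM =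
      cls s (M.shift n) (hM.shift n) := by
  rw [← cls_tensor]
  exact cls_iso _ _ (shiftTensor _ _ _ ≪≫ shiftCongr (unitTensor M) n)

/-- ... and on the right. -/
theorem cls_mul_shift {s : ℂˣ} {M : GrBimod} (hM : BW s M) (n : ℤ) :
    cls s M hM * cls s (GrBimod.unit.shift n) (BW.unit.shift n) =
      cls s (M.shift n) (hM.shift n) := by
  rw [← cls_tensor]
  exact cls_iso _ _ (tensorShift _ _ _ ≪≫ shiftCongr (tensorUnit M) n)

/-- The classes of objects generate `A_W` as an abelian group. -/
theorem AW_induction {s : ℂˣ} {p : AW s → Prop} (x : AW s) (h : ∀ M hM, p (cls s M hM))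
    (h0 : p 0) (hadd : ∀ x y, p x → p y → p (x + y)) (hneg : ∀ x, p x → p (-x)) : p x := by
  obtain ⟨y, rfl⟩ := (splitCon s).mk'_surjective x
  induction y using MonoidAlgebra.induction_on with
  | of c =>
    obtain ⟨_, M, hM, rfl⟩ := c
    exact h M hM
  | add f g hf hg => rw [map_add]; exact hadd _ _ hf hg
  | smul r f hf =>
    rw [map_zsmul]
    induction r with
    | zero => rw [zero_smul]; exact h0
    | succ n ih => rw [add_smul, one_smul]; exact hadd _ _ ih hf
    | pred n ih => rw [sub_smul, one_smul, sub_eq_add_neg]; exact hadd _ _ ih (hneg _ hf)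

/-- `v ^ n ↦ [R[n]]`. -/
def shiftHom (s : ℂˣ) : Multiplicative ℤ →* AW s where
  toFun n := cls s (GrBimod.unit.shift n.toAdd) (BW.unit.shift _)
  map_one' := (cls_iso _ _ (shiftZero _)).trans (cls_unit s)
  map_mul' a b := by
    rw [cls_shift_mul]
    exact (cls_iso _ _ (shiftShift _ _ _)).symm

/-- The structure morphism `ℤ[v, v⁻¹] → A_W`, `v ^ n ↦ [R[n]]`. -/
def structureHom (s : ℂˣ) : LaurentPolynomial ℤ →+* AW s :=
  (AddMonoidAlgebra.lift ℤ (AW s) ℤ (shiftHom s)).toRingHom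

theorem structureHom_T (s : ℂˣ) (n : ℤ) : structureHom s (LaurentPolynomial.T n) =
    cls s (GrBimod.unit.shift n) (BW.unit.shift n) := by
  have := AddMonoidAlgebra.lift_single (R := ℤ) (shiftHom s) n (1 : ℤ)
  rw [one_smul] at this
  exact this

theorem structureHom_comm (s : ℂˣ) (p : LaurentPolynomial ℤ) (x : AW s) :
    structureHom s p * x = x * structureHom s p := by
  induction p using LaurentPolynomial.induction_on' with
  | add p q hp hq => rw [map_add, add_mul, mul_add, hp, hq]
  | C_mul_T n a =>
    have h : structureHom s (LaurentPolynomial.T n) * x =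
        x * structureHom s (LaurentPolynomial.T n) := by
      rw [structureHom_T]
      refine AW_induction (p := fun x =>
        cls s (GrBimod.unit.shift n) (BW.unit.shift n) * x =
          x * cls s (GrBimod.unit.shift n) (BW.unit.shift n)) x (fun M hM => ?_) (by simp)
        (fun x y hx hy => by rw [mul_add, add_mul, hx, hy])
        (fun x hx => by rw [mul_neg, neg_mul, hx])
      rw [cls_shift_mul, cls_mul_shift]
    have hC : structureHom s (LaurentPolynomial.C a) = (a : AW s) := by
      rw [eq_intCast LaurentPolynomial.C a, map_intCast]
    rw [map_mul, hC, mul_assoc, h, ← mul_assoc, ← mul_assoc, Int.cast_comm]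

/-- `A_W` is a `ℤ[v, v⁻¹]`-algebra, where `v` acts by the grading shift `[1]`. -/
instance (s : ℂˣ) : Algebra (LaurentPolynomial ℤ) (AW s) :=
  (structureHom s).toAlgebra' (structureHom_comm s)

theorem T_smul_cls {s : ℂˣ} {M : GrBimod} (hM : BW s M) (n : ℤ) :
    (LaurentPolynomial.T n : LaurentPolynomial ℤ) • cls s M hM =
      cls s (M.shift n) (hM.shift n) := by
  rw [Algebra.smul_def]
  exact (congrArg (· * _) (structureHom_T s n)).trans (cls_shift_mul hM n)

/-! ### The presented algebra -/

/-- The generators: `s`, and `C i` for the generator `C_{i+1}`, `0 ≤ i < d - 1`. -/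
inductive Gen (d : ℕ) : Type
  | s : Gen d
  | C (i : Fin (d - 1)) : Gen d

/-- The free `ℤ[v, v⁻¹]`-algebra on the generators. -/
abbrev Free (d : ℕ) : Type := FreeAlgebra (LaurentPolynomial ℤ) (Gen d)

/-- The generator `s`. -/
def genS (d : ℕ) : Free d := FreeAlgebra.ι _ Gen.s

/-- The generator `C_i` for `1 ≤ i ≤ d - 1`, with the convention `C_0 = 1`. (The value `0` for
`i ≥ d` is never used.) -/
def genC (d : ℕ) : ℕ → Free d
  | 0 => 1
  | i + 1 => if h : i < d - 1 then FreeAlgebra.ι _ (Gen.C ⟨i, h⟩) else 0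

/-- The defining relations. -/
inductive Rel (d : ℕ) : Free d → Free d → Prop
  | s_pow : Rel d (genS d ^ d) 1
  | C_comm (i j : ℕ) (hi : 1 ≤ i ∧ i ≤ d - 1) (hj : 1 ≤ j ∧ j ≤ d - 1) :
      Rel d (genC d i * genC d j) (genC d j * genC d i)
  | s_comm (i : ℕ) (hi : 1 ≤ i ∧ i ≤ d - 1) : Rel d (genS d * genC d i) (genC d i * genS d)
  | C_one_mul (i : ℕ) (hi : 1 ≤ i ∧ i ≤ d - 2) :
      Rel d (genC d 1 * genC d i) (genC d (i + 1) + genS d * genC d (i - 1))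
  | C_one_mul_last : Rel d (genC d 1 * genC d (d - 1))
      ((LaurentPolynomial.T 1 + LaurentPolynomial.T (-1) : LaurentPolynomial ℤ) • genC d (d - 1))
  | s_mul_last : Rel d (genS d * genC d (d - 1)) (genC d (d - 1))

/-- The algebra with the above generators and relations. -/
abbrev Presented (d : ℕ) : Type := RingQuot (Rel d)

/-- The image of a word in the presented algebra. -/
abbrev toPresented (d : ℕ) : Free d →ₐ[LaurentPolynomial ℤ] Presented d :=
  RingQuot.mkAlgHom (LaurentPolynomial ℤ) (Rel d)

/-- The set `{e, s, …, s ^ i}`. -/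
def powersLE (s : ℂˣ) (i : ℕ) : Set ℂˣ := {x | ∃ k ≤ i, x = s ^ k}

end RankOne
end

noncomputable section

namespace RankOne

namespace GrBimod

/-! ### Bijective morphisms, split idempotents and bricks -/

/-! The objects of `𝓑_W` can be classified completely, and the presentation is then read off from a
basis. The building blocks are the bimodules `𝒪(A)[n]`. Each is generated by `1`, and the degree `0`
part of `𝒪(A)` is `ℂ`, so its endomorphisms are scalars (`isBrick_O`). Bricks can be split off from
direct sums (`exchange`), hence sums of bricks are closed under direct summands
(`mem_closure_of_add_mem`). This is all that is needed of a Krull-Schmidt theorem.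

The multiplication rules come from viewing `𝒪(A) ⊗ 𝒪(B)` as functions on the lines `(a b v, b v, v)`
in `ℂ³`, with left, middle and right coordinates. Tensoring with `𝒪(a)` translates a set by `a`. For
`𝒪(e, s) ⊗ 𝒪(A)`, one or two lines lie over each point `c` of `A ∪ sA`. A linear form with nonzero
coefficient at the middle coordinate, vanishing on all lines except those over a set `D ⊆ A ∩ sA`,
splits the tensor product as `𝒪(A ∪ sA) ⊕ 𝒪(D)[-2]` (`pair_tensor_iso`). For `A = {e, …, s ^ i}`
with `i + 1 < d`, only the two end lines must be killed, two conditions on three coefficients; for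
`A = W` there are none. This gives the two relations for `C_1 C_i`. Since `d > 2`, the square of
`𝒪(e, s)` has `𝒪(s)[-2]` as a summand. By the recursion `C_{i+1} = C_1 C_i - s C_{i-1}`, the objects
of `𝓑_W` are exactly the sums of shifts of the bimodules `𝒪(s ^ a {e, …, s ^ i})` (`BW.mem_stdSums`
for the harder inclusion), so `s` and the `C_i` generate `A_W`.

For injectivity, the presented algebra is spanned over `ℤ[v, v⁻¹]` by the `s ^ a C_i` with `a < d`,
`i < d - 1`, together with `C_{d-1}` (`basisSpan_eq_top`). Their images are, up to powers of `v`,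
classes of bimodules `𝒪(B)` for pairwise distinct sets `B`. Such classes are independent
(`coeff_eq_zero_of_sum_cls`): counting generators hit by morphisms from `𝒪(A)[n]` is an additive
invariant, equal on `𝒪(B)[k]` to `1` if `k = n` and `B ⊆ A` and to `0` otherwise (`mult_O`), which
is a triangular system. The embedding of the group algebra is the same independence for singletons.
-/

theorem components_mem (M : GrBimod) (m : M.carrier) (i : ℤ) : M.components m i ∈ M.gr i := by
  refine M.hom_induction (p := fun m => M.components m i ∈ M.gr i) m (fun j m hm => ?_) (by simp)
    (fun x y hx hy => by rw [map_add, Finsupp.add_apply]; exact add_mem hx hy)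
  rw [components_of_mem M hm, Finsupp.single_apply]
  split_ifs with h
  · exact h ▸ hm
  · exact zero_mem _

theorem lsum_components (M : GrBimod) (m : M.carrier) :
    Finsupp.lsum ℂ (fun _ : ℤ => (LinearMap.id : M.carrier →ₗ[ℂ] M.carrier))
      (M.components m) = m := by
  refine M.hom_induction (p := fun m => Finsupp.lsum ℂ
    (fun _ : ℤ => (LinearMap.id : M.carrier →ₗ[ℂ] M.carrier)) (M.components m) = m) m
    (fun j m hm => ?_) (by simp) (fun x y hx hy => by rw [map_add, map_add, hx, hy])
  rw [components_of_mem M hm]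
  simp

theorem components_map {M N : GrBimod} (f : Hom M N) (m : M.carrier) (i : ℤ) :
    N.components (f.toLin m) i = f.toLin (M.components m i) := by
  refine M.hom_induction (p := fun m => N.components (f.toLin m) i = f.toLin (M.components m i)) m
    (fun j m hm => ?_) (by simp) (fun x y hx hy => by simp only [map_add, Finsupp.add_apply, hx, hy])
  rw [components_of_mem M hm, components_of_mem N (f.map_gr j m hm), Finsupp.single_apply,
    Finsupp.single_apply]
  split_ifs <;> simp

/-- Morphisms commute with homogeneous components, so the components of `m` outside degree `i` map
to zero and vanish by injectivity. This is what makes the inverse of a bijective morphism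
homogeneous. -/
theorem mem_gr_of_map_mem_gr {M N : GrBimod} (f : Hom M N) (hf : Function.Injective f.toLin)
    {i : ℤ} {m : M.carrier} (h : f.toLin m ∈ N.gr i) : m ∈ M.gr i := by
  have h1 : M.components m = Finsupp.single i (M.components m i) := by
    ext j
    rw [Finsupp.single_apply]
    split_ifs with hij
    · rw [hij]
    · refine hf ?_
      rw [← components_map, components_of_mem N h, Finsupp.single_apply, if_neg hij, map_zero]
  have h2 := M.lsum_components m
  rw [h1] at h2
  simp only [Finsupp.lsum_single, LinearMap.id_apply] at h2
  rw [← h2]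
  exact M.components_mem m i

/-- A bijective morphism is an isomorphism. -/
def isoOfBijective {M N : GrBimod} (f : Hom M N) (hf : Function.Bijective f.toLin) : M ≅ N :=
  let e := LinearEquiv.ofBijective f.toLin hf
  have he : ∀ n, f.toLin (e.symm n) = n := e.apply_symm_apply
  mkIso f
    ⟨e.symm.toLinearMap,
      fun a n => hf.1 (by
        change f.toLin (e.symm _) = f.toLin (M.left a (e.symm n))
        rw [f.map_left, he, he]),
      fun a n => hf.1 (by
        change f.toLin (e.symm _) = f.toLin (M.right a (e.symm n))
        rw [f.map_right, he, he]),
      fun i n hn => mem_gr_of_map_mem_gr f hf.1 (by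
        change f.toLin (e.symm n) ∈ _
        rwa [he])⟩
    e.symm_apply_apply he

/-- The image of an idempotent endomorphism. -/
def splitObj {P : GrBimod} (π : Hom P P) (hπ : ∀ p, π.toLin (π.toLin p) = π.toLin p) : GrBimod where
  carrier := LinearMap.range π.toLin
  left :=
    { toFun := fun a => (P.left a).restrict (by
        rintro _ ⟨p, rfl⟩; exact ⟨P.left a p, π.map_left a p⟩)
      map_one' := by ext; simp
      map_mul' := by intro a b; ext; simp
      map_zero' := by ext; simp
      map_add' := by intro a b; ext; simp
      commutes' := by intro a; ext; simp }
  right :=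
    { toFun := fun a => (P.right a).restrict (by
        rintro _ ⟨p, rfl⟩; exact ⟨P.right a p, π.map_right a p⟩)
      map_one' := by ext; simp
      map_mul' := by intro a b; ext; simp
      map_zero' := by ext; simp
      map_add' := by intro a b; ext; simp
      commutes' := by intro a; ext; simp }
  left_right a b m := Subtype.ext (P.left_right a b m)
  gr i := (P.gr i).comap (LinearMap.range π.toLin).subtype
  isInternal := by
    -- An element of the image is fixed by `π`, and so are its components, because `π` is
    -- homogeneous. Applying `π` to them only places them in the image.
    refine isInternal_of_components _
      (Finsupp.mapRange.linearMap π.toLin.rangeRestrict ∘ₗ P.components ∘ₗ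
        (LinearMap.range π.toLin).subtype) ?_ ?_
    · rintro i ⟨_, p, rfl⟩ hm
      have hm' : π.toLin p ∈ P.gr i := hm
      simp only [LinearMap.comp_apply, Submodule.subtype_apply, components_of_mem P hm',
        Finsupp.mapRange.linearMap_apply, Finsupp.mapRange_single]
      congr 1
      exact Subtype.ext (hπ p)
    · rw [eq_top_iff]
      rintro ⟨_, p, rfl⟩ -
      have h := P.hom_induction (p := fun p => π.toLin.rangeRestrict p ∈
          ⨆ i, (P.gr i).comap (LinearMap.range π.toLin).subtype) p
        (fun i p hp => Submodule.mem_iSup_of_mem i (π.map_gr i p hp)) (by simp)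
        (fun x y hx hy => by rw [map_add]; exact add_mem hx hy)
      exact h
  left_mem i m h := P.left_mem i _ h
  right_mem i m h := P.right_mem i _ h

/-- A brick: a nonzero bimodule with only scalar endomorphisms. -/
structure IsBrick (M : GrBimod) : Prop where
  nontrivial : ∃ m : M.carrier, m ≠ 0
  scalar : ∀ f : Hom M M, ∃ c : ℂ, ∀ m, f.toLin m = c • m

/-- A linear combination `f + c • g` of morphisms. -/
def homAddSMul {M N : GrBimod} (f g : Hom M N) (c : ℂ) : Hom M N :=
  ⟨f.toLin + c • g.toLin, fun a m => by simp [f.map_left, g.map_left],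
    fun a m => by simp [f.map_right, g.map_right],
    fun i m h => add_mem (f.map_gr i m h) (Submodule.smul_mem _ c (g.map_gr i m h))⟩

/-- If a summand `B` maps to `P` and back with composite a nonzero scalar, and `B ⊕ Z ≅ P ⊕ Q`
compatibly, then `B` can be cancelled. -/
theorem exchange_aux {B Z P Q : GrBimod} (e : sum B Z ≅ sum P Q) {c : ℂ} (hc : c ≠ 0)
    (h : ∀ b : B.carrier, (Hom.toLin e.inv ((Hom.toLin e.hom (b, 0)).1, 0)).1 = c • b) :
    ∃ K : GrBimod, Nonempty (P ≅ sum B K) ∧ Nonempty (Z ≅ sum K Q) := by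
  let E : Hom (sum B Z) (sum P Q) := e.hom
  let F : Hom (sum P Q) (sum B Z) := e.inv
  have hEF : ∀ x, E.toLin (F.toLin x) = x := iso_inv_hom e
  have hFE : ∀ x, F.toLin (E.toLin x) = x := iso_hom_inv e
  have h : ∀ b : B.carrier, (F.toLin ((E.toLin (b, 0)).1, 0)).1 = c • b := h
  clear_value E F
  -- Since `r i = c`, the map `c⁻¹ i r` is an idempotent with image a copy of `B`. The complement
  -- `K` is the image of `π = 1 - c⁻¹ i r`, that is, the kernel of `r`.
  let i : Hom B P := (inlHom B Z ≫ E ≫ fstHom P Q : B ⟶ P)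
  let r : Hom P B := (inlHom P Q ≫ F ≫ fstHom B Z : P ⟶ B)
  have hri : ∀ b, r.toLin (i.toLin b) = c • b := h
  let ir : Hom P P := (r ≫ i : P ⟶ P)
  have hir : ∀ p, ir.toLin p = i.toLin (r.toLin p) := fun _ => rfl
  let π : Hom P P := homAddSMul (𝟙 P : P ⟶ P) ir (-c⁻¹)
  have hπ' : ∀ p, π.toLin p = p - c⁻¹ • i.toLin (r.toLin p) := fun p => by
    change p + (-c⁻¹) • i.toLin (r.toLin p) = _
    rw [neg_smul, sub_eq_add_neg]
  have hrπ : ∀ p, r.toLin (π.toLin p) = 0 := fun p => by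
    rw [hπ', map_sub, map_smul, hri, smul_smul, inv_mul_cancel₀ hc, one_smul, sub_self]
  have hπ0 : ∀ p, r.toLin p = 0 → π.toLin p = p := fun p hp => by
    rw [hπ', hp, map_zero, smul_zero, sub_zero]
  have hππ : ∀ p, π.toLin (π.toLin p) = π.toLin p := fun p => hπ0 _ (hrπ p)
  let K := splitObj π hππ
  let k : Hom K P := ⟨(LinearMap.range π.toLin).subtype, fun _ _ => rfl, fun _ _ => rfl,
    fun _ _ h => h⟩
  let q : Hom P K := ⟨π.toLin.rangeRestrict, fun a m => Subtype.ext (π.map_left a m),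
    fun a m => Subtype.ext (π.map_right a m), fun i m h => π.map_gr i m h⟩
  have hkq : ∀ p, k.toLin (q.toLin p) = π.toLin p := fun _ => rfl
  have hk : Function.Injective k.toLin := Subtype.val_injective
  have hrk : ∀ x, r.toLin (k.toLin x) = 0 := by rintro ⟨_, p, rfl⟩; exact hrπ p
  have hqk : ∀ x, q.toLin (k.toLin x) = x := fun x => hk (by rw [hkq, hπ0 _ (hrk x)])
  have hqi : ∀ b, q.toLin (i.toLin b) = 0 := fun b => hk (by
    rw [hkq, hπ', hri, map_smul, smul_smul, inv_mul_cancel₀ hc, one_smul, sub_self, map_zero])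
  -- The second isomorphism is the inclusion of `K ⊕ Q` in `P ⊕ Q`, followed by `F` and the
  -- projection to `Z`. It is bijective because `K ⊕ Q` is a complement of the image of `B`.
  refine ⟨K, ⟨(isoOfBijective (copairHom i k) ⟨?_, ?_⟩).symm⟩,
    ⟨(isoOfBijective ((pairHom (fstHom K Q ≫ k : sum K Q ⟶ P) (sndHom K Q) ≫ F ≫ sndHom B Z :
      sum K Q ⟶ Z)) ⟨?_, ?_⟩).symm⟩⟩
  · rw [injective_iff_map_eq_zero]
    rintro ⟨b, x⟩ hx
    have hx : i.toLin b + k.toLin x = 0 := hx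
    have h1 := congrArg r.toLin hx
    rw [map_add, hri, hrk, add_zero, map_zero, smul_eq_zero_iff_right hc] at h1
    subst h1
    rw [map_zero, zero_add] at hx
    rw [hk (hx.trans (map_zero _).symm)]
    rfl
  · intro p
    refine ⟨(c⁻¹ • r.toLin p, q.toLin p), ?_⟩
    change i.toLin (c⁻¹ • r.toLin p) + k.toLin (q.toLin p) = p
    rw [hkq, hπ', map_smul, add_sub_cancel]
  · rw [injective_iff_map_eq_zero]
    rintro ⟨x, y⟩ hx
    have hx : (F.toLin (k.toLin x, y)).2 = 0 := hx
    -- An element of `K ⊕ Q` dying in `Z` comes from some `(t, 0)`; then `c t = r (i t) = r (k x) =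
    -- 0`.
    set t := (F.toLin (k.toLin x, y)).1 with ht
    have h1 : F.toLin (k.toLin x, y) = (t, 0) := Prod.ext rfl hx
    have h2 : E.toLin (t, 0) = (k.toLin x, y) := by rw [← h1, hEF]
    have h3 : i.toLin t = k.toLin x := congrArg Prod.fst h2
    have h4 := hri t
    rw [h3, hrk] at h4
    have h5 : t = 0 := (smul_eq_zero_iff_right hc).1 h4.symm
    rw [h5] at h2
    have h6 : (k.toLin x, y) = (0 : P.carrier × Q.carrier) := by
      rw [← h2]; exact map_zero E.toLin
    have h7 : k.toLin x = 0 := congrArg Prod.fst h6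
    have h8 : y = 0 := congrArg Prod.snd h6
    rw [h8, hk (h7.trans (map_zero _).symm)]
    rfl
  · intro z
    set w := E.toLin (0, z) with hw
    -- The lift `(t, z)` of `z` is chosen so that the `P`-component of its image is killed by `r`,
    -- hence lies in `K`.
    set t := -(c⁻¹ • r.toLin w.1) with ht
    have h1 : E.toLin (t, z) = (i.toLin t + w.1, (E.toLin (t, 0)).2 + w.2) := by
      have h0 : ((t, z) : B.carrier × Z.carrier) = (t, 0) + (0, z) := by simp
      rw [h0, map_add, ← hw]
      rfl
    have h2 : r.toLin (i.toLin t + w.1) = 0 := by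
      rw [map_add, hri, ht, smul_neg, smul_smul, mul_inv_cancel₀ hc, one_smul, neg_add_cancel]
    refine ⟨(q.toLin (i.toLin t + w.1), (E.toLin (t, 0)).2 + w.2), ?_⟩
    change (F.toLin (k.toLin (q.toLin (i.toLin t + w.1)), (E.toLin (t, 0)).2 + w.2)).2 = z
    rw [hkq, hπ0 _ h2, ← h1, hFE]

/-- The identity of `B` is the sum of its composites through `P` and through `Q`. Both are scalars
with sum `1`, so one is nonzero, and `B` can be cancelled on that side. -/
theorem exchange {B Z P Q : GrBimod} (hB : IsBrick B) (e : sum B Z ≅ sum P Q) :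
    (∃ K : GrBimod, Nonempty (P ≅ sum B K) ∧ Nonempty (Z ≅ sum K Q)) ∨
      ∃ K : GrBimod, Nonempty (Q ≅ sum B K) ∧ Nonempty (Z ≅ sum K P) := by
  obtain ⟨c, hc⟩ := hB.scalar
    ((inlHom B Z ≫ (e.hom ≫ fstHom P Q) ≫ inlHom P Q ≫ e.inv ≫ fstHom B Z : B ⟶ B))
  obtain ⟨c', hc'⟩ := hB.scalar
    ((inlHom B Z ≫ (e.hom ≫ sndHom P Q) ≫ inrHom P Q ≫ e.inv ≫ fstHom B Z : B ⟶ B))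
  have hc : ∀ b : B.carrier, (Hom.toLin e.inv ((Hom.toLin e.hom (b, 0)).1, 0)).1 = c • b := hc
  have hc' : ∀ b : B.carrier, (Hom.toLin e.inv (0, (Hom.toLin e.hom (b, 0)).2)).1 = c' • b := hc'
  by_cases h : c = 0
  · right
    have h' : c' ≠ 0 := by
      rintro rfl
      obtain ⟨b, hb⟩ := hB.nontrivial
      apply hb
      have h1 := iso_hom_inv e (b, 0)
      have h2 : Hom.toLin e.hom (b, 0) =
          ((Hom.toLin e.hom (b, 0)).1, 0) + (0, (Hom.toLin e.hom (b, 0)).2) := by simp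
      have h3 := congrArg Prod.fst h1
      rw [h2, map_add, Prod.fst_add, hc, hc', h] at h3
      simpa using h3.symm
    exact exchange_aux (e ≪≫ sumComm P Q) h' hc'
  · exact Or.inl (exchange_aux e h hc)

end GrBimod

/-! ### Cancellation of bricks in the semiring of isomorphism classes -/

open GrBimod

theorem isoClass_surjective (x : IsoClass) : ∃ M, isoClass M = x := Quotient.exists_rep x

theorem isoClass_eq_iff {M N : GrBimod} : isoClass M = isoClass N ↔ Nonempty (M ≅ N) :=
  Quotient.eq (r := isIsomorphicSetoid GrBimod)

/-- A summand of the zero bimodule embeds in it. This is the base case of the induction over sums of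
bricks. -/
theorem eq_zero_of_add_eq_zero {x y : IsoClass} (h : x + y = 0) : x = 0 := by
  obtain ⟨M, rfl⟩ := isoClass_surjective x
  obtain ⟨N, rfl⟩ := isoClass_surjective y
  obtain ⟨e⟩ := isoClass_eq_iff.1 (h : isoClass (M.sum N) = isoClass GrBimod.zero)
  have hm : ∀ m : M.carrier, m = 0 := fun m => by
    have h1 := iso_hom_inv e (m, 0)
    have h2 : Hom.toLin e.hom (m, 0) = 0 := rfl
    rw [h2, map_zero] at h1
    exact (congrArg Prod.fst h1).symm
  exact isoClass_eq (mkIso (zeroHom _ _) (zeroHom _ _) (fun m => (hm m).symm) fun _ => rfl)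

theorem isoClass_exchange {B : GrBimod} (hB : IsBrick B) {z x y : IsoClass}
    (h : isoClass B + z = x + y) :
    (∃ k, x = isoClass B + k ∧ z = k + y) ∨ ∃ k, y = isoClass B + k ∧ z = x + k := by
  obtain ⟨Z, rfl⟩ := isoClass_surjective z
  obtain ⟨P, rfl⟩ := isoClass_surjective x
  obtain ⟨Q, rfl⟩ := isoClass_surjective y
  obtain ⟨e⟩ := isoClass_eq_iff.1 (h : isoClass (B.sum Z) = isoClass (P.sum Q))
  obtain ⟨K, ⟨e₁⟩, ⟨e₂⟩⟩ | ⟨K, ⟨e₁⟩, ⟨e₂⟩⟩ := exchange hB e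
  · exact Or.inl ⟨isoClass K, isoClass_eq e₁, isoClass_eq e₂⟩
  · exact Or.inr ⟨isoClass K, isoClass_eq e₁, (isoClass_eq e₂).trans (add_comm (isoClass K) (isoClass P))⟩

/-- Sums of bricks are closed under direct summands. -/
theorem mem_closure_of_add_mem {G : Set IsoClass} (hG : ∀ g ∈ G, ∃ B, IsBrick B ∧ isoClass B = g)
    {x y : IsoClass} (h : x + y ∈ AddSubmonoid.closure G) : x ∈ AddSubmonoid.closure G := by
  suffices key : ∀ z ∈ AddSubmonoid.closure G, ∀ x y, z = x + y →
      x ∈ AddSubmonoid.closure G from key _ h x y rfl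
  intro z hz
  -- Induction on the number of bricks in `x + y`: the exchange property removes one brick from `x`
  -- or from `y`, and the hypothesis applies to what remains.
  induction hz using AddSubmonoid.closure_induction_left with
  | zero =>
    intro x y h
    rw [eq_zero_of_add_eq_zero h.symm]
    exact zero_mem _
  | add_left g hg z hz ih =>
    intro x y h
    obtain ⟨B, hB, rfl⟩ := hG g hg
    obtain ⟨k, rfl, hk⟩ | ⟨k, rfl, hk⟩ := isoClass_exchange hB h
    · exact add_mem (AddSubmonoid.subset_closure hg) (ih _ _ hk)
    · exact ih _ _ hk


namespace GrBimod

open MvPolynomial (X)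

/-! ### The action of `ℂ[x, y]` on a graded bimodule -/

/-- A linear map commuting with `X` on both sides, as a morphism. -/
def homOfX {M N : GrBimod} (f : M.carrier →ₗ[ℂ] N.carrier)
    (hl : ∀ m, f (M.left Polynomial.X m) = N.left Polynomial.X (f m))
    (hr : ∀ m, f (M.right Polynomial.X m) = N.right Polynomial.X (f m))
    (hg : ∀ i, ∀ m ∈ M.gr i, f m ∈ N.gr i) : Hom M N where
  toLin := f
  map_left a := by
    induction a using Polynomial.induction_on with
    | C a => intro m; simp
    | add p q hp hq => intro m; simp [hp, hq]
    | monomial n a h =>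
      intro m
      rw [pow_succ, ← mul_assoc, map_mul M.left, map_mul N.left, Module.End.mul_apply,
        Module.End.mul_apply, h, hl]
  map_right a := by
    induction a using Polynomial.induction_on with
    | C a => intro m; simp
    | add p q hp hq => intro m; simp [hp, hq]
    | monomial n a h =>
      intro m
      rw [pow_succ, ← mul_assoc, map_mul M.right, map_mul N.right, Module.End.mul_apply,
        Module.End.mul_apply, h, hr]
  map_gr := hg

/-- The action of a polynomial in `x` (acting on the left) and `y` (acting on the right) on an
element of a graded bimodule. -/
def act (M : GrBimod) (m : M.carrier) : MvPolynomial (Fin 2) ℂ →ₗ[ℂ] M.carrier :=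
  (MvPolynomial.basisMonomials (Fin 2) ℂ).constr ℂ fun d =>
    M.left (Polynomial.X ^ d 0) (M.right (Polynomial.X ^ d 1) m)

theorem act_monomial (M : GrBimod) (m : M.carrier) (d : Fin 2 →₀ ℕ) (a : ℂ) :
    M.act m (MvPolynomial.monomial d a) =
      a • M.left (Polynomial.X ^ d 0) (M.right (Polynomial.X ^ d 1) m) := by
  have := (MvPolynomial.basisMonomials (Fin 2) ℂ).constr_basis ℂ (fun d =>
    M.left (Polynomial.X ^ d 0) (M.right (Polynomial.X ^ d 1) m)) d
  rw [MvPolynomial.coe_basisMonomials] at this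
  rw [← mul_one a, ← smul_eq_mul, ← MvPolynomial.smul_monomial, map_smul, act, this, smul_eq_mul,
    mul_one]

@[simp] theorem act_C (M : GrBimod) (m : M.carrier) (c : ℂ) :
    M.act m (MvPolynomial.C c) = c • m := by
  rw [MvPolynomial.C_apply, act_monomial]; simp

@[simp] theorem act_one (M : GrBimod) (m : M.carrier) : M.act m 1 = m := by
  rw [← MvPolynomial.C_1, act_C, one_smul]

theorem act_mul_X0 (M : GrBimod) (m : M.carrier) (p : MvPolynomial (Fin 2) ℂ) :
    M.act m (p * X 0) = M.left Polynomial.X (M.act m p) := by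
  induction p using MvPolynomial.induction_on' with
  | monomial d a =>
    rw [MvPolynomial.X, MvPolynomial.monomial_mul, act_monomial, act_monomial, map_smul, mul_one,
      ← Module.End.mul_apply (M.left Polynomial.X), ← map_mul, ← pow_succ']
    simp
  | add p q hp hq => rw [add_mul, map_add, map_add, map_add, hp, hq]

theorem act_mul_X1 (M : GrBimod) (m : M.carrier) (p : MvPolynomial (Fin 2) ℂ) :
    M.act m (p * X 1) = M.right Polynomial.X (M.act m p) := by
  induction p using MvPolynomial.induction_on' with
  | monomial d a =>
    rw [MvPolynomial.X, MvPolynomial.monomial_mul, act_monomial, act_monomial, map_smul, mul_one,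
      ← M.left_right, ← Module.End.mul_apply (M.right Polynomial.X), ← map_mul, ← pow_succ']
    simp
  | add p q hp hq => rw [add_mul, map_add, map_add, map_add, hp, hq]

@[simp] theorem act_X0 (M : GrBimod) (m : M.carrier) : M.act m (X 0) = M.left Polynomial.X m := by
  rw [← one_mul (X 0), act_mul_X0, act_one]

@[simp] theorem act_X1 (M : GrBimod) (m : M.carrier) : M.act m (X 1) = M.right Polynomial.X m := by
  rw [← one_mul (X 1), act_mul_X1, act_one]

theorem act_map {M N : GrBimod} (f : M.carrier →ₗ[ℂ] N.carrier)
    (hl : ∀ m, f (M.left Polynomial.X m) = N.left Polynomial.X (f m))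
    (hr : ∀ m, f (M.right Polynomial.X m) = N.right Polynomial.X (f m)) (m : M.carrier)
    (p : MvPolynomial (Fin 2) ℂ) : f (M.act m p) = N.act (f m) p := by
  induction p using MvPolynomial.induction_on with
  | C a => simp
  | add p q hp hq => simp only [map_add, hp, hq]
  | mul_X p i hp =>
    fin_cases i
    · change f (M.act m (p * X 0)) = N.act (f m) (p * X 0)
      rw [act_mul_X0, hl, hp, act_mul_X0]
    · change f (M.act m (p * X 1)) = N.act (f m) (p * X 1)
      rw [act_mul_X1, hr, hp, act_mul_X1]

/-- A common eigenfunctional of both actions turns the action of a polynomial into its value at the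
pair of eigenvalues. It is applied to the point evaluations on tensor products. -/
theorem act_functional {M : GrBimod} (f : M.carrier →ₗ[ℂ] ℂ) (l r : ℂ)
    (hl : ∀ m, f (M.left Polynomial.X m) = l * f m)
    (hr : ∀ m, f (M.right Polynomial.X m) = r * f m) (m : M.carrier)
    (p : MvPolynomial (Fin 2) ℂ) : f (M.act m p) = MvPolynomial.eval ![l, r] p * f m := by
  induction p using MvPolynomial.induction_on with
  | C a => simp
  | add p q hp hq => simp only [map_add, hp, hq, add_mul]
  | mul_X p i hp =>
    fin_cases i
    · change f (M.act m (p * X 0)) = MvPolynomial.eval ![l, r] (p * X 0) * f m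
      rw [act_mul_X0, hl, hp]; simp; ring
    · change f (M.act m (p * X 1)) = MvPolynomial.eval ![l, r] (p * X 1) * f m
      rw [act_mul_X1, hr, hp]; simp; ring

theorem left_pow_mem (M : GrBimod) {i : ℤ} {m : M.carrier} (hm : m ∈ M.gr i) (k : ℕ) :
    M.left (Polynomial.X ^ k) m ∈ M.gr (i + 2 * k) := by
  induction k with
  | zero => simpa using hm
  | succ k ih =>
    rw [pow_succ', map_mul, Nat.cast_succ, mul_add, mul_one, ← add_assoc]
    exact M.left_mem _ _ ih

theorem right_pow_mem (M : GrBimod) {i : ℤ} {m : M.carrier} (hm : m ∈ M.gr i) (k : ℕ) :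
    M.right (Polynomial.X ^ k) m ∈ M.gr (i + 2 * k) := by
  induction k with
  | zero => simpa using hm
  | succ k ih =>
    rw [pow_succ', map_mul, Nat.cast_succ, mul_add, mul_one, ← add_assoc]
    exact M.right_mem _ _ ih

theorem act_mem (M : GrBimod) {i : ℤ} {m : M.carrier} (hm : m ∈ M.gr i)
    {p : MvPolynomial (Fin 2) ℂ} {k : ℕ} (hp : p.IsHomogeneous k) :
    M.act m p ∈ M.gr (i + 2 * k) := by
  rw [p.as_sum, map_sum]
  refine Submodule.sum_mem _ fun d hd => ?_
  have hd' : d 1 + d 0 = k := by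
    have := hp (MvPolynomial.mem_support_iff.1 hd)
    simpa [Finsupp.weight_apply, Finsupp.sum_fintype, add_comm] using this
  rw [act_monomial]
  refine Submodule.smul_mem _ _ ?_
  have := M.left_pow_mem (M.right_pow_mem hm (d 1)) (d 0)
  rwa [add_assoc, ← mul_add, ← Nat.cast_add, hd'] at this

/-! ### The bimodules `𝒪(A)` -/

/-- The restriction of a polynomial function to the union of graphs. -/
def oe (A : Set ℂˣ) : MvPolynomial (Fin 2) ℂ →ₗ[ℂ] (O A).carrier := (res A).toLinearMap

theorem oe_surjective (A : Set ℂˣ) : Function.Surjective (oe A) :=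
  Ideal.Quotient.mkₐ_surjective ℂ (graphIdeal A)

/-- The vanishing of a polynomial function on the graphs. -/
theorem oe_eq_zero {A : Set ℂˣ} {p : MvPolynomial (Fin 2) ℂ} :
    oe A p = 0 ↔ ∀ a ∈ A, ∀ v : ℂ, MvPolynomial.eval ![(a : ℂ) * v, v] p = 0 := by
  have h1 : oe A p = 0 ↔ p ∈ graphIdeal A := Ideal.Quotient.eq_zero_iff_mem
  rw [h1]
  constructor
  · intro h a ha v
    have := h _ ⟨a, ha, v, rfl⟩
    rwa [MvPolynomial.aeval_eq_eval] at this
  · rintro h _ ⟨a, ha, v, rfl⟩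
    rw [MvPolynomial.aeval_eq_eval]
    exact h a ha v

theorem left_oe (A : Set ℂˣ) (p : MvPolynomial (Fin 2) ℂ) :
    (O A).left Polynomial.X (oe A p) = oe A (p * X 0) := by
  have h : (O A).left Polynomial.X (oe A p) =
      res A (Polynomial.aeval (X 0) Polynomial.X) * res A p := rfl
  rw [h, Polynomial.aeval_X, ← map_mul, mul_comm]
  rfl

theorem right_oe (A : Set ℂˣ) (p : MvPolynomial (Fin 2) ℂ) :
    (O A).right Polynomial.X (oe A p) = oe A (p * X 1) := by
  have h : (O A).right Polynomial.X (oe A p) =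
      res A (Polynomial.aeval (X 1) Polynomial.X) * res A p := rfl
  rw [h, Polynomial.aeval_X, ← map_mul, mul_comm]
  rfl

theorem oe_mem (A : Set ℂˣ) {p : MvPolynomial (Fin 2) ℂ} {k : ℕ} (hp : p.IsHomogeneous k) :
    oe A p ∈ (O A).gr (2 * k) := by
  have h : res A p ∈ Submodule.span ℂ {f : FunRing A | ∃ j : ℕ, 2 * (k : ℤ) = 2 * j ∧
      ∃ p : MvPolynomial (Fin 2) ℂ, p.IsHomogeneous j ∧ f = res A p} :=
    Submodule.subset_span ⟨k, rfl, p, hp, rfl⟩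
  exact h

theorem oe_one_mem (A : Set ℂˣ) : oe A 1 ∈ (O A).gr 0 :=
  oe_mem A (k := 0) (MvPolynomial.isHomogeneous_one _ _)

/-- The degree `i` fixes `k` by `i = 2 k`, and homogeneous polynomials of degree `k` are closed
under sums and multiples, so the span adds nothing but `0`. -/
theorem exists_homogeneous_of_mem {A : Set ℂˣ} {i : ℤ} {m : (O A).carrier} (hm : m ∈ (O A).gr i) :
    m = 0 ∨ ∃ (k : ℕ) (p : MvPolynomial (Fin 2) ℂ),
      i = 2 * k ∧ p.IsHomogeneous k ∧ m = oe A p := by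
  refine Submodule.span_induction (p := fun m _ => m = 0 ∨ ∃ (k : ℕ)
    (p : MvPolynomial (Fin 2) ℂ), i = 2 * k ∧ p.IsHomogeneous k ∧ m = oe A p)
    ?_ (Or.inl rfl) ?_ ?_ hm
  · rintro _ ⟨k, hk, p, hp, rfl⟩
    exact Or.inr ⟨k, p, hk, hp, rfl⟩
  · rintro x y _ _ (rfl | ⟨k, p, hk, hp, rfl⟩) (rfl | ⟨l, q, hl, hq, rfl⟩)
    · exact Or.inl (add_zero _)
    · exact Or.inr ⟨l, q, hl, hq, zero_add _⟩
    · exact Or.inr ⟨k, p, hk, hp, add_zero _⟩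
    · obtain rfl : k = l := by omega
      exact Or.inr ⟨k, p + q, hk, hp.add hq, (map_add _ _ _).symm⟩
  · rintro c x _ (rfl | ⟨k, p, hk, hp, rfl⟩)
    · exact Or.inl (smul_zero _)
    · refine Or.inr ⟨k, c • p, hk, ?_, (map_smul _ _ _).symm⟩
      rw [MvPolynomial.smul_eq_C_mul, ← zero_add k]
      exact (MvPolynomial.isHomogeneous_C _ c).mul hp

/-- Evaluation at a point of a graph. -/
def ev (A : Set ℂˣ) (a : A) (v : ℂ) : (O A).carrier →ₗ[ℂ] ℂ :=
  ((graphIdeal A).restrictScalars ℂ).liftQ ((MvPolynomial.aeval ![((a : ℂˣ) : ℂ) * v, v] : MvPolynomial (Fin 2) ℂ →ₐ[ℂ] ℂ)).toLinearMap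
    (fun _ hp => hp _ ⟨a, a.2, v, rfl⟩)

@[simp] theorem ev_oe (A : Set ℂˣ) (a : A) (v : ℂ) (p : MvPolynomial (Fin 2) ℂ) :
    ev A a v (oe A p) = MvPolynomial.eval ![((a : ℂˣ) : ℂ) * v, v] p := by
  change MvPolynomial.aeval (![((a : ℂˣ) : ℂ) * v, v] : Fin 2 → ℂ) p = _
  rw [MvPolynomial.aeval_eq_eval]

theorem ev_left (A : Set ℂˣ) (a : A) (v : ℂ) (m : (O A).carrier) :
    ev A a v ((O A).left Polynomial.X m) = ((a : ℂˣ) : ℂ) * v * ev A a v m := by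
  obtain ⟨p, rfl⟩ := oe_surjective A m
  rw [left_oe]; simp; ring

theorem ev_right (A : Set ℂˣ) (a : A) (v : ℂ) (m : (O A).carrier) :
    ev A a v ((O A).right Polynomial.X m) = v * ev A a v m := by
  obtain ⟨p, rfl⟩ := oe_surjective A m
  rw [right_oe]; simp; ring

/-- A polynomial function in `v` which vanishes for `v ≠ 0` vanishes identically. -/
theorem eval_line_eq_zero {p : MvPolynomial (Fin 2) ℂ} {a : ℂ}
    (h : ∀ v : ℂ, v ≠ 0 → MvPolynomial.eval ![a * v, v] p = 0) (v : ℂ) :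
    MvPolynomial.eval ![a * v, v] p = 0 := by
  have hc : Continuous fun v : ℂ => MvPolynomial.eval ![a * v, v] p := by
    have : Continuous fun v : ℂ => (![a * v, v] : Fin 2 → ℂ) := by fun_prop
    exact (MvPolynomial.continuous_eval p).comp this
  have := hc.ext_on (dense_compl_singleton (0 : ℂ)) continuous_const (fun v hv => h v hv)
  exact congrFun this v

/-- The origin can be left out by continuity along each line. This matters because later arguments
divide by `v`. -/
theorem eq_zero_of_ev {A : Set ℂˣ} {m : (O A).carrier}
    (h : ∀ (a : A) (v : ℂ), v ≠ 0 → ev A a v m = 0) : m = 0 := by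
  obtain ⟨p, rfl⟩ := oe_surjective A m
  refine oe_eq_zero.2 fun a ha => eval_line_eq_zero fun v hv => ?_
  rw [← ev_oe A ⟨a, ha⟩]
  exact h ⟨a, ha⟩ v hv

/-- The morphism out of a shift of `𝒪(A)` given by an element killed by the vanishing ideal. -/
def homOfElement {A : Set ℂˣ} {M : GrBimod} (k : ℤ) (m : M.carrier) (hm : m ∈ M.gr (-k))
    (h : ∀ p, oe A p = 0 → M.act m p = 0) : Hom ((O A).shift k) M :=
  let f : (O A).carrier →ₗ[ℂ] M.carrier := ((graphIdeal A).restrictScalars ℂ).liftQ (M.act m)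
    (fun p hp => h p (Ideal.Quotient.eq_zero_iff_mem.2 hp))
  have hf : ∀ p, f (oe A p) = M.act m p := fun _ => rfl
  homOfX (M := (O A).shift k) f
    (fun n => by
      obtain ⟨p, rfl⟩ := oe_surjective A n
      change f ((O A).left Polynomial.X (oe A p)) = _
      rw [left_oe, hf, act_mul_X0, hf])
    (fun n => by
      obtain ⟨p, rfl⟩ := oe_surjective A n
      change f ((O A).right Polynomial.X (oe A p)) = _
      rw [right_oe, hf, act_mul_X1, hf])
    (fun i n hn => by
      obtain rfl | ⟨j, p, hj, hp, rfl⟩ := exists_homogeneous_of_mem (hn : n ∈ (O A).gr (i + k))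
      · rw [map_zero]; exact zero_mem _
      · rw [hf, show i = -k + 2 * j by omega]
        exact M.act_mem hm hp)

theorem homOfElement_oe {A : Set ℂˣ} {M : GrBimod} (k : ℤ) (m : M.carrier) (hm : m ∈ M.gr (-k))
    (h : ∀ p, oe A p = 0 → M.act m p = 0) (p : MvPolynomial (Fin 2) ℂ) :
    (homOfElement k m hm h).toLin (oe A p) = M.act m p := rfl

theorem act_oe (A : Set ℂˣ) (q p : MvPolynomial (Fin 2) ℂ) :
    (O A).act (oe A q) p = oe A (q * p) := by
  induction p using MvPolynomial.induction_on with
  | C a => rw [act_C, mul_comm, ← MvPolynomial.smul_eq_C_mul, map_smul]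
  | add p q hp hq => simp only [map_add, mul_add, hp, hq]
  | mul_X p i hp =>
    fin_cases i
    · change (O A).act _ (p * X 0) = oe A (q * (p * X 0))
      rw [act_mul_X0, hp, left_oe, mul_assoc]
    · change (O A).act _ (p * X 1) = oe A (q * (p * X 1))
      rw [act_mul_X1, hp, right_oe, mul_assoc]

/-- A morphism out of a shift of `𝒪(A)` is determined by the image of `1`. -/
theorem hom_oe {A : Set ℂˣ} {M : GrBimod} {k : ℤ} (f : Hom ((O A).shift k) M)
    (p : MvPolynomial (Fin 2) ℂ) : f.toLin (oe A p) = M.act (f.toLin (oe A 1)) p := by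
  rw [← act_map (M := (O A).shift k) f.toLin (f.map_left _) (f.map_right _)]
  congr 1
  exact (by rw [act_oe, one_mul] : oe A p = (O A).act (oe A 1) p)

theorem act_shift (M : GrBimod) (k : ℤ) (m : M.carrier) (p : MvPolynomial (Fin 2) ℂ) :
    (M.shift k).act m p = M.act m p := rfl

theorem oe_one_ne_zero {A : Set ℂˣ} (hA : A.Nonempty) : oe A 1 ≠ 0 := by
  obtain ⟨a, ha⟩ := hA
  intro h
  simpa using oe_eq_zero.1 h a ha 0

/-- An element of degree `0` of `𝒪(A)` is a constant. -/
theorem eq_smul_of_mem_gr_zero {A : Set ℂˣ} {m : (O A).carrier} (hm : m ∈ (O A).gr 0) :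
    ∃ c : ℂ, m = c • oe A 1 := by
  obtain rfl | ⟨k, p, hk, hp, rfl⟩ := exists_homogeneous_of_mem hm
  · exact ⟨0, (zero_smul _ _).symm⟩
  · obtain rfl : k = 0 := by omega
    have := MvPolynomial.totalDegree_eq_zero_iff_eq_C.1 (Nat.le_zero.1 hp.totalDegree_le)
    refine ⟨MvPolynomial.coeff 0 p, ?_⟩
    rw [this, ← map_smul, MvPolynomial.smul_eq_C_mul, mul_one]
    simp

/-- The shifts of `𝒪(A)` are bricks. -/
theorem isBrick_O {A : Set ℂˣ} (hA : A.Nonempty) (k : ℤ) : IsBrick ((O A).shift k) where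
  nontrivial := ⟨oe A 1, oe_one_ne_zero hA⟩
  scalar f := by
    -- In the shift by `k` the generator `1` has degree `-k`, which is degree `0` of `𝒪(A)`; its
    -- image is therefore a constant, and that constant determines `f`.
    have h1 : f.toLin (oe A 1) ∈ (O A).gr (-k + k) := f.map_gr (-k) (oe A 1) (by
      change _ ∈ (O A).gr (-k + k)
      rw [neg_add_cancel]; exact oe_one_mem A)
    rw [neg_add_cancel] at h1
    obtain ⟨c, hc⟩ := eq_smul_of_mem_gr_zero h1
    refine ⟨c, fun m => ?_⟩
    obtain ⟨p, rfl⟩ := oe_surjective A m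
    rw [hom_oe, hc, act_shift, ← map_smul, act_oe, smul_mul_assoc, one_mul, map_smul]

end GrBimod


namespace GrBimod

open MvPolynomial (X)

/-! ### Tensor products of the bimodules `𝒪(A)` -/

/-- The action of the middle variable on `M ⊗_R N`. -/
def mid (M N : GrBimod) : Tens M N →ₗ[ℂ] Tens M N :=
  tlift ((tmkL M N).compl₂ (N.left Polynomial.X)) (by
    intro r m n
    change (tmk (M.right r m) (N.left Polynomial.X n) : Tens M N) =
      tmk m (N.left Polynomial.X (N.left r n))
    rw [tmk_balance, ← Module.End.mul_apply, ← Module.End.mul_apply, ← map_mul, ← map_mul, mul_comm])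

theorem mid_tmk {M N : GrBimod} (m : M.carrier) (n : N.carrier) :
    mid M N (tmk m n) = tmk m (N.left Polynomial.X n) := rfl

theorem mid_left {M N : GrBimod} (t : Tens M N) :
    mid M N (tensLeft M N Polynomial.X t) = tensLeft M N Polynomial.X (mid M N t) :=
  tens_induction (p := fun t => mid M N (tensLeft M N Polynomial.X t) =
    tensLeft M N Polynomial.X (mid M N t)) t (fun _ _ => rfl)
    fun x y hx hy => by simp only [map_add, hx, hy]

theorem mid_right {M N : GrBimod} (t : Tens M N) :
    mid M N (tensRight M N Polynomial.X t) = tensRight M N Polynomial.X (mid M N t) :=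
  tens_induction (p := fun t => mid M N (tensRight M N Polynomial.X t) =
    tensRight M N Polynomial.X (mid M N t)) t
    (fun m n => by
      rw [tensRight_tmk, mid_tmk, mid_tmk, tensRight_tmk, N.left_right])
    fun x y hx hy => by simp only [map_add, hx, hy]

/-- The element `1 ⊗ 1`. -/
def tone (A B : Set ℂˣ) : Tens (O A) (O B) := tmk (oe A 1) (oe B 1)

/-- The tensor product is generated from `1 ⊗ 1` by three variables: the left one, the right one and
the middle one, which acts on the first factor from the right or on the second from the left. All
surjectivity statements and normal forms below rest on this. -/
theorem tens_O_top {A B : Set ℂˣ} (N : Submodule ℂ (Tens (O A) (O B))) (h1 : tone A B ∈ N)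
    (hl : ∀ t ∈ N, tensLeft (O A) (O B) Polynomial.X t ∈ N)
    (hr : ∀ t ∈ N, tensRight (O A) (O B) Polynomial.X t ∈ N)
    (hm : ∀ t ∈ N, mid (O A) (O B) t ∈ N) (t : Tens (O A) (O B)) : t ∈ N := by
  have hq : ∀ q, (tmk (oe A 1) (oe B q) : Tens (O A) (O B)) ∈ N := fun q => by
    induction q using MvPolynomial.induction_on with
    | C a =>
      rw [← mul_one (MvPolynomial.C a), ← MvPolynomial.smul_eq_C_mul, map_smul, tmk_smul_right]
      exact N.smul_mem _ h1
    | add p q hp hq => rw [map_add, tmk_add_right]; exact N.add_mem hp hq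
    | mul_X p i hp =>
      fin_cases i
      · change tmk (oe A 1) (oe B (p * X 0)) ∈ N
        rw [← left_oe]; exact hm _ hp
      · change tmk (oe A 1) (oe B (p * X 1)) ∈ N
        rw [← right_oe]; exact hr _ hp
  have hp : ∀ p q, (tmk (oe A p) (oe B q) : Tens (O A) (O B)) ∈ N := fun p => by
    induction p using MvPolynomial.induction_on with
    | C a =>
      intro q
      rw [← mul_one (MvPolynomial.C a), ← MvPolynomial.smul_eq_C_mul, map_smul, tmk_smul_left]
      exact N.smul_mem _ (hq q)
    | add p q hp hq => intro r; rw [map_add, tmk_add_left]; exact N.add_mem (hp r) (hq r)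
    | mul_X p i hp =>
      intro q
      fin_cases i
      · change tmk (oe A (p * X 0)) (oe B q) ∈ N
        rw [← left_oe]; exact hl _ (hp q)
      · change tmk (oe A (p * X 1)) (oe B q) ∈ N
        rw [← right_oe, tmk_balance, left_oe]; exact hp _
  refine tens_induction (p := fun t => t ∈ N) t (fun m n => ?_) fun x y hx hy => N.add_mem hx hy
  obtain ⟨p, rfl⟩ := oe_surjective A m
  obtain ⟨q, rfl⟩ := oe_surjective B n
  exact hp p q

/-- Evaluation at the point `(a b v, b v, v)`. -/
def tev {A B : Set ℂˣ} (a : A) (b : B) (v : ℂ) : Tens (O A) (O B) →ₗ[ℂ] ℂ :=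
  tlift ((LinearMap.mul ℂ ℂ).compl₁₂ (ev A a (((b : ℂˣ) : ℂ) * v)) (ev B b v))
    (balanced_of_X _ fun m n => by simp [ev_right, ev_left]; ring)

theorem tev_tmk {A B : Set ℂˣ} (a : A) (b : B) (v : ℂ) (m : (O A).carrier) (n : (O B).carrier) :
    tev a b v (tmk m n) = ev A a (((b : ℂˣ) : ℂ) * v) m * ev B b v n := rfl

theorem tev_act {A B : Set ℂˣ} (a : A) (b : B) (v : ℂ) (t : Tens (O A) (O B))
    (p : MvPolynomial (Fin 2) ℂ) : tev a b v (act (tensor (O A) (O B)) t p) =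
      MvPolynomial.eval ![((a : ℂˣ) * (b : ℂˣ) : ℂˣ) * v, v] p * tev a b v t := by
  refine act_functional (M := tensor (O A) (O B)) (tev a b v) _ _ (fun t => ?_) (fun t => ?_) t p
  · refine tens_induction (p := fun t => tev a b v (tensLeft _ _ Polynomial.X t) =
      ((a : ℂˣ) * (b : ℂˣ) : ℂˣ) * v * tev a b v t) t (fun m n => ?_)
      fun x y hx hy => by simp only [map_add, hx, hy, mul_add]
    rw [tensLeft_tmk, tev_tmk, tev_tmk, ev_left]; push_cast; ring
  · refine tens_induction (p := fun t => tev a b v (tensRight _ _ Polynomial.X t) =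
      v * tev a b v t) t (fun m n => ?_) fun x y hx hy => by simp only [map_add, hx, hy, mul_add]
    rw [tensRight_tmk, tev_tmk, tev_tmk, ev_right]; ring

theorem tev_tone {A B : Set ℂˣ} (a : A) (b : B) (v : ℂ) : tev a b v (tone A B) = 1 := by
  rw [tone, tev_tmk]; simp

theorem tone_mem (A B : Set ℂˣ) : tone A B ∈ tensGr (O A) (O B) 0 := by
  have h := tmk_mem (oe_one_mem A) (oe_one_mem B)
  rwa [add_zero] at h

theorem range_stable {M N : GrBimod} (f : Hom M N) {t : N.carrier}
    (ht : t ∈ LinearMap.range f.toLin) (p : MvPolynomial (Fin 2) ℂ) :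
    N.act t p ∈ LinearMap.range f.toLin := by
  obtain ⟨m, rfl⟩ := ht
  exact ⟨M.act m p, act_map f.toLin (f.map_left _) (f.map_right _) m p⟩

/-- `𝒪(A) ⊗ 𝒪(B) ≅ 𝒪(C)` if the left-hand side is a ring of functions generated by `1 ⊗ 1` and
`C = A B`. -/
theorem tensor_iso_of_mul {A B C : Set ℂˣ} (hC : ∀ c, c ∈ C ↔ ∃ a ∈ A, ∃ b ∈ B, a * b = c)
    (h0 : ∀ t : Tens (O A) (O B), (∀ a b v, tev a b v t = 0) → t = 0)
    {q : MvPolynomial (Fin 2) ℂ}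
    (hq : mid (O A) (O B) (tone A B) = act (tensor (O A) (O B)) (tone A B) q) :
    Nonempty (O C ≅ tensor (O A) (O B)) := by
  -- A polynomial vanishing on `C = A B` acts on `1 ⊗ 1` with all values zero, so `h0` makes this
  -- map well defined.
  let f : Hom ((O C).shift 0) (tensor (O A) (O B)) := homOfElement 0 (tone A B) (tone_mem A B)
    (fun p hp => h0 _ fun a b v => by
      rw [tev_act, oe_eq_zero.1 hp _ ((hC _).2 ⟨a, a.2, b, b.2, rfl⟩) v, zero_mul])
  have hf : ∀ p, f.toLin (oe C p) = act (tensor (O A) (O B)) (tone A B) p := homOfElement_oe _ _ _ _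
  refine ⟨(shiftZero _).symm ≪≫ isoOfBijective f ⟨?_, ?_⟩⟩
  · rw [injective_iff_map_eq_zero]
    intro m hm
    obtain ⟨p, rfl⟩ := oe_surjective C m
    rw [hf] at hm
    refine oe_eq_zero.2 fun c hc v => ?_
    obtain ⟨a, ha, b, hb, rfl⟩ := (hC c).1 hc
    have := congrArg (tev ⟨a, ha⟩ ⟨b, hb⟩ v) hm
    rwa [tev_act, tev_tone, mul_one, map_zero] at this
  · intro t
    refine tens_O_top (LinearMap.range f.toLin) ⟨oe C 1, (hf 1).trans (act_one _ _)⟩ ?_ ?_ ?_ t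
    · rintro _ ⟨m, rfl⟩; exact ⟨_, f.map_left _ m⟩
    · rintro _ ⟨m, rfl⟩; exact ⟨_, f.map_right _ m⟩
    -- The middle variable commutes with the outer actions, so stability under it need only be known
    -- at `1 ⊗ 1`, where it is `hq`.
    · rintro _ ⟨m, rfl⟩
      obtain ⟨p, rfl⟩ := oe_surjective C m
      rw [hf, act_map (M := tensor (O A) (O B)) (N := tensor (O A) (O B)) (mid _ _) mid_left
        mid_right, hq]
      exact range_stable f (by rw [← hf]; exact ⟨_, rfl⟩) p

theorem oe_singleton_X0 (a : ℂˣ) (p : MvPolynomial (Fin 2) ℂ) :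
    oe {a} (p * X 0) = (a : ℂ) • oe {a} (p * X 1) := by
  rw [← sub_eq_zero, ← map_smul, ← map_sub, oe_eq_zero]
  rintro _ rfl v
  simp [MvPolynomial.smul_eq_C_mul]
  ring

theorem oe_singleton_X1 (a : ℂˣ) (p : MvPolynomial (Fin 2) ℂ) :
    oe {a} (p * X 1) = ((a⁻¹ : ℂˣ) : ℂ) • oe {a} (p * X 0) := by
  rw [oe_singleton_X0, smul_smul, ← Units.val_mul, inv_mul_cancel, Units.val_one, one_smul]

theorem oe_C (A : Set ℂˣ) (c : ℂ) : oe A (MvPolynomial.C c) = c • oe A 1 := by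
  rw [← map_smul, MvPolynomial.smul_eq_C_mul, mul_one]

/-- On `Gr(a)` the two coordinates are proportional, so the middle variable is `a⁻¹` times the left
one. Hence every element is `1 ⊗ n`, and `n` is recovered from its values. -/
theorem singleton_tensor_iso {a : ℂˣ} {B C : Set ℂˣ} (hC : ∀ c, c ∈ C ↔ a⁻¹ * c ∈ B) :
    Nonempty (O C ≅ tensor (O {a}) (O B)) := by
  have hmid : mid (O {a}) (O B) (tone {a} B) =
      ((a⁻¹ : ℂˣ) : ℂ) • tensLeft (O {a}) (O B) Polynomial.X (tone {a} B) := by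
    rw [tone, mid_tmk, tensLeft_tmk, ← tmk_balance, right_oe, left_oe, oe_singleton_X1,
      tmk_smul_left]
  refine tensor_iso_of_mul (fun c => ?_) (fun t ht => ?_)
    (q := ((a⁻¹ : ℂˣ) : ℂ) • X 0) ?_
  · rw [hC]
    constructor
    · intro h
      exact ⟨a, rfl, _, h, mul_inv_cancel_left a c⟩
    · rintro ⟨_, rfl, b, hb, rfl⟩
      rwa [inv_mul_cancel_left]
  · have : t ∈ LinearMap.range (tmkL (O {a}) (O B) (oe {a} 1)) := by
      refine tens_O_top (LinearMap.range (tmkL (O {a}) (O B) (oe {a} 1))) ⟨oe B 1, rfl⟩ ?_ ?_ ?_ t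
      · rintro _ ⟨n, rfl⟩
        refine ⟨(a : ℂ) • (O B).left Polynomial.X n, ?_⟩
        rw [tmkL_apply, tmkL_apply, tensLeft_tmk, left_oe, oe_singleton_X0, tmk_smul_left,
          tmk_smul_right, ← right_oe, tmk_balance]
      · rintro _ ⟨n, rfl⟩; exact ⟨_, rfl⟩
      · rintro _ ⟨n, rfl⟩; exact ⟨_, rfl⟩
    obtain ⟨n, rfl⟩ := this
    have : n = 0 := eq_zero_of_ev fun b v _ => by
      have := ht ⟨a, rfl⟩ b v
      rw [tmkL_apply, tev_tmk] at this
      simpa using this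
    rw [this, map_zero]
  · rw [hmid, map_smul, act_X0]

/-- The mirror image of `singleton_tensor_iso`: here the middle variable is `a` times the right one.
-/
theorem tensor_singleton_iso {a : ℂˣ} {B C : Set ℂˣ} (hC : ∀ c, c ∈ C ↔ a⁻¹ * c ∈ B) :
    Nonempty (O C ≅ tensor (O B) (O {a})) := by
  have hmid : mid (O B) (O {a}) (tone B {a}) =
      (a : ℂ) • tensRight (O B) (O {a}) Polynomial.X (tone B {a}) := by
    rw [tone, mid_tmk, tensRight_tmk, left_oe, oe_singleton_X0, tmk_smul_right, right_oe]
  refine tensor_iso_of_mul (fun c => ?_) (fun t ht => ?_) (q := (a : ℂ) • X 1) ?_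
  · rw [hC]
    constructor
    · intro h
      exact ⟨_, h, a, rfl, by rw [mul_comm, mul_inv_cancel_left]⟩
    · rintro ⟨b, hb, _, rfl, rfl⟩
      rwa [mul_comm b, inv_mul_cancel_left]
  · have : t ∈ LinearMap.range ((tmkL (O B) (O {a})).flip (oe {a} 1)) := by
      refine tens_O_top (LinearMap.range ((tmkL (O B) (O {a})).flip (oe {a} 1))) ⟨oe B 1, rfl⟩ ?_ ?_ ?_ t
      · rintro _ ⟨n, rfl⟩; exact ⟨_, rfl⟩
      · rintro _ ⟨n, rfl⟩
        refine ⟨((a⁻¹ : ℂˣ) : ℂ) • (O B).right Polynomial.X n, ?_⟩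
        rw [LinearMap.flip_apply, LinearMap.flip_apply, tmkL_apply, tmkL_apply, tensRight_tmk,
          right_oe, oe_singleton_X1, tmk_smul_left, tmk_smul_right, ← left_oe, tmk_balance]
      · rintro _ ⟨n, rfl⟩
        refine ⟨(O B).right Polynomial.X n, ?_⟩
        rw [LinearMap.flip_apply, LinearMap.flip_apply, tmkL_apply, tmkL_apply, mid_tmk,
          tmk_balance]
    obtain ⟨n, rfl⟩ := this
    have : n = 0 := eq_zero_of_ev fun b v _ => by
      -- The value of `n` at `(b v, v)` is read off at the point `(b v, v, a⁻¹ v)`.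
      have := ht b ⟨a, rfl⟩ ((a⁻¹ : ℂˣ) * v)
      rw [LinearMap.flip_apply, tmkL_apply, tev_tmk] at this
      simpa using this
    rw [this, map_zero]
  · rw [hmid, map_smul, act_X1]

/-- `Gr(1)` is the diagonal. Restriction to it sends both coordinates to `X`, and an element of
`ℂ[X]` is determined by its values. -/
theorem unit_iso_O_one : Nonempty (O {1} ≅ unit) := by
  have hact : ∀ p, unit.act (1 : R) p = MvPolynomial.aeval ![Polynomial.X, Polynomial.X] p := by
    intro p
    induction p using MvPolynomial.induction_on with
    | C a =>
      rw [act_C, MvPolynomial.aeval_C, Algebra.algebraMap_eq_smul_one]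
    | add p q hp hq => rw [map_add, map_add, hp, hq]
    | mul_X p i hp =>
      have hX : ∀ q : R, (Polynomial.X : R) * q = q * Polynomial.X := fun q => mul_comm _ _
      fin_cases i
      · change unit.act (1 : R) (p * X 0) = MvPolynomial.aeval _ (p * X 0)
        rw [act_mul_X0, hp, map_mul, MvPolynomial.aeval_X]
        exact hX _
      · change unit.act (1 : R) (p * X 1) = MvPolynomial.aeval _ (p * X 1)
        rw [act_mul_X1, hp, map_mul, MvPolynomial.aeval_X]
        exact hX _
  have hev : ∀ (p : MvPolynomial (Fin 2) ℂ) (v : ℂ), Polynomial.eval v (MvPolynomial.aeval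
      (![Polynomial.X, Polynomial.X] : Fin 2 → R) p) = MvPolynomial.eval ![v, v] p := by
    intro p v
    induction p using MvPolynomial.induction_on with
    | C a => simp
    | add p q hp hq => simp only [map_add, Polynomial.eval_add, hp, hq]
    | mul_X p i hp =>
      rw [map_mul, Polynomial.eval_mul, hp, map_mul]
      fin_cases i <;> simp
  have hz : ∀ p, oe {1} p = 0 ↔ MvPolynomial.aeval
      (![Polynomial.X, Polynomial.X] : Fin 2 → R) p = 0 := by
    intro p
    rw [oe_eq_zero]
    constructor
    · intro h
      refine Polynomial.funext fun v => ?_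
      have := h 1 rfl v
      rw [Units.val_one, one_mul] at this
      rw [hev, this, Polynomial.eval_zero]
    · rintro h _ rfl v
      rw [Units.val_one, one_mul, ← hev, h, Polynomial.eval_zero]
  let f : Hom ((O {1}).shift 0) unit := homOfElement (M := unit) 0 (1 : R) one_mem_unit
    (fun p hp => (hact p).trans ((hz p).1 hp))
  have hf : ∀ p, f.toLin (oe {1} p) = unit.act (1 : R) p := homOfElement_oe _ _ _ _
  refine ⟨(shiftZero _).symm ≪≫ isoOfBijective f ⟨?_, ?_⟩⟩
  · rw [injective_iff_map_eq_zero]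
    intro m hm
    obtain ⟨p, rfl⟩ := oe_surjective {1} m
    rw [hf, hact] at hm
    exact (hz p).2 hm
  · intro q
    refine ⟨oe {1} (Polynomial.aeval (X 0) (q : R)), ?_⟩
    rw [hf, hact]
    change MvPolynomial.aeval _ _ = (q : R)
    induction (q : R) using Polynomial.induction_on' with
    | add p q hp hq => rw [map_add, map_add, hp, hq]
    | monomial n a => simp [← Polynomial.C_mul_X_pow_eq_monomial]

/-! ### The tensor product with `𝒪(e, s)` -/

/-- This is `(x - y)(x - s y) = 0` on the two lines. It makes `1` and `x` generators of `𝒪(e, s)`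
for the right action. -/
theorem oe_pair_X0_mul_X0 (s : ℂˣ) : oe {1, s} (X 0 * X 0) =
    (1 + s : ℂ) • oe {1, s} (X 0 * X 1) - (s : ℂ) • oe {1, s} (X 1 * X 1) := by
  rw [← sub_eq_zero, ← map_smul, ← map_smul, ← map_sub, ← map_sub, oe_eq_zero]
  rintro _ (rfl | rfl) v <;> simp [MvPolynomial.smul_eq_C_mul] <;> ring

theorem exists_repr_pair (s : ℂˣ) (A : Set ℂˣ) (t : Tens (O {1, s}) (O A)) :
    ∃ m n, t = tmk (oe {1, s} 1) m + tmk (oe {1, s} (X 0)) n := by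
  have : t ∈ LinearMap.range ((tmkL (O {1, s}) (O A) (oe {1, s} 1)).coprod
      (tmkL (O {1, s}) (O A) (oe {1, s} (X 0)))) := by
    refine tens_O_top (LinearMap.range ((tmkL (O {1, s}) (O A) (oe {1, s} 1)).coprod
      (tmkL (O {1, s}) (O A) (oe {1, s} (X 0))))) ⟨(oe A 1, 0), by simp [tone, tmk_zero_right]⟩ ?_ ?_ ?_ t
    · rintro _ ⟨⟨m, n⟩, rfl⟩
      -- With `x'` the left and `x` the middle variable, `x'² = (1 + s) x' x - s x²` gives `x' (1 ⊗
      -- m + x' ⊗ n) = 1 ⊗ (-s x² n) + x' ⊗ (m + (1 + s) x n)`.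
      refine ⟨(-(s : ℂ) • (O A).left Polynomial.X ((O A).left Polynomial.X n),
        m + (1 + s : ℂ) • (O A).left Polynomial.X n), ?_⟩
      simp only [LinearMap.coprod_apply, tmkL_apply, map_add, tensLeft_tmk, left_oe, one_mul,
        oe_pair_X0_mul_X0, tmk_smul_right]
      rw [sub_eq_add_neg, ← neg_smul, tmk_add_left, tmk_smul_left, tmk_smul_left, ← right_oe,
        tmk_balance, ← right_oe, tmk_balance, ← one_mul (X 1), ← right_oe, tmk_balance]
      abel
    · rintro _ ⟨⟨m, n⟩, rfl⟩
      exact ⟨((O A).right Polynomial.X m, (O A).right Polynomial.X n), by simp⟩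
    · rintro _ ⟨⟨m, n⟩, rfl⟩
      exact ⟨((O A).left Polynomial.X m, (O A).left Polynomial.X n), by simp [mid_tmk]⟩
  obtain ⟨⟨m, n⟩, rfl⟩ := this
  exact ⟨m, n, rfl⟩

/-- For `1 ⊗ m + x ⊗ n` the lines with `a = 1` and `a = s` give the values `m + b v n` and `m + s b
v n`, a system with determinant `(s - 1) b v`. Thus elements of `𝒪(e, s) ⊗ 𝒪(A)` are determined by
their values on the lines. -/
theorem pair_tensor_eq_zero {s : ℂˣ} (hs : s ≠ 1) {A : Set ℂˣ} (t : Tens (O {1, s}) (O A))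
    (ht : ∀ a b v, tev a b v t = 0) : t = 0 := by
  obtain ⟨m, n, rfl⟩ := exists_repr_pair s A t
  have h : ∀ (b : A) (v : ℂ), v ≠ 0 → ev A b v m = 0 ∧ ev A b v n = 0 := by
    intro b v hv
    have h1 := ht ⟨1, Or.inl rfl⟩ b v
    have h2 := ht ⟨s, Or.inr rfl⟩ b v
    rw [map_add, tev_tmk, tev_tmk] at h1 h2
    simp only [ev_oe, map_one, one_mul, MvPolynomial.eval_X, Matrix.cons_val_zero,
      Units.val_one] at h1 h2
    have h3 : ((1 : ℂ) - s) * ((b : ℂˣ) * v) * ev A b v n = 0 := by linear_combination h1 - h2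
    have h4 : (1 : ℂ) - s ≠ 0 := sub_ne_zero.2 fun h => hs (Units.ext h.symm)
    have h5 : ev A b v n = 0 := by simpa [h4, hv] using h3
    rw [h5, mul_zero, add_zero] at h1
    exact ⟨h1, h5⟩
  rw [eq_zero_of_ev fun b v hv => (h b v hv).1, eq_zero_of_ev fun b v hv => (h b v hv).2,
    tmk_zero_right, tmk_zero_right, add_zero]

/-- The linear function `α x' + β x + γ y` in `𝒪(A) ⊗ 𝒪(B)`. -/
def tlin (A B : Set ℂˣ) (α β γ : ℂ) : Tens (O A) (O B) :=
  α • tensLeft (O A) (O B) Polynomial.X (tone A B) + β • mid (O A) (O B) (tone A B) +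
    γ • tensRight (O A) (O B) Polynomial.X (tone A B)

theorem tlin_mem (A B : Set ℂˣ) (α β γ : ℂ) : tlin A B α β γ ∈ tensGr (O A) (O B) 2 := by
  refine Submodule.add_mem _ (Submodule.add_mem _ ?_ ?_) ?_ <;> refine Submodule.smul_mem _ _ ?_
  · have h := tmk_mem ((O A).left_mem 0 _ (oe_one_mem A)) (oe_one_mem B)
    rwa [add_zero, zero_add] at h
  · have h := tmk_mem (oe_one_mem A) ((O B).left_mem 0 _ (oe_one_mem B))
    rwa [zero_add, zero_add] at h
  · have h := tmk_mem (oe_one_mem A) ((O B).right_mem 0 _ (oe_one_mem B))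
    rwa [zero_add, zero_add] at h

theorem tev_tlin {A B : Set ℂˣ} (a : A) (b : B) (v α β γ : ℂ) : tev a b v (tlin A B α β γ) =
    (α * ((a : ℂˣ) * (b : ℂˣ) : ℂˣ) + β * (b : ℂˣ) + γ) * v := by
  simp only [tlin, tone, mid_tmk, tensLeft_tmk, tensRight_tmk, map_add, map_smul, tev_tmk, left_oe,
    right_oe, ev_oe, one_mul, map_one, mul_one, MvPolynomial.eval_X, Matrix.cons_val_zero,
    Matrix.cons_val_one, smul_eq_mul, Units.val_mul]
  ring

/-- The decomposition of `𝒪(e, s) ⊗ 𝒪(A)`. -/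
theorem pair_tensor_iso {s : ℂˣ} (hs : s ≠ 1) {A C D : Set ℂˣ} {α β γ : ℂ} (hβ : β ≠ 0)
    (hC : ∀ c, c ∈ C ↔ c ∈ A ∨ s⁻¹ * c ∈ A) (hD : ∀ c ∈ D, c ∈ A ∧ s⁻¹ * c ∈ A)
    (h₁ : ∀ c ∈ A, c ∉ D → α * c + β * c + γ = 0)
    (h₂ : ∀ c, s⁻¹ * c ∈ A → c ∉ D → α * c + β * (s⁻¹ * c : ℂˣ) + γ = 0) :
    Nonempty (sum ((O C).shift 0) ((O D).shift (-2)) ≅ tensor (O {1, s}) (O A)) := by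
  -- Two lines lie over each `c ∈ D`, those of `(1, c)` and `(s, s⁻¹ c)`. By `h₁` and `h₂` the form
  -- `θ` vanishes on every line not over `D`. So `1 ⊗ 1` will generate `𝒪(C)` and `θ`, of degree
  -- `2`, will generate `𝒪(D)[-2]`.
  set θ := tlin {1, s} A α β γ with hθ
  have hC' : ∀ a ∈ ({1, s} : Set ℂˣ), ∀ b ∈ A, a * b ∈ C := by
    rintro _ (rfl | rfl) b hb
    · exact (hC _).2 (Or.inl (by rwa [one_mul]))
    · exact (hC _).2 (Or.inr (by rwa [inv_mul_cancel_left]))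
  have hθ0 : ∀ (a : ({1, s} : Set ℂˣ)) (b : A) (v : ℂ), (a * b : ℂˣ) ∉ D → tev a b v θ = 0 := by
    rintro ⟨a, ha | ha⟩ ⟨b, hb⟩ v hab <;> subst a
    · rw [one_mul] at hab
      rw [hθ, tev_tlin]
      simp only [one_mul, h₁ b hb hab, zero_mul]
    · have := h₂ (s * b) (by rwa [inv_mul_cancel_left]) hab
      rw [inv_mul_cancel_left] at this
      rw [hθ, tev_tlin]
      simp only [this, zero_mul]
  let E := tensor (O {1, s}) (O A)
  let f : Hom ((O C).shift 0) E := homOfElement 0 (tone _ _) (tone_mem _ _)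
    (fun p hp => pair_tensor_eq_zero hs _ fun a b v => by
      rw [tev_act, oe_eq_zero.1 hp _ (hC' a a.2 b b.2) v, zero_mul])
  have hf : ∀ p, f.toLin (oe C p) = E.act (tone _ _) p := homOfElement_oe _ _ _ _
  let g : Hom ((O D).shift (-2)) E := homOfElement (-2) θ (tlin_mem _ _ _ _ _)
    (fun p hp => pair_tensor_eq_zero hs _ fun a b v => by
      rw [tev_act]
      by_cases hab : (a * b : ℂˣ) ∈ D
      · rw [oe_eq_zero.1 hp _ hab v, zero_mul]
      · rw [hθ0 a b v hab, mul_zero])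
  have hg : ∀ p, g.toLin (oe D p) = E.act θ p := homOfElement_oe _ _ _ _
  let F := copairHom f g
  have hF : ∀ p q, F.toLin (oe C p, oe D q) = E.act (tone _ _) p + E.act θ q := fun p q => by
    rw [← hf, ← hg]; rfl
  refine ⟨isoOfBijective F ⟨?_, ?_⟩⟩
  · rw [injective_iff_map_eq_zero]
    rintro ⟨m, n⟩ hmn
    obtain ⟨p, rfl⟩ := oe_surjective C m
    obtain ⟨q, rfl⟩ := oe_surjective D n
    rw [hF] at hmn
    have hev : ∀ (a : ({1, s} : Set ℂˣ)) (b : A) (v : ℂ) (c : ℂˣ), (a : ℂˣ) * b = c →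
        MvPolynomial.eval ![(c : ℂ) * v, v] p +
        MvPolynomial.eval ![(c : ℂ) * v, v] q *
          ((α * (c : ℂ) + β * (b : ℂˣ) + γ) * v) = 0 := by
      rintro a b v c rfl
      have := congrArg (tev a b v) hmn
      rwa [map_add, tev_act, tev_act, tev_tone, mul_one, map_zero, hθ, tev_tlin] at this
    -- On the two lines over `c` the values of `θ` differ by `β (c - s⁻¹ c) v`, nonzero as `β ≠ 0`
    -- and `s ≠ 1`. Subtracting the two equations kills `q`, and then `p`.
    have hDv : ∀ c ∈ D, ∀ v : ℂ, v ≠ 0 → MvPolynomial.eval ![(c : ℂ) * v, v] p = 0 ∧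
        MvPolynomial.eval ![(c : ℂ) * v, v] q = 0 := by
      intro c hc v hv
      have e1 := hev ⟨1, Or.inl rfl⟩ ⟨c, (hD c hc).1⟩ v c (one_mul c)
      have e2 := hev ⟨s, Or.inr rfl⟩ ⟨s⁻¹ * c, (hD c hc).2⟩ v c (mul_inv_cancel_left s c)
      have h4 : ((c : ℂˣ) : ℂ) - (s⁻¹ * c : ℂˣ) ≠ 0 := sub_ne_zero.2 fun h => hs (by
        have h := Units.ext h
        rw [eq_comm, inv_mul_eq_iff_eq_mul, eq_comm] at h
        exact mul_eq_right.1 h)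
      have e3 : MvPolynomial.eval ![(c : ℂ) * v, v] q *
          (β * (((c : ℂˣ) : ℂ) - (s⁻¹ * c : ℂˣ)) * v) = 0 := by linear_combination e1 - e2
      have e4 : MvPolynomial.eval ![(c : ℂ) * v, v] q = 0 :=
        (mul_eq_zero.1 e3).resolve_right (mul_ne_zero (mul_ne_zero hβ h4) hv)
      rw [e4, zero_mul, add_zero] at e1
      exact ⟨e1, e4⟩
    have hp : oe C p = 0 := oe_eq_zero.2 fun c hc => eval_line_eq_zero fun v hv => by
      by_cases hcD : c ∈ D
      · exact (hDv c hcD v hv).1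
      rcases (hC c).1 hc with h | h
      · have := hev ⟨1, Or.inl rfl⟩ ⟨c, h⟩ v c (one_mul c)
        rwa [h₁ c h hcD, zero_mul, mul_zero, add_zero] at this
      · have := hev ⟨s, Or.inr rfl⟩ ⟨s⁻¹ * c, h⟩ v c (mul_inv_cancel_left s c)
        rwa [h₂ c h hcD, zero_mul, mul_zero, add_zero] at this
    have hq : oe D q = 0 := oe_eq_zero.2 fun c hc => eval_line_eq_zero fun v hv =>
      (hDv c hc v hv).2
    rw [hp, hq]
    rfl
  · intro t
    have hact : ∀ t ∈ LinearMap.range F.toLin, ∀ p, E.act t p ∈ LinearMap.range F.toLin :=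
      fun t ht p => range_stable F ht p
    have hone : tone {1, s} A ∈ LinearMap.range F.toLin :=
      ⟨(oe C 1, oe D 0), by rw [hF, act_one, map_zero, add_zero]⟩
    have hθm : θ ∈ LinearMap.range F.toLin :=
      ⟨(oe C 0, oe D 1), by rw [hF, act_one, map_zero, zero_add]⟩
    have hl : ∀ t ∈ LinearMap.range F.toLin,
        tensLeft (O {1, s}) (O A) Polynomial.X t ∈ LinearMap.range F.toLin := by
      rintro _ ⟨m, rfl⟩; exact ⟨_, F.map_left _ m⟩
    have hr : ∀ t ∈ LinearMap.range F.toLin,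
        tensRight (O {1, s}) (O A) Polynomial.X t ∈ LinearMap.range F.toLin := by
      rintro _ ⟨m, rfl⟩; exact ⟨_, F.map_right _ m⟩
    -- The middle variable is solved for from the definition of `θ`; this is where `β ≠ 0` is needed
    -- for surjectivity.
    have hm1 : mid (O {1, s}) (O A) (tone {1, s} A) ∈ LinearMap.range F.toLin := by
      have h : mid (O {1, s}) (O A) (tone {1, s} A) = β⁻¹ • (θ -
          α • tensLeft (O {1, s}) (O A) Polynomial.X (tone {1, s} A) -
          γ • tensRight (O {1, s}) (O A) Polynomial.X (tone {1, s} A)) := by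
        rw [eq_inv_smul_iff₀ hβ, hθ, tlin]; abel
      rw [h]
      exact Submodule.smul_mem _ _ (Submodule.sub_mem _ (Submodule.sub_mem _ hθm
        (Submodule.smul_mem _ _ (hl _ hone))) (Submodule.smul_mem _ _ (hr _ hone)))
    -- The relation `(x' - x)(x' - s x) = 0` of the first factor is solved for `x²`, as `s` is
    -- invertible. This in turn puts the middle variable times `θ` in the range.
    have hm2 : mid (O {1, s}) (O A) (mid (O {1, s}) (O A) (tone {1, s} A)) ∈
        LinearMap.range F.toLin := by
      have h0 : tensLeft (O {1, s}) (O A) Polynomial.X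
          (tensLeft (O {1, s}) (O A) Polynomial.X (tone {1, s} A)) =
          (1 + s : ℂ) • tensLeft (O {1, s}) (O A) Polynomial.X
            (mid (O {1, s}) (O A) (tone {1, s} A)) -
          (s : ℂ) • mid (O {1, s}) (O A) (mid (O {1, s}) (O A) (tone {1, s} A)) := by
        simp only [tone, tensLeft_tmk, mid_tmk]
        rw [left_oe, left_oe, one_mul, oe_pair_X0_mul_X0, sub_eq_add_neg, ← neg_smul, tmk_add_left,
          tmk_smul_left, tmk_smul_left, ← right_oe, tmk_balance, ← right_oe, tmk_balance,
          ← one_mul (X 1), ← right_oe, tmk_balance, neg_smul, ← sub_eq_add_neg]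
      have h : mid (O {1, s}) (O A) (mid (O {1, s}) (O A) (tone {1, s} A)) =
          (s : ℂ)⁻¹ • ((1 + s : ℂ) • tensLeft (O {1, s}) (O A) Polynomial.X
            (mid (O {1, s}) (O A) (tone {1, s} A)) - tensLeft (O {1, s}) (O A) Polynomial.X
            (tensLeft (O {1, s}) (O A) Polynomial.X (tone {1, s} A))) := by
        rw [eq_inv_smul_iff₀ s.ne_zero, h0]; abel
      rw [h]
      exact Submodule.smul_mem _ _ (Submodule.sub_mem _ (Submodule.smul_mem _ _ (hl _ hm1))
        (hl _ (hl _ hone)))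
    have hm3 : mid (O {1, s}) (O A) θ ∈ LinearMap.range F.toLin := by
      rw [hθ, tlin, map_add, map_add, map_smul, map_smul, map_smul, mid_left, mid_right]
      exact Submodule.add_mem _ (Submodule.add_mem _ (Submodule.smul_mem _ _ (hl _ hm1))
        (Submodule.smul_mem _ _ hm2)) (Submodule.smul_mem _ _ (hr _ hm1))
    refine tens_O_top (LinearMap.range F.toLin) hone hl hr ?_ t
    rintro _ ⟨⟨m, n⟩, rfl⟩
    obtain ⟨p, rfl⟩ := oe_surjective C m
    obtain ⟨q, rfl⟩ := oe_surjective D n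
    rw [hF, map_add, act_map (M := E) (N := E) (mid _ _) mid_left mid_right,
      act_map (M := E) (N := E) (mid _ _) mid_left mid_right]
    exact Submodule.add_mem _ (hact _ hm1 p) (hact _ hm3 q)

end GrBimod


open GrBimod

/-! ### Relations between isomorphism classes -/

/-- The class of `𝒪(A)`. -/
def oc (A : Set ℂˣ) : IsoClass := isoClass (O A)

/-- The class of `R[n]`. -/
def vc (n : ℤ) : IsoClass := isoClass (GrBimod.unit.shift n)

theorem isoClass_shift (M : GrBimod) (n : ℤ) : isoClass (M.shift n) = vc n * isoClass M :=
  (isoClass_eq (shiftTensor _ _ _ ≪≫ shiftCongr (unitTensor M) n)).symm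

theorem vc_comm (n : ℤ) (x : IsoClass) : x * vc n = vc n * x := by
  obtain ⟨M, rfl⟩ := isoClass_surjective x
  rw [← isoClass_shift]
  exact isoClass_eq (tensorShift _ _ _ ≪≫ shiftCongr (tensorUnit M) n)

theorem vc_add (m n : ℤ) : vc (m + n) = vc m * vc n := by
  change _ = vc m * isoClass _
  rw [← isoClass_shift]
  exact (isoClass_eq (shiftShift _ _ _)).symm

theorem vc_zero : vc 0 = 1 := isoClass_eq (shiftZero _)

theorem oc_one : oc {1} = 1 := by
  obtain ⟨e⟩ := unit_iso_O_one
  exact isoClass_eq e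

theorem oc_singleton_mul (a : ℂˣ) (B : Set ℂˣ) : oc {a} * oc B = oc ((a⁻¹ * ·) ⁻¹' B) := by
  obtain ⟨e⟩ := singleton_tensor_iso (a := a) (B := B) (C := (a⁻¹ * ·) ⁻¹' B) (fun _ => Iff.rfl)
  exact (isoClass_eq e).symm

theorem oc_mul_singleton (a : ℂˣ) (B : Set ℂˣ) : oc B * oc {a} = oc ((a⁻¹ * ·) ⁻¹' B) := by
  obtain ⟨e⟩ := tensor_singleton_iso (a := a) (B := B) (C := (a⁻¹ * ·) ⁻¹' B) (fun _ => Iff.rfl)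
  exact (isoClass_eq e).symm

theorem oc_singleton_mul_singleton (a b : ℂˣ) : oc {a} * oc {b} = oc {a * b} := by
  rw [oc_singleton_mul]
  congr 1
  ext c
  simp

theorem oc_singleton_pow (a : ℂˣ) (k : ℕ) : oc {a} ^ k = oc {a ^ k} := by
  induction k with
  | zero => rw [pow_zero, pow_zero, oc_one]
  | succ k ih => rw [pow_succ, ih, oc_singleton_mul_singleton, pow_succ]

theorem oc_pair_mul {s : ℂˣ} (hs : s ≠ 1) {A C D : Set ℂˣ} {α β γ : ℂ} (hβ : β ≠ 0)
    (hC : ∀ c, c ∈ C ↔ c ∈ A ∨ s⁻¹ * c ∈ A) (hD : ∀ c ∈ D, c ∈ A ∧ s⁻¹ * c ∈ A)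
    (h₁ : ∀ c ∈ A, c ∉ D → α * c + β * c + γ = 0)
    (h₂ : ∀ c, s⁻¹ * c ∈ A → c ∉ D → α * c + β * (s⁻¹ * c : ℂˣ) + γ = 0) :
    oc {1, s} * oc A = oc C + vc (-2) * oc D := by
  obtain ⟨e⟩ := pair_tensor_iso hs hβ hC hD h₁ h₂
  rw [oc, oc, oc, oc, ← isoClass_shift, isoClass_eq (shiftZero (O C)).symm]
  exact (isoClass_eq e).symm

theorem mem_powersLE_iff_mem_zpowers {s : ℂˣ} (hs : 0 < orderOf s) {x : ℂˣ} :
    x ∈ powersLE s (orderOf s - 1) ↔ x ∈ Subgroup.zpowers s := by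
  constructor
  · rintro ⟨k, -, rfl⟩
    exact Subgroup.npow_mem_zpowers s k
  · intro h
    have : IsOfFinOrder s := orderOf_pos_iff.1 hs
    obtain ⟨k, rfl⟩ := this.mem_powers_iff_mem_zpowers.2 h
    exact ⟨k % orderOf s, Nat.le_sub_one_of_lt (Nat.mod_lt _ hs), (pow_mod_orderOf s k).symm⟩

theorem powersLE_zero (s : ℂˣ) : powersLE s 0 = {1} := by
  ext x
  simp [powersLE]

theorem powersLE_one (s : ℂˣ) : powersLE s 1 = {1, s} := by
  ext x
  constructor
  · rintro ⟨k, hk, rfl⟩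
    interval_cases k <;> simp
  · rintro (rfl | rfl)
    · exact ⟨0, zero_le_one, (pow_zero s).symm⟩
    · exact ⟨1, le_rfl, (pow_one x).symm⟩

/-! ### Products with the classes of `𝒪(s)` and `𝒪(e, s)` -/

section relations
variable {s : ℂˣ}

theorem oc_powersLE_zero : oc (powersLE s 0) = 1 := by rw [powersLE_zero, oc_one]

theorem oc_s_comm (A : Set ℂˣ) : oc {s} * oc A = oc A * oc {s} := by
  rw [oc_singleton_mul, oc_mul_singleton]

theorem oc_s_pow_orderOf : oc {s} ^ orderOf s = 1 := by
  rw [oc_singleton_pow, pow_orderOf_eq_one, oc_one]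

/-- The set `{e, …, s ^ (d - 1)}` is all of `W`, hence stable under translation by `s`. -/
theorem oc_s_mul_last (hs : 0 < orderOf s) :
    oc {s} * oc (powersLE s (orderOf s - 1)) = oc (powersLE s (orderOf s - 1)) := by
  rw [oc_singleton_mul]
  congr 1
  ext c
  rw [Set.mem_preimage, mem_powersLE_iff_mem_zpowers hs, mem_powersLE_iff_mem_zpowers hs]
  exact Subgroup.mul_mem_cancel_left _ (inv_mem (Subgroup.mem_zpowers s))

/-- Here `A`, `C` and `D` are all equal to `W`. No line has to be killed, so the middle coordinate
itself serves as the linear form. -/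
theorem oc_C_one_mul_last (hs : 1 < orderOf s) :
    oc (powersLE s 1) * oc (powersLE s (orderOf s - 1)) =
      oc (powersLE s (orderOf s - 1)) + vc (-2) * oc (powersLE s (orderOf s - 1)) := by
  have hmem : ∀ c, s⁻¹ * c ∈ powersLE s (orderOf s - 1) ↔ c ∈ powersLE s (orderOf s - 1) :=
    fun c => by
      rw [mem_powersLE_iff_mem_zpowers (by omega), mem_powersLE_iff_mem_zpowers (by omega)]
      exact Subgroup.mul_mem_cancel_left _ (inv_mem (Subgroup.mem_zpowers s))
  rw [powersLE_one]
  refine oc_pair_mul (α := 0) (β := 1) (γ := 0) (fun h => by simp [h] at hs) one_ne_zero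
    (fun c => ?_) (fun c hc => ⟨hc, (hmem c).2 hc⟩) (fun c hc h => absurd hc h)
    (fun c hc h => absurd ((hmem c).1 hc) h)
  rw [hmem, or_self]

/-- For `A = {e, …, s ^ i}` the union `A ∪ sA` is `{e, …, s ^ (i + 1)}` and the intersection is `s
{e, …, s ^ (i - 1)}`. Exactly two points, `e` and `s ^ (i + 1)`, carry a single line. -/
theorem oc_C_one_mul {i : ℕ} (hi : 1 ≤ i) (hs : i + 1 < orderOf s) :
    oc (powersLE s 1) * oc (powersLE s i) =
      oc (powersLE s (i + 1)) + vc (-2) * (oc {s} * oc (powersLE s (i - 1))) := by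
  rw [oc_singleton_mul, powersLE_one]
  have hmem : ∀ k, 1 ≤ k → k ≤ i → s ^ k ∈ (s⁻¹ * ·) ⁻¹' powersLE s (i - 1) := fun k h1 h2 =>
    ⟨k - 1, by omega, by
      rw [inv_mul_eq_iff_eq_mul, ← pow_succ']; congr 1; omega⟩
  -- The coefficients solve `α + β + γ = 0` and `α s ^ (i + 1) + β s ^ i + γ = 0`, the vanishing on
  -- the two end lines. The condition `β ≠ 0` is `s ^ (i + 1) ≠ 1`.
  refine oc_pair_mul (α := (s : ℂ) ^ i - 1) (β := 1 - (s : ℂ) ^ (i + 1))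
    (γ := (s : ℂ) ^ (i + 1) - (s : ℂ) ^ i) (fun h => by simp [h] at hs) ?_ (fun c => ?_) ?_ ?_ ?_
  · rw [sub_ne_zero]
    intro h
    refine pow_ne_one_of_lt_orderOf (x := s) (n := i + 1) (by omega) hs (Units.ext ?_)
    rw [Units.val_pow_eq_pow_val, Units.val_one, h]
  · constructor
    · rintro ⟨k, hk, rfl⟩
      rcases Nat.lt_or_eq_of_le hk with h | rfl
      · exact Or.inl ⟨k, by omega, rfl⟩
      · exact Or.inr ⟨i, le_rfl, by rw [pow_succ', inv_mul_cancel_left]⟩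
    · rintro (⟨k, hk, rfl⟩ | ⟨k, hk, h⟩)
      · exact ⟨k, by omega, rfl⟩
      · exact ⟨k + 1, by omega, by rw [pow_succ', ← h, mul_inv_cancel_left]⟩
  · rintro c ⟨k, hk, h⟩
    have h : s⁻¹ * c = s ^ k := h
    exact ⟨⟨k + 1, by omega, by rw [pow_succ', ← h, mul_inv_cancel_left]⟩, k, by omega, h⟩
  · rintro _ ⟨k, hk, rfl⟩ h
    obtain rfl : k = 0 := by
      by_contra hk0
      exact h (hmem k (by omega) hk)
    simp
  · rintro c ⟨k, hk, h⟩ hc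
    have hck : c = s ^ (k + 1) := by rw [pow_succ', ← h, mul_inv_cancel_left]
    obtain rfl : k = i := by
      by_contra hki
      exact hc (hck ▸ hmem (k + 1) (by omega) (by omega))
    rw [h, hck]
    push_cast
    ring

end relations

/-! ### Classification of the objects of `𝓑_W` -/

theorem BW.of_isoClass {s : ℂˣ} {M : GrBimod} (h : isoClass M ∈ BWClasses s) : BW s M := by
  obtain ⟨N, hN, h⟩ := h
  exact hN.iso (isoClass_eq_iff.1 h)

theorem BW.isoClass_mem {s : ℂˣ} {M : GrBimod} (h : BW s M) : isoClass M ∈ BWClasses s :=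
  ⟨M, h, rfl⟩

theorem mem_BWClasses_of_add {s : ℂˣ} {x y : IsoClass} (h : x + y ∈ BWClasses s) :
    x ∈ BWClasses s := by
  obtain ⟨M, rfl⟩ := isoClass_surjective x
  obtain ⟨N, rfl⟩ := isoClass_surjective y
  exact (BW.of_isoClass (M := M.sum N) h).summand.isoClass_mem

theorem vc_mem (s : ℂˣ) (n : ℤ) : vc n ∈ BWClasses s := (BW.unit.shift n).isoClass_mem

theorem oc_C_one_mem (s : ℂˣ) : oc (powersLE s 1) ∈ BWClasses s := by
  rw [powersLE_one]; exact BW.gen.isoClass_mem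

/-- The square of `𝒪(e, s)` is `𝒪(e, s, s²) ⊕ 𝒪(s)[-2]`, so `𝒪(s)` is a shifted summand. The
relation used, with `i = 1`, requires `2 < d`. -/
theorem oc_s_mem {s : ℂˣ} (hs : 2 < orderOf s) : oc {s} ∈ BWClasses s := by
  have h := mul_mem (oc_C_one_mem s) (oc_C_one_mem s)
  rw [oc_C_one_mul le_rfl hs, add_comm, oc_powersLE_zero, mul_one] at h
  have h2 := mul_mem (vc_mem s 2) (mem_BWClasses_of_add h)
  rwa [← mul_assoc, ← vc_add, add_neg_cancel, vc_zero, one_mul] at h2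

/-- `𝒪(e, …, s ^ (i + 1))` is a direct summand of `𝒪(e, s) ⊗ 𝒪(e, …, s ^ i)`. -/
theorem oc_powersLE_mem {s : ℂˣ} {i : ℕ} (hi : i < orderOf s) :
    oc (powersLE s i) ∈ BWClasses s := by
  induction i with
  | zero => rw [oc_powersLE_zero]; exact one_mem _
  | succ i ih =>
    rcases Nat.eq_zero_or_pos i with rfl | h
    · exact oc_C_one_mem s
    · have h2 := mul_mem (oc_C_one_mem s) (ih (by omega))
      rw [oc_C_one_mul h hi] at h2
      exact mem_BWClasses_of_add h2

/-- The classes of the standard indecomposable objects. -/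
def stdClasses (s : ℂˣ) : Set IsoClass :=
  {x | ∃ (n : ℤ) (a i : ℕ), i < orderOf s ∧ x = vc n * (oc {s} ^ a * oc (powersLE s i))}

theorem nonempty_powersLE (s : ℂˣ) (i : ℕ) : (powersLE s i).Nonempty := ⟨_, 0, Nat.zero_le _, rfl⟩

/-- The translate `s ^ a {e, …, s ^ i}`. -/
def cyc (s : ℂˣ) (a i : ℕ) : Set ℂˣ := ((s ^ a)⁻¹ * ·) ⁻¹' powersLE s i

theorem nonempty_cyc (s : ℂˣ) (a i : ℕ) : (cyc s a i).Nonempty := by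
  obtain ⟨b, hb⟩ := nonempty_powersLE s i
  exact ⟨s ^ a * b, by
    change (s ^ a)⁻¹ * (s ^ a * b) ∈ powersLE s i
    rwa [inv_mul_cancel_left]⟩

theorem oc_cyc (s : ℂˣ) (a i : ℕ) : oc {s} ^ a * oc (powersLE s i) = oc (cyc s a i) := by
  rw [oc_singleton_pow, oc_singleton_mul, cyc]

theorem isBrick_of_mem_stdClasses {s : ℂˣ} {x : IsoClass} (hx : x ∈ stdClasses s) :
    ∃ B, IsBrick B ∧ isoClass B = x := by
  obtain ⟨n, a, i, -, rfl⟩ := hx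
  refine ⟨(O (cyc s a i)).shift n, isBrick_O (nonempty_cyc s a i) n, ?_⟩
  rw [oc_cyc, isoClass_shift, oc]

/-- The sums of standard indecomposable classes. -/
def stdSums (s : ℂˣ) : AddSubmonoid IsoClass := AddSubmonoid.closure (stdClasses s)

theorem mul_stdSums {s : ℂˣ} {y : IsoClass} (h : ∀ x ∈ stdClasses s, y * x ∈ stdSums s)
    {x : IsoClass} (hx : x ∈ stdSums s) : y * x ∈ stdSums s := by
  induction hx using AddSubmonoid.closure_induction with
  | mem x hx => exact h x hx
  | zero => rw [mul_zero]; exact zero_mem _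
  | add x z _ _ hx hz => rw [mul_add]; exact add_mem hx hz

theorem vc_mul_stdSums {s : ℂˣ} (n : ℤ) {x : IsoClass} (hx : x ∈ stdSums s) :
    vc n * x ∈ stdSums s := by
  refine mul_stdSums ?_ hx
  rintro _ ⟨m, a, i, hi, rfl⟩
  refine AddSubmonoid.subset_closure ⟨n + m, a, i, hi, ?_⟩
  rw [vc_add, mul_assoc]

theorem s_mul_stdSums {s : ℂˣ} {x : IsoClass} (hx : x ∈ stdSums s) :
    oc {s} * x ∈ stdSums s := by
  refine mul_stdSums ?_ hx
  rintro _ ⟨m, a, i, hi, rfl⟩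
  refine AddSubmonoid.subset_closure ⟨m, a + 1, i, hi, ?_⟩
  rw [← mul_assoc, vc_comm, mul_assoc, pow_succ', mul_assoc]

theorem s_pow_mul_stdSums {s : ℂˣ} (a : ℕ) {x : IsoClass} (hx : x ∈ stdSums s) :
    oc {s} ^ a * x ∈ stdSums s := by
  induction a with
  | zero => rwa [pow_zero, one_mul]
  | succ a ih => rw [pow_succ', mul_assoc]; exact s_mul_stdSums ih

theorem oc_powersLE_mem_stdSums {s : ℂˣ} {i : ℕ} (hi : i < orderOf s) :
    oc (powersLE s i) ∈ stdSums s :=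
  AddSubmonoid.subset_closure ⟨0, 0, i, hi, by rw [vc_zero, pow_zero, one_mul, one_mul]⟩

theorem C_one_mul_stdSums {s : ℂˣ} (hs : 1 < orderOf s) {x : IsoClass} (hx : x ∈ stdSums s) :
    oc (powersLE s 1) * x ∈ stdSums s := by
  refine mul_stdSums ?_ hx
  rintro _ ⟨m, a, i, hi, rfl⟩
  have hc : oc (powersLE s 1) * (vc m * (oc {s} ^ a * oc (powersLE s i))) =
      vc m * (oc {s} ^ a * (oc (powersLE s 1) * oc (powersLE s i))) := by
    have h1 : Commute (oc {s} ^ a) (oc (powersLE s 1)) := Commute.pow_left (oc_s_comm _) a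
    rw [← mul_assoc, vc_comm, mul_assoc, ← mul_assoc (oc (powersLE s 1)), ← h1.eq, mul_assoc]
  rw [hc]
  refine vc_mul_stdSums _ (s_pow_mul_stdSums _ ?_)
  rcases Nat.eq_zero_or_pos i with rfl | h0
  · rw [oc_powersLE_zero, mul_one]
    exact oc_powersLE_mem_stdSums hs
  rcases Nat.lt_or_ge (i + 1) (orderOf s) with h | h
  · rw [oc_C_one_mul h0 h]
    exact add_mem (oc_powersLE_mem_stdSums h)
      (vc_mul_stdSums _ (s_mul_stdSums (oc_powersLE_mem_stdSums (by omega))))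
  · obtain rfl : i = orderOf s - 1 := by omega
    rw [oc_C_one_mul_last hs]
    exact add_mem (oc_powersLE_mem_stdSums hi) (vc_mul_stdSums _ (oc_powersLE_mem_stdSums hi))

/-- The product for `i + 1` is a direct summand of the product with `𝒪(e, s)` of the product for
`i`. There is no subtraction in the semiring, so closure of sums of bricks under summands takes its
place. -/
theorem C_mul_stdSums {s : ℂˣ} {i : ℕ} (hi : i < orderOf s) {x : IsoClass} (hx : x ∈ stdSums s) :
    oc (powersLE s i) * x ∈ stdSums s := by
  induction i with
  | zero => rwa [oc_powersLE_zero, one_mul]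
  | succ i ih =>
    rcases Nat.eq_zero_or_pos i with rfl | h
    · exact C_one_mul_stdSums hi hx
    · have h2 := C_one_mul_stdSums (by omega) (ih (by omega))
      rw [← mul_assoc, oc_C_one_mul h hi, add_mul] at h2
      exact mem_closure_of_add_mem (fun _ => isBrick_of_mem_stdClasses) h2

theorem mul_mem_stdSums {s : ℂˣ} {x y : IsoClass} (hx : x ∈ stdSums s) (hy : y ∈ stdSums s) :
    x * y ∈ stdSums s := by
  induction hx using AddSubmonoid.closure_induction with
  | mem x hx =>
    obtain ⟨m, a, i, hi, rfl⟩ := hx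
    rw [mul_assoc, mul_assoc]
    exact vc_mul_stdSums _ (s_pow_mul_stdSums _ (C_mul_stdSums hi hy))
  | zero => rw [zero_mul]; exact zero_mem _
  | add x z _ _ hx hz => rw [add_mul]; exact add_mem hx hz

/-- Every object of `𝓑_W` is a sum of shifts of bimodules `𝒪(s ^ a {e, …, s ^ i})`. -/
theorem BW.mem_stdSums {s : ℂˣ} (hs : 1 < orderOf s) {M : GrBimod} (hM : BW s M) :
    isoClass M ∈ stdSums s := by
  have h1 : (1 : IsoClass) ∈ stdSums s := by
    rw [← oc_powersLE_zero (s := s)]; exact oc_powersLE_mem_stdSums (by omega)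
  induction hM with
  | gen =>
    have := oc_powersLE_mem_stdSums hs
    rwa [powersLE_one] at this
  | unit => exact h1
  | zero => exact zero_mem _
  | tensor _ _ h h' => exact mul_mem_stdSums h h'
  | sum _ _ h h' => exact add_mem h h'
  | shift n _ h => rw [isoClass_shift]; exact vc_mul_stdSums n h
  | @summand M N _ h => exact mem_closure_of_add_mem (y := isoClass N) (fun _ => isBrick_of_mem_stdClasses) h
  | iso _ e h =>
    obtain ⟨e⟩ := e
    rwa [← isoClass_eq e]


namespace GrBimod

open MvPolynomial (X)

/-! ### Multiplicities -/

/-- The subspace `x M + M y`. -/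
def rad (M : GrBimod) : Submodule ℂ M.carrier :=
  LinearMap.range (M.left Polynomial.X) ⊔ LinearMap.range (M.right Polynomial.X)

theorem map_rad {M N : GrBimod} (f : Hom M N) : M.rad ≤ N.rad.comap f.toLin := by
  refine sup_le ?_ ?_
  · rintro _ ⟨m, rfl⟩
    exact Submodule.mem_sup_left ⟨f.toLin m, (f.map_left _ _).symm⟩
  · rintro _ ⟨m, rfl⟩
    exact Submodule.mem_sup_right ⟨f.toLin m, (f.map_right _ _).symm⟩

/-- The map induced on the quotients `M / (x M + M y)`. -/
def barMap {M N : GrBimod} (f : Hom M N) : (M.carrier ⧸ M.rad) →ₗ[ℂ] (N.carrier ⧸ N.rad) :=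
  M.rad.mapQ N.rad f.toLin (map_rad f)

/-- The part of `M / (x M + M y)` spanned by the images of `1` under the morphisms from
`𝒪(A)[n]` to `M`. -/
def genSpan (A : Set ℂˣ) (n : ℤ) (M : GrBimod) : Submodule ℂ (M.carrier ⧸ M.rad) :=
  Submodule.span ℂ (Set.range fun f : Hom ((O A).shift n) M => M.rad.mkQ (f.toLin (oe A 1)))

theorem genSpan_map_le (A : Set ℂˣ) (n : ℤ) {M N : GrBimod} (f : Hom M N) :
    ∀ x ∈ genSpan A n M, barMap f x ∈ genSpan A n N := by
  change genSpan A n M ≤ (genSpan A n N).comap (barMap f)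
  rw [genSpan, Submodule.span_le]
  rintro _ ⟨g, rfl⟩
  exact Submodule.subset_span ⟨(g ≫ f : (O A).shift n ⟶ N), rfl⟩

/-- The map induced on the subspaces `genSpan`. -/
def genMap (A : Set ℂˣ) (n : ℤ) {M N : GrBimod} (f : Hom M N) :
    genSpan A n M →ₗ[ℂ] genSpan A n N :=
  (barMap f).restrict (genSpan_map_le A n f)

theorem genMap_eq (A : Set ℂˣ) (n : ℤ) {M N : GrBimod} (f : Hom M N) (x : genSpan A n M)
    (m : M.carrier) (hx : (x : M.carrier ⧸ M.rad) = M.rad.mkQ m) :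
    (genMap A n f x : N.carrier ⧸ N.rad) = N.rad.mkQ (f.toLin m) := by
  change barMap f x = _
  rw [hx]
  rfl

theorem exists_mkQ {A : Set ℂˣ} {n : ℤ} {M : GrBimod} (x : genSpan A n M) :
    ∃ m, (x : M.carrier ⧸ M.rad) = M.rad.mkQ m := by
  obtain ⟨m, hm⟩ := M.rad.mkQ_surjective x
  exact ⟨m, hm.symm⟩

/-- The dimension of `genSpan A n M`. -/
def mult (A : Set ℂˣ) (n : ℤ) (M : GrBimod) : ℕ := Module.finrank ℂ (genSpan A n M)

/-- Isomorphic bimodules have isomorphic subspaces `genSpan`. -/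
def genSpanCongr (A : Set ℂˣ) (n : ℤ) {M N : GrBimod} (e : M ≅ N) :
    genSpan A n M ≃ₗ[ℂ] genSpan A n N :=
  LinearEquiv.ofLinearMap (genMap A n e.hom) (genMap A n e.inv)
    (LinearMap.ext fun x => by
      obtain ⟨m, hm⟩ := exists_mkQ x
      refine Subtype.ext ?_
      rw [LinearMap.comp_apply, genMap_eq A n _ _ _ (genMap_eq A n _ x m hm), iso_inv_hom]
      exact hm.symm)
    (LinearMap.ext fun x => by
      obtain ⟨m, hm⟩ := exists_mkQ x
      refine Subtype.ext ?_
      rw [LinearMap.comp_apply, genMap_eq A n _ _ _ (genMap_eq A n _ x m hm), iso_hom_inv]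
      exact hm.symm)

/-- `genSpan` is additive. -/
def genSpanSum (A : Set ℂˣ) (n : ℤ) (M N : GrBimod) :
    genSpan A n (M.sum N) ≃ₗ[ℂ] genSpan A n M × genSpan A n N :=
  LinearEquiv.ofLinearMap ((genMap A n (fstHom M N)).prod (genMap A n (sndHom M N)))
    ((genMap A n (inlHom M N)).coprod (genMap A n (inrHom M N)))
    (LinearMap.ext fun x => by
      obtain ⟨x, y⟩ := x
      obtain ⟨m, hm⟩ := exists_mkQ x
      obtain ⟨m', hm'⟩ := exists_mkQ y
      have h : (((genMap A n (inlHom M N)).coprod (genMap A n (inrHom M N)) (x, y) :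
          genSpan A n (M.sum N)) : _ ⧸ (M.sum N).rad) = (M.sum N).rad.mkQ (m, m') := by
        rw [LinearMap.coprod_apply, Submodule.coe_add, genMap_eq A n _ x m hm,
          genMap_eq A n _ y m' hm', ← map_add]
        congr 1
        exact Prod.ext (add_zero m) (zero_add m')
      refine Prod.ext (Subtype.ext ?_) (Subtype.ext ?_)
      · exact (genMap_eq A n (fstHom M N) _ _ h).trans hm.symm
      · exact (genMap_eq A n (sndHom M N) _ _ h).trans hm'.symm)
    (LinearMap.ext fun x => by
      obtain ⟨m, hm⟩ := exists_mkQ x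
      refine Subtype.ext ?_
      rw [LinearMap.comp_apply, LinearMap.coprod_apply, Submodule.coe_add, LinearMap.prod_apply]
      change (genMap A n (inlHom M N) (genMap A n (fstHom M N) x) : _ ⧸ (M.sum N).rad) +
        (genMap A n (inrHom M N) (genMap A n (sndHom M N) x) : _ ⧸ (M.sum N).rad) = _
      rw [genMap_eq A n (inlHom M N) _ _ (genMap_eq A n (fstHom M N) x m hm),
        genMap_eq A n (inrHom M N) _ _ (genMap_eq A n (sndHom M N) x m hm), ← map_add]
      refine Eq.trans ?_ hm.symm
      congr 1
      exact Prod.ext (add_zero m.1) (zero_add m.2))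

/-- Both coordinates act by zero on the quotient, so a polynomial contributes only its constant
term. -/
theorem mkQ_oe (B : Set ℂˣ) (k : ℤ) (p : MvPolynomial (Fin 2) ℂ) :
    ((O B).shift k).rad.mkQ (oe B p) =
      MvPolynomial.constantCoeff p • ((O B).shift k).rad.mkQ (oe B 1) := by
  induction p using MvPolynomial.induction_on with
  | C a => rw [oe_C, map_smul, MvPolynomial.constantCoeff_C]
  | add p q hp hq => rw [map_add, map_add, map_add, hp, hq, add_smul]
  | mul_X p i hp =>
    rw [map_mul MvPolynomial.constantCoeff, MvPolynomial.constantCoeff_X, mul_zero, zero_smul]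
    refine (Submodule.Quotient.mk_eq_zero _).2 ?_
    fin_cases i
    · exact Submodule.mem_sup_left ⟨oe B p, left_oe B p⟩
    · exact Submodule.mem_sup_right ⟨oe B p, right_oe B p⟩

/-- Evaluation at the origin kills `x M + M y` but not `1`. -/
theorem mkQ_oe_one_ne_zero {B : Set ℂˣ} (hB : B.Nonempty) (k : ℤ) :
    ((O B).shift k).rad.mkQ (oe B 1) ≠ 0 := by
  obtain ⟨b, hb⟩ := hB
  intro h
  have h1 : oe B 1 ∈ ((O B).shift k).rad := (Submodule.Quotient.mk_eq_zero _).1 h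
  have h2 : ((O B).shift k).rad ≤ LinearMap.ker (ev B ⟨b, hb⟩ 0) := by
    refine sup_le ?_ ?_
    · rintro _ ⟨m, rfl⟩
      exact (ev_left B ⟨b, hb⟩ 0 m).trans (by simp)
    · rintro _ ⟨m, rfl⟩
      exact (ev_right B ⟨b, hb⟩ 0 m).trans (by simp)
  have h3 : ev B ⟨b, hb⟩ 0 (oe B 1) = 0 := h2 h1
  rw [ev_oe, map_one] at h3
  exact one_ne_zero h3

theorem genSpan_le_span (A B : Set ℂˣ) (n k : ℤ) :
    genSpan A n ((O B).shift k) ≤ Submodule.span ℂ {((O B).shift k).rad.mkQ (oe B 1)} := by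
  rw [genSpan, Submodule.span_le]
  rintro _ ⟨f, rfl⟩
  obtain ⟨p, hp⟩ := oe_surjective B (f.toLin (oe A 1))
  have h : ((O B).shift k).rad.mkQ (f.toLin (oe A 1)) = _ := (congrArg _ hp.symm).trans (mkQ_oe B k p)
  exact Submodule.mem_span_singleton.2 ⟨_, h.symm⟩

instance finite_genSpan_O (A B : Set ℂˣ) (n k : ℤ) :
    Module.Finite ℂ (genSpan A n ((O B).shift k)) :=
  Submodule.finiteDimensional_of_le (genSpan_le_span A B n k)

/-- The image of `1` is a homogeneous polynomial with nonzero constant term, hence a nonzero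
constant, which forces the shifts to agree. Every equation of `A` must then hold on `B`. -/
theorem subset_of_hom {A B : Set ℂˣ} (hA : A.Finite) {n k : ℤ}
    (f : Hom ((O A).shift n) ((O B).shift k))
    (hf : ((O B).shift k).rad.mkQ (f.toLin (oe A 1)) ≠ 0) : k = n ∧ B ⊆ A := by
  have h1 : f.toLin (oe A 1) ∈ (O B).gr (-n + k) := f.map_gr (-n) (oe A 1) (by
    change _ ∈ (O A).gr (-n + n)
    rw [neg_add_cancel]; exact oe_one_mem A)
  obtain h | ⟨j, p, hj, hp, h⟩ := exists_homogeneous_of_mem h1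
  · exact absurd ((congrArg _ h).trans (map_zero _)) hf
  have hc : MvPolynomial.coeff 0 p ≠ 0 := by
    intro h0
    apply hf
    refine (congrArg _ h).trans ((mkQ_oe B k p).trans ?_)
    rw [MvPolynomial.constantCoeff_eq, h0, zero_smul]
  have hj0 : j = 0 := by
    have := hp hc
    simpa using this.symm
  subst hj0
  refine ⟨by omega, fun b hb => ?_⟩
  by_contra hbA
  -- The product of the equations `x - a y` of the lines of `A`, which is a polynomial because `A`
  -- is finite. It is tested at the point `(b, 1)`.
  let P : MvPolynomial (Fin 2) ℂ := ∏ a ∈ hA.toFinset, (X 0 - MvPolynomial.C (a : ℂ) * X 1)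
  have hP : oe A P = 0 := oe_eq_zero.2 fun a ha v => by
    rw [map_prod]
    exact Finset.prod_eq_zero (hA.mem_toFinset.2 ha) (by simp)
  have h2 : f.toLin (oe A P) = oe B (p * P) := by
    rw [hom_oe, h, act_shift, act_oe]
  rw [hP, map_zero] at h2
  have h3 := oe_eq_zero.1 h2.symm b hb 1
  rw [MvPolynomial.totalDegree_eq_zero_iff_eq_C.1 (Nat.le_zero.1 hp.totalDegree_le), map_mul,
    MvPolynomial.eval_C, map_prod] at h3
  refine (mul_ne_zero hc (Finset.prod_ne_zero_iff.2 fun a ha => ?_)) h3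
  simp only [map_sub, map_mul, MvPolynomial.eval_X, MvPolynomial.eval_C, Matrix.cons_val_zero,
    Matrix.cons_val_one, mul_one]
  refine sub_ne_zero.2 fun h => hbA ?_
  rw [Units.ext h]
  exact hA.mem_toFinset.1 ha

open Classical in
-- If `B ⊆ A`, restriction of functions sends `1` to `1` and hits the one-dimensional quotient.
-- Otherwise `subset_of_hom` shows that no morphism does.
theorem mult_O {A B : Set ℂˣ} (hA : A.Finite) (hB : B.Nonempty) (n k : ℤ) :
    mult A n ((O B).shift k) = if k = n ∧ B ⊆ A then 1 else 0 := by
  split_ifs with h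
  · obtain ⟨rfl, hBA⟩ := h
    have : genSpan A k ((O B).shift k) = Submodule.span ℂ {((O B).shift k).rad.mkQ (oe B 1)} := by
      refine le_antisymm (genSpan_le_span A B k k) ?_
      rw [Submodule.span_singleton_le_iff_mem]
      have h1 : oe B 1 ∈ (O B).gr (-k + k) := by rw [neg_add_cancel]; exact oe_one_mem B
      have h2 : ∀ p, oe A p = 0 → ((O B).shift k).act (oe B 1) p = 0 := fun p hp => by
        rw [act_shift, act_oe, one_mul]
        exact oe_eq_zero.2 fun b hb => oe_eq_zero.1 hp b (hBA hb)
      refine Submodule.subset_span ⟨homOfElement (M := (O B).shift k) k (oe B 1) h1 h2, ?_⟩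
      change ((O B).shift k).rad.mkQ ((homOfElement (M := (O B).shift k) k (oe B 1) h1 h2).toLin (oe A 1)) = _
      rw [homOfElement_oe, act_one]
    rw [mult, this]
    exact finrank_span_singleton (mkQ_oe_one_ne_zero hB k)
  · have : genSpan A n ((O B).shift k) = ⊥ := by
      rw [genSpan, Submodule.span_eq_bot]
      rintro _ ⟨f, rfl⟩
      by_contra hf
      exact h (subset_of_hom hA f hf)
    rw [mult, this, finrank_bot]

end GrBimod

/-! ### Multiplicity functionals on `A_W` -/

open GrBimod

/-- The bimodules with finite multiplicity, up to isomorphism. -/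
def finClasses (A : Set ℂˣ) (n : ℤ) : AddSubmonoid IsoClass where
  carrier := {x | ∃ M, Module.Finite ℂ (genSpan A n M) ∧ isoClass M = x}
  add_mem' := by
    rintro _ _ ⟨M, hM, rfl⟩ ⟨N, hN, rfl⟩
    exact ⟨M.sum N, Module.Finite.equiv (genSpanSum A n M N).symm, rfl⟩
  zero_mem' := by
    refine ⟨GrBimod.zero, ?_, rfl⟩
    have : Module.Finite ℂ GrBimod.zero.carrier := inferInstanceAs (Module.Finite ℂ PUnit)
    infer_instance

/-- Finiteness holds for each `𝒪(B)[k]` and passes to sums, so the classification gives it for all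
objects. It is needed because `finrank` is additive only on finite-dimensional spaces. -/
theorem BW.finite_genSpan {s : ℂˣ} (hs : 1 < orderOf s) {M : GrBimod} (hM : BW s M) (A : Set ℂˣ)
    (n : ℤ) : Module.Finite ℂ (genSpan A n M) := by
  have h : stdSums s ≤ finClasses A n := by
    rw [stdSums, AddSubmonoid.closure_le]
    rintro _ ⟨k, a, i, -, rfl⟩
    exact ⟨(O (cyc s a i)).shift k, finite_genSpan_O A _ n k, by
      rw [oc_cyc, isoClass_shift, oc]⟩
  obtain ⟨N, hN, hNM⟩ := h (hM.mem_stdSums hs)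
  obtain ⟨e⟩ := isoClass_eq_iff.1 hNM
  exact Module.Finite.equiv (genSpanCongr A n e)

/-- The multiplicity of an isomorphism class. -/
def multClass (A : Set ℂˣ) (n : ℤ) : IsoClass → ℕ :=
  Quotient.lift (mult A n) fun _ _ ⟨e⟩ => (genSpanCongr A n e).finrank_eq

theorem multClass_isoClass (A : Set ℂˣ) (n : ℤ) (M : GrBimod) :
    multClass A n (isoClass M) = mult A n M := rfl

theorem multClass_add {s : ℂˣ} (hs : 1 < orderOf s) (A : Set ℂˣ) (n : ℤ) {x y : IsoClass}
    (hx : x ∈ BWClasses s) (hy : y ∈ BWClasses s) :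
    multClass A n (x + y) = multClass A n x + multClass A n y := by
  obtain ⟨M, hM, rfl⟩ := hx
  obtain ⟨N, hN, rfl⟩ := hy
  have := hM.finite_genSpan hs A n
  have := hN.finite_genSpan hs A n
  exact (genSpanSum A n M N).finrank_eq.trans Module.finrank_prod

/-- An additive function on classes of objects induces a map on `A_W`. -/
theorem exists_addHom {s : ℂˣ} (μ : BWClasses s → ℤ) (hμ : ∀ a b, μ (a + b) = μ a + μ b) :
    ∃ Φ : AW s →+ ℤ, ∀ c, Φ (classHom s c) = μ c := by
  let Φ₀ : MonoidAlgebra ℤ (BWClasses s) →+ ℤ := MonoidAlgebra.liftNC (AddMonoidHom.id ℤ) μ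
  have h₀ : ∀ c, Φ₀ (MonoidAlgebra.of ℤ _ c) = μ c := fun c => by
    simp [Φ₀]
  have hker : ∀ x ∈ splitRel s, Φ₀ x = 0 := by
    intro x hx
    induction hx using AddSubgroup.closure_induction with
    | mem x hx =>
      obtain ⟨a, b, rfl⟩ := hx
      rw [map_sub, map_sub, h₀, h₀, h₀, hμ]
      ring
    | zero => exact map_zero _
    | add x y _ _ hx hy => rw [map_add, hx, hy, add_zero]
    | neg x _ hx => rw [map_neg, hx, neg_zero]
  let Φ : (splitCon s).Quotient →+ ℤ := (splitCon s).toAddCon.lift Φ₀ (by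
    intro x y h
    have h : x - y ∈ splitRel s := h
    have := hker _ h
    rwa [map_sub, sub_eq_zero] at this)
  exact ⟨Φ, fun c => h₀ c⟩

open Classical in
/-- The functional on `A_W` given by `mult A n`. -/
theorem exists_multHom {s : ℂˣ} (hs : 1 < orderOf s) {A : Set ℂˣ} (hA : A.Finite) (n : ℤ) :
    ∃ Φ : AW s →+ ℤ, ∀ (B : Set ℂˣ) (_ : B.Nonempty) (hO : BW s (O B)) (p : LaurentPolynomial ℤ),
      Φ (p • cls s (O B) hO) = if B ⊆ A then p.coeff n else 0 := by
  obtain ⟨Φ, hΦ⟩ := exists_addHom (s := s) (fun c => (multClass A n c : ℤ)) (fun a b => by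
    change ((multClass A n ((a : IsoClass) + b) : ℕ) : ℤ) = _
    rw [multClass_add hs A n a.2 b.2]
    push_cast; rfl)
  refine ⟨Φ, fun B hB hO p => ?_⟩
  have hT : ∀ k : ℤ, Φ ((LaurentPolynomial.T k : LaurentPolynomial ℤ) • cls s (O B) hO) =
      if k = n ∧ B ⊆ A then 1 else 0 := fun k => by
    rw [T_smul_cls, cls, hΦ]
    change ((multClass A n (isoClass ((O B).shift k)) : ℕ) : ℤ) = _
    rw [multClass_isoClass, mult_O hA hB]
    split_ifs <;> simp
  induction p using LaurentPolynomial.induction_on' with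
  | add p q hp hq =>
    rw [add_smul, map_add, hp, hq]
    split_ifs <;> simp
  | C_mul_T k a =>
    have h1 : (LaurentPolynomial.C a * LaurentPolynomial.T k : LaurentPolynomial ℤ) =
        a • LaurentPolynomial.T k := by
      rw [LaurentPolynomial.smul_eq_C_mul]
    have h2 : (LaurentPolynomial.T k : LaurentPolynomial ℤ).coeff n = if k = n then 1 else 0 :=
      Finsupp.single_apply
    rw [h1, smul_assoc, map_zsmul, hT, AddMonoidAlgebra.coeff_smul, Finsupp.smul_apply, h2]
    by_cases hBA : B ⊆ A <;> by_cases hk : k = n <;> simp [hBA, hk]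


/-! ### Linear independence of the classes of the bimodules `𝒪(A)` -/

/-- The multiplicity functionals are triangular for inclusion of the sets `B j`: the functional of
`B j` in degree `n` sees only the terms with `B k ⊆ B j`, and from the term `j` it extracts the
coefficient of `v ^ n` in `p j`. -/
theorem coeff_eq_zero_of_sum_cls {s : ℂˣ} (hs : 1 < orderOf s) {ι : Type} (I : Finset ι)
    (B : ι → Set ℂˣ) (hfin : ∀ j, (B j).Finite) (hne : ∀ j, (B j).Nonempty)
    (hinj : Set.InjOn B I) (hO : ∀ j, BW s (O (B j))) (p : ι → LaurentPolynomial ℤ)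
    (h : ∑ j ∈ I, p j • cls s (O (B j)) (hO j) = 0) : ∀ j ∈ I, p j = 0 := by
  classical
  suffices key : ∀ m, ∀ j ∈ I, (B j).ncard = m → p j = 0 from fun j hj => key _ j hj rfl
  intro m
  induction m using Nat.strong_induction_on with
  | _ m ih =>
    intro j hj hm
    refine LaurentPolynomial.ext fun n => ?_
    obtain ⟨Φ, hΦ⟩ := exists_multHom hs (hfin j) n
    have h1 := congrArg Φ h
    rw [map_sum, map_zero] at h1
    simp only [hΦ _ (hne _)] at h1
    rw [Finset.sum_eq_single j] at h1
    · rwa [if_pos subset_rfl] at h1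
    -- A contributing `k ≠ j` has `B k` strictly inside `B j`, since the sets are distinct, and its
    -- coefficient vanishes by induction on cardinality.
    · intro k hk hkj
      split_ifs with hB
      · have hlt : (B k).ncard < m := by
          rw [← hm]
          exact Set.ncard_lt_ncard (hB.ssubset_of_ne fun h => hkj (hinj hk hj h)) (hfin j)
        rw [ih _ hlt k hk rfl]
        rfl
      · rfl
    · exact fun h => absurd hj h

/-! ### The generators of `A_W` -/

section gens
variable {s : ℂˣ}

/-- The element of `A_W` given by the class of an object. -/
def cl {x : IsoClass} (hx : x ∈ BWClasses s) : AW s := classHom s ⟨x, hx⟩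

theorem cl_congr {x y : IsoClass} (hx : x ∈ BWClasses s) (hy : y ∈ BWClasses s) (h : x = y) :
    cl hx = cl hy := by
  subst h; rfl

theorem cl_add {x y : IsoClass} (hx : x ∈ BWClasses s) (hy : y ∈ BWClasses s) :
    cl (add_mem hx hy) = cl hx + cl hy := classHom_add s ⟨x, hx⟩ ⟨y, hy⟩

theorem cl_mul {x y : IsoClass} (hx : x ∈ BWClasses s) (hy : y ∈ BWClasses s) :
    cl (mul_mem hx hy) = cl hx * cl hy := map_mul (classHom s) ⟨x, hx⟩ ⟨y, hy⟩

theorem cl_pow {x : IsoClass} (hx : x ∈ BWClasses s) (n : ℕ) :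
    cl (pow_mem hx n) = cl hx ^ n := map_pow (classHom s) ⟨x, hx⟩ n

theorem cl_one : cl (one_mem (BWClasses s)) = 1 := map_one (classHom s)

theorem cl_zero : cl (zero_mem (BWClasses s)) = 0 := by
  have h := cl_add (zero_mem (BWClasses s)) (zero_mem (BWClasses s))
  rw [cl_congr _ (zero_mem (BWClasses s)) (add_zero (0 : IsoClass))] at h
  exact left_eq_add.1 h

theorem cl_vc_mul {x : IsoClass} (hx : x ∈ BWClasses s) (n : ℤ) :
    cl (mul_mem (vc_mem s n) hx) = (LaurentPolynomial.T n : LaurentPolynomial ℤ) • cl hx := by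
  rw [cl_mul (vc_mem s n) hx, Algebra.smul_def]
  exact congrArg (· * _) (structureHom_T s n).symm

theorem T_smul_T_smul (m n : ℤ) (x : AW s) : (LaurentPolynomial.T m : LaurentPolynomial ℤ) •
    (LaurentPolynomial.T n : LaurentPolynomial ℤ) • x =
    (LaurentPolynomial.T (m + n) : LaurentPolynomial ℤ) • x := by
  rw [smul_smul, LaurentPolynomial.T_add]

/-- The class of `𝒪(s)`. -/
def aS (hs : 2 < orderOf s) : AW s := cl (oc_s_mem hs)

/-- The class of `𝒪(e, s, …, s ^ i)`, with value `0` for `i ≥ d`. -/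
def aP (s : ℂˣ) (i : ℕ) : AW s := if h : i < orderOf s then cl (oc_powersLE_mem h) else 0

/-- The class `C_i` of `𝒪(e, s, …, s ^ i)[i]`. -/
def aC (s : ℂˣ) (i : ℕ) : AW s := (LaurentPolynomial.T (i : ℤ) : LaurentPolynomial ℤ) • aP s i

theorem aP_eq {i : ℕ} (h : i < orderOf s) : aP s i = cl (oc_powersLE_mem h) := dif_pos h

theorem aS_pow (hs : 2 < orderOf s) : aS hs ^ orderOf s = 1 := by
  rw [aS, ← cl_pow, ← cl_one]
  exact cl_congr _ _ oc_s_pow_orderOf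

theorem aC_zero (hs : 2 < orderOf s) : aC s 0 = 1 := by
  rw [aC, aP_eq (by omega), ← cl_one, Nat.cast_zero, LaurentPolynomial.T_zero, one_smul]
  exact cl_congr _ _ oc_powersLE_zero

theorem aS_mul_aC (hs : 2 < orderOf s) {i : ℕ} (hi : i < orderOf s) :
    aS hs * aC s i = aC s i * aS hs := by
  rw [aC, mul_smul_comm, smul_mul_assoc, aP_eq hi, aS, ← cl_mul, ← cl_mul]
  exact congrArg _ (cl_congr _ _ (oc_s_comm _))

theorem aS_mul_last (hs : 2 < orderOf s) :
    aS hs * aC s (orderOf s - 1) = aC s (orderOf s - 1) := by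
  rw [aC, mul_smul_comm, aP_eq (by omega), aS, ← cl_mul]
  exact congrArg _ (cl_congr _ _ (oc_s_mul_last (by omega)))

/-- The shifts in the definition of the `C_i` turn `1 + v⁻²` into `v (1 + v⁻²) = v + v⁻¹`. -/
theorem aC_one_mul_last (hs : 2 < orderOf s) : aC s 1 * aC s (orderOf s - 1) =
    (LaurentPolynomial.T 1 + LaurentPolynomial.T (-1) : LaurentPolynomial ℤ) •
      aC s (orderOf s - 1) := by
  have h : aP s 1 * aP s (orderOf s - 1) = aP s (orderOf s - 1) +
      (LaurentPolynomial.T (-2) : LaurentPolynomial ℤ) • aP s (orderOf s - 1) := by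
    rw [aP_eq (i := 1) (by omega), aP_eq (i := orderOf s - 1) (by omega), ← cl_mul, ← cl_vc_mul,
      ← cl_add]
    exact cl_congr _ _ (oc_C_one_mul_last (by omega))
  rw [aC, aC, smul_mul_smul_comm, h, add_smul, smul_add, ← LaurentPolynomial.T_add, T_smul_T_smul,
    T_smul_T_smul, T_smul_T_smul]
  congr 3
  push_cast
  ring

/-- The total shift `i + 1` is the normalisation of `C_{i+1}`, and `i + 1 - 2 = i - 1` is that of
`C_{i-1}`. -/
theorem aC_one_mul (hs : 2 < orderOf s) {i : ℕ} (h1 : 1 ≤ i) (h2 : i + 1 < orderOf s) :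
    aC s 1 * aC s i = aC s (i + 1) + aS hs * aC s (i - 1) := by
  have h : aP s 1 * aP s i = aP s (i + 1) +
      (LaurentPolynomial.T (-2) : LaurentPolynomial ℤ) • (aS hs * aP s (i - 1)) := by
    rw [aP_eq (i := 1) (by omega), aP_eq (i := i) (by omega), aP_eq h2,
      aP_eq (i := i - 1) (by omega), aS, ← cl_mul, ← cl_mul, ← cl_vc_mul, ← cl_add]
    exact cl_congr _ _ (oc_C_one_mul h1 h2)
  rw [aC, aC, aC, aC, smul_mul_smul_comm, h, smul_add, ← LaurentPolynomial.T_add, T_smul_T_smul,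
    mul_smul_comm, Nat.cast_sub h1]
  congr 3
  · push_cast
    ring
  · push_cast
    ring

/-- By `C_{i+2} = C_1 C_{i+1} - s C_i`, all `C_i` lie in the subring generated by `s` and `C_1`. -/
theorem aC_commute_of (hs : 2 < orderOf s) {x : AW s} (h1 : Commute (aS hs) x)
    (h2 : Commute (aC s 1) x) {i : ℕ} (hi : i < orderOf s) : Commute (aC s i) x := by
  induction i using Nat.strong_induction_on with
  | _ i ih =>
    match i, hi, ih with
    | 0, _, _ => rw [aC_zero hs]; exact Commute.one_left x
    | 1, _, _ => exact h2
    | i + 2, hi, ih =>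
      rw [← add_sub_cancel_right (aC s (i + 2)) (aS hs * aC s i)]
      have h := aC_one_mul hs (i := i + 1) (by omega) hi
      rw [Nat.add_sub_cancel] at h
      rw [← h]
      exact (h2.mul_left (ih (i + 1) (by omega) (by omega))).sub_left
        (h1.mul_left (ih i (by omega) (by omega)))

theorem aC_commute (hs : 2 < orderOf s) {i j : ℕ} (hi : i < orderOf s) (hj : j < orderOf s) :
    aC s i * aC s j = aC s j * aC s i :=
  aC_commute_of hs (aS_mul_aC hs hj)
    (aC_commute_of hs (aS_mul_aC hs (by omega)) (Commute.refl _) hj).symm hi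

theorem aS_pow_mul_aC (hs : 2 < orderOf s) (a : ℕ) {i : ℕ} (hi : i < orderOf s)
    (h : BW s (O (cyc s a i))) : aS hs ^ a * aC s i =
      (LaurentPolynomial.T (i : ℤ) : LaurentPolynomial ℤ) • cls s (O (cyc s a i)) h := by
  rw [aC, mul_smul_comm, aP_eq hi, aS, ← cl_pow, ← cl_mul]
  exact congrArg _ (cl_congr _ h.isoClass_mem (oc_cyc s a i))

theorem BW_cyc (hs : 2 < orderOf s) (a : ℕ) {i : ℕ} (hi : i < orderOf s) :
    BW s (O (cyc s a i)) := by
  refine BW.of_isoClass ?_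
  have := mul_mem (pow_mem (oc_s_mem hs) a) (oc_powersLE_mem hi)
  rwa [oc_cyc] at this

/-- Every class is a sum of the elements `v ^ n s ^ a C_i`. -/
theorem mem_of_generators (hs : 2 < orderOf s) (S : Subalgebra (LaurentPolynomial ℤ) (AW s))
    (h1 : aS hs ∈ S) (h2 : ∀ i < orderOf s, aC s i ∈ S) (x : AW s) : x ∈ S := by
  refine AW_induction (p := fun x => x ∈ S) x (fun M hM => ?_) (zero_mem _)
    (fun _ _ => add_mem) (fun _ => neg_mem)
  -- Membership in `BWClasses s` is carried through the induction, since `cl` makes sense only for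
  -- such classes.
  suffices key : ∀ y ∈ stdSums s, ∃ hy : y ∈ BWClasses s, cl hy ∈ S by
    obtain ⟨hy, h⟩ := key _ (hM.mem_stdSums (by omega))
    exact h
  intro y hy
  induction hy using AddSubmonoid.closure_induction with
  | mem y hy =>
    obtain ⟨n, a, i, hi, rfl⟩ := hy
    refine ⟨mul_mem (vc_mem s n) (mul_mem (pow_mem (oc_s_mem hs) a) (oc_powersLE_mem hi)), ?_⟩
    rw [cl_vc_mul (mul_mem (pow_mem (oc_s_mem hs) a) (oc_powersLE_mem hi)),
      cl_mul (pow_mem (oc_s_mem hs) a) (oc_powersLE_mem hi), cl_pow (oc_s_mem hs), ← aP_eq hi]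
    have h3 : aP s i = (LaurentPolynomial.T (-i : ℤ) : LaurentPolynomial ℤ) • aC s i := by
      rw [aC, T_smul_T_smul, neg_add_cancel, LaurentPolynomial.T_zero, one_smul]
    rw [h3]
    exact S.smul_mem (mul_mem (pow_mem h1 a) (S.smul_mem (h2 i hi) _)) _
  | zero => exact ⟨zero_mem _, by rw [cl_zero]; exact zero_mem _⟩
  | add x y _ _ hx hy =>
    obtain ⟨hx, hx'⟩ := hx
    obtain ⟨hy, hy'⟩ := hy
    exact ⟨add_mem hx hy, by rw [cl_add hx hy]; exact add_mem hx' hy'⟩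

end gens

/-! ### The presented algebra -/

/-- The indices `(a, i)` of the basis elements `s ^ a C_i`. -/
def basisIndex (d : ℕ) : Finset (ℕ × ℕ) :=
  (Finset.range d ×ˢ Finset.range (d - 1)) ∪ {(0, d - 1)}

theorem mem_basisIndex {d : ℕ} {j : ℕ × ℕ} :
    j ∈ basisIndex d ↔ (j.1 < d ∧ j.2 < d - 1) ∨ (j.1 = 0 ∧ j.2 = d - 1) := by
  simp [basisIndex, Prod.ext_iff, or_comm]

theorem mem_cyc {s : ℂˣ} {a i : ℕ} {x : ℂˣ} : x ∈ cyc s a i ↔ ∃ k ≤ i, x = s ^ (a + k) := by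
  change (∃ k ≤ i, (s ^ a)⁻¹ * x = s ^ k) ↔ _
  simp only [inv_mul_eq_iff_eq_mul, pow_add]

theorem finite_cyc (s : ℂˣ) (a i : ℕ) : (cyc s a i).Finite := by
  refine (Set.finite_Iic i).image (fun k => s ^ (a + k)) |>.subset ?_
  intro x hx
  obtain ⟨k, hk, rfl⟩ := mem_cyc.1 hx
  exact ⟨k, hk, rfl⟩

theorem pow_inj_of_lt {s : ℂˣ} {k l : ℕ} (hk : k < orderOf s) (hl : l < orderOf s)
    (h : s ^ k = s ^ l) : k = l := pow_injOn_Iio_orderOf hk hl h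

theorem ncard_cyc {s : ℂˣ} {a i : ℕ} (hi : i < orderOf s) : (cyc s a i).ncard = i + 1 := by
  have : cyc s a i = (fun k => s ^ (a + k)) '' (Finset.range (i + 1) : Set ℕ) := by
    ext x
    rw [mem_cyc]
    constructor
    · rintro ⟨k, hk, rfl⟩
      exact ⟨k, by simpa using Nat.lt_succ_of_le hk, rfl⟩
    · rintro ⟨k, hk, rfl⟩
      exact ⟨k, Nat.le_of_lt_succ (by simpa using hk), rfl⟩
  rw [this, Set.InjOn.ncard_image, Set.ncard_coe_finset, Finset.card_range]
  intro k hk l hl h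
  have hk : k < i + 1 := by simpa using hk
  have hl : l < i + 1 := by simpa using hl
  simp only [pow_add] at h
  exact pow_inj_of_lt (by omega) (by omega) (mul_left_cancel h)

/-- The cardinality `i + 1` determines `i`. An arc with `i < d - 1` is not the whole cycle and is
determined by its starting point, the only element whose predecessor is outside; the whole cycle is
listed only with `a = 0`. -/
theorem cyc_injOn {s : ℂˣ} (hs : 0 < orderOf s) :
    Set.InjOn (fun j : ℕ × ℕ => cyc s j.1 j.2) (basisIndex (orderOf s)) := by
  rintro ⟨a, i⟩ ha ⟨b, j⟩ hb h
  have ha := mem_basisIndex.1 ha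
  have hb := mem_basisIndex.1 hb
  simp only at ha hb h
  have hij : i = j := by
    have h1 := ncard_cyc (s := s) (a := a) (i := i) (by omega)
    rw [h, ncard_cyc (by omega)] at h1
    omega
  subst hij
  refine Prod.ext ?_ rfl
  change a = b
  rcases ha with ⟨ha, hi⟩ | ⟨ha, hi⟩
  swap
  · omega
  have hb : b < orderOf s := by omega
  obtain ⟨k, hk, hk'⟩ := mem_cyc.1 (h ▸ mem_cyc.2 ⟨0, Nat.zero_le _, rfl⟩ : s ^ (b + 0) ∈ cyc s a i)
  rw [add_zero] at hk'
  rcases Nat.eq_zero_or_pos k with rfl | hk0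
  · exact (pow_inj_of_lt hb ha hk').symm
  · obtain ⟨l, hl, hl'⟩ := mem_cyc.1
      (h ▸ mem_cyc.2 ⟨k - 1, by omega, rfl⟩ : s ^ (a + (k - 1)) ∈ cyc s b i)
    -- If `s ^ b = s ^ (a + k)` with `k > 0`, its predecessor lies in the common arc. Counted from
    -- `s ^ b` it is `d - 1` steps ahead, beyond the length `i < d - 1`.
    have h1 : s ^ b * s ^ (orderOf s - 1) = s ^ b * s ^ l := by
      rw [← pow_add s b l, ← hl', hk', ← pow_add,
        show a + k + (orderOf s - 1) = a + (k - 1) + orderOf s by omega, pow_add s _ (orderOf s),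
        pow_orderOf_eq_one, mul_one]
    have := pow_inj_of_lt (by omega) (by omega) (mul_left_cancel h1)
    omega

section presented
variable {d : ℕ}

/-- The generator `s` of the presented algebra. -/
def prS (d : ℕ) : Presented d := toPresented d (genS d)

/-- The generator `C_i` of the presented algebra. -/
def prC (d i : ℕ) : Presented d := toPresented d (genC d i)

theorem toPresented_rel {x y : Free d} (h : Rel d x y) : toPresented d x = toPresented d y :=
  RingQuot.mkAlgHom_rel _ h

theorem prC_zero : prC d 0 = 1 := map_one (toPresented d)

theorem prS_pow : prS d ^ d = 1 := by
  rw [prS, ← map_pow, toPresented_rel Rel.s_pow, map_one]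

theorem prS_mul_last : prS d * prC d (d - 1) = prC d (d - 1) := by
  rw [prS, prC, ← map_mul, toPresented_rel Rel.s_mul_last]

theorem prC_commute {i j : ℕ} (hi : i ≤ d - 1) (hj : j ≤ d - 1) :
    Commute (prC d i) (prC d j) := by
  rcases Nat.eq_zero_or_pos i with rfl | hi0
  · rw [prC_zero]; exact Commute.one_left _
  rcases Nat.eq_zero_or_pos j with rfl | hj0
  · rw [prC_zero]; exact Commute.one_right _
  change prC d i * prC d j = prC d j * prC d i
  rw [prC, prC, ← map_mul, toPresented_rel (Rel.C_comm i j ⟨hi0, hi⟩ ⟨hj0, hj⟩), map_mul]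

theorem prS_commute {i : ℕ} (hi : i ≤ d - 1) : Commute (prS d) (prC d i) := by
  rcases Nat.eq_zero_or_pos i with rfl | hi0
  · rw [prC_zero]; exact Commute.one_right _
  change prS d * prC d i = prC d i * prS d
  rw [prS, prC, ← map_mul, toPresented_rel (Rel.s_comm i ⟨hi0, hi⟩), map_mul]

theorem prC_one_mul {i : ℕ} (h1 : 1 ≤ i) (h2 : i ≤ d - 2) :
    prC d 1 * prC d i = prC d (i + 1) + prS d * prC d (i - 1) := by
  rw [prC, prC, ← map_mul, toPresented_rel (Rel.C_one_mul i ⟨h1, h2⟩), map_add, map_mul]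
  rfl

theorem prC_one_mul_last : prC d 1 * prC d (d - 1) =
    (LaurentPolynomial.T 1 + LaurentPolynomial.T (-1) : LaurentPolynomial ℤ) • prC d (d - 1) := by
  rw [prC, prC, ← map_mul, toPresented_rel Rel.C_one_mul_last, map_smul]

/-- The basis elements `s ^ a C_i`. -/
def prB (d : ℕ) (j : ℕ × ℕ) : Presented d := prS d ^ j.1 * prC d j.2

/-- The span of the basis elements. -/
def basisSpan (d : ℕ) : Submodule (LaurentPolynomial ℤ) (Presented d) :=
  Submodule.span _ (prB d '' (basisIndex d : Set (ℕ × ℕ)))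

theorem prS_pow_mul_last (a : ℕ) : prS d ^ a * prC d (d - 1) = prC d (d - 1) := by
  induction a with
  | zero => rw [pow_zero, one_mul]
  | succ a ih => rw [pow_succ, mul_assoc, prS_mul_last, ih]

/-- Exponents of `s` are reduced modulo `d`, and in front of `C_{d-1}` the powers of `s` disappear.
-/
theorem prB_mem (hd : 2 < d) (a : ℕ) {i : ℕ} (hi : i ≤ d - 1) :
    prS d ^ a * prC d i ∈ basisSpan d := by
  rcases Nat.lt_or_ge i (d - 1) with h | h
  · rw [← Nat.mod_add_div a d, pow_add, pow_mul, prS_pow, one_pow, mul_one]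
    exact Submodule.subset_span ⟨(a % d, i), mem_basisIndex.2
      (Or.inl ⟨Nat.mod_lt _ (by omega), h⟩), rfl⟩
  · obtain rfl : i = d - 1 := by omega
    rw [prS_pow_mul_last]
    exact Submodule.subset_span ⟨(0, d - 1), mem_basisIndex.2 (Or.inr ⟨rfl, rfl⟩),
      by rw [prB, pow_zero, one_mul]⟩

theorem le_of_mem_basisIndex {j : ℕ × ℕ} (hj : j ∈ basisIndex d) : j.2 ≤ d - 1 := by
  have := mem_basisIndex.1 hj
  omega

theorem mul_basisSpan {y : Presented d}
    (h : ∀ a i, i ≤ d - 1 → y * (prS d ^ a * prC d i) ∈ basisSpan d) {x : Presented d}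
    (hx : x ∈ basisSpan d) : y * x ∈ basisSpan d := by
  induction hx using Submodule.span_induction with
  | mem x hx =>
    obtain ⟨⟨a, i⟩, hj, rfl⟩ := hx
    exact h a i (le_of_mem_basisIndex hj)
  | zero => rw [mul_zero]; exact zero_mem _
  | add x z _ _ hx hz => rw [mul_add]; exact add_mem hx hz
  | smul c x _ hx => rw [mul_smul_comm]; exact Submodule.smul_mem _ _ hx

theorem prS_mul_basisSpan (hd : 2 < d) {x : Presented d} (hx : x ∈ basisSpan d) :
    prS d * x ∈ basisSpan d :=
  mul_basisSpan (fun a i hi => by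
    rw [← mul_assoc, ← pow_succ']; exact prB_mem hd (a + 1) hi) hx

theorem prC_one_mul_basisSpan (hd : 2 < d) {x : Presented d} (hx : x ∈ basisSpan d) :
    prC d 1 * x ∈ basisSpan d := by
  refine mul_basisSpan (fun a i hi => ?_) hx
  rw [← mul_assoc, ← ((prS_commute (d := d) (i := 1) (by omega)).pow_left a).eq, mul_assoc]
  rcases Nat.eq_zero_or_pos i with rfl | h0
  · rw [prC_zero, mul_one]
    exact prB_mem hd a (by omega)
  rcases Nat.lt_or_ge i (d - 1) with h | h
  · rw [prC_one_mul h0 (by omega), mul_add, ← mul_assoc, ← pow_succ]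
    exact add_mem (prB_mem hd a (by omega)) (prB_mem hd (a + 1) (by omega))
  · obtain rfl : i = d - 1 := by omega
    rw [prC_one_mul_last, mul_smul_comm]
    exact Submodule.smul_mem _ _ (prB_mem hd a le_rfl)

theorem left_mem_of_add_mem {L M : Type*} [Ring L] [AddCommMonoid M] [Module L M]
    (N : Submodule L M) {p q : M} (h : p + q ∈ N) (hq : q ∈ N) : p ∈ N := by
  have h1 : p + q + (-1 : L) • q = p := by
    have h2 : q + (-1 : L) • q = 0 := by
      rw [← one_smul L q, smul_smul, ← add_smul, mul_one, add_neg_cancel, zero_smul]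
    rw [add_assoc, h2, add_zero]
  exact h1 ▸ N.add_mem h (N.smul_mem _ hq)

/-- The same recursion `C_{i+2} = C_1 C_{i+1} - s C_i` reduces the claim to multiplication by `s`
and `C_1`, for which the defining relations apply directly. -/
theorem prC_mul_basisSpan (hd : 2 < d) {i : ℕ} (hi : i ≤ d - 1) {x : Presented d}
    (hx : x ∈ basisSpan d) : prC d i * x ∈ basisSpan d := by
  induction i using Nat.strong_induction_on with
  | _ i ih =>
    match i, hi, ih with
    | 0, _, _ => rwa [prC_zero, one_mul]
    | 1, _, _ => exact prC_one_mul_basisSpan hd hx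
    | i + 2, hi, ih =>
      have h := prC_one_mul (d := d) (i := i + 1) (by omega) (by omega)
      rw [Nat.add_sub_cancel] at h
      have h2 := prC_one_mul_basisSpan hd (ih (i + 1) (by omega) (by omega))
      rw [← mul_assoc, h, add_mul, mul_assoc] at h2
      exact left_mem_of_add_mem _ h2 (prS_mul_basisSpan hd (ih i (by omega) (by omega)))

/-- The span contains `1 = s ^ 0 C_0` and is stable under left multiplication by every generator,
hence by every word. -/
theorem basisSpan_eq_top (hd : 2 < d) (z : Presented d) : z ∈ basisSpan d := by
  obtain ⟨w, rfl⟩ := RingQuot.mkAlgHom_surjective (LaurentPolynomial ℤ) (Rel d) z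
  change toPresented d w ∈ _
  suffices key : ∀ x ∈ basisSpan d, toPresented d w * x ∈ basisSpan d by
    have := key 1 (by
      have := prB_mem hd 0 (i := 0) (by omega)
      rwa [pow_zero, prC_zero, mul_one] at this)
    rwa [mul_one] at this
  induction w using FreeAlgebra.induction with
  | grade0 r =>
    intro x hx
    rw [AlgHom.commutes, ← Algebra.smul_def]
    exact Submodule.smul_mem _ _ hx
  | grade1 g =>
    intro x hx
    cases g with
    | s => exact prS_mul_basisSpan hd hx
    | C i =>
      have h : prC d (i + 1) = toPresented d (FreeAlgebra.ι _ (Gen.C i)) := by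
        rw [prC, genC, dif_pos i.2]
      rw [← h]
      exact prC_mul_basisSpan hd (by omega) hx
  | mul a b ha hb => intro x hx; rw [map_mul, mul_assoc]; exact ha _ (hb _ hx)
  | add a b ha hb => intro x hx; rw [map_add, add_mul]; exact add_mem (ha _ hx) (hb _ hx)

theorem presented_commute (hd : 2 < d) (x y : Presented d) : Commute x y := by
  have hB : ∀ j ∈ basisIndex d, ∀ k ∈ basisIndex d, Commute (prB d j) (prB d k) := fun j hj k hk =>
    (((Commute.refl (prS d)).pow_pow _ _).mul_right
      ((prS_commute (le_of_mem_basisIndex hk)).pow_left _)).mul_left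
      (((prS_commute (le_of_mem_basisIndex hj)).symm.pow_right _).mul_right
        (prC_commute (le_of_mem_basisIndex hj) (le_of_mem_basisIndex hk)))
  have h1 : ∀ j ∈ basisIndex d, Commute (prB d j) y := fun j hj => by
    induction basisSpan_eq_top hd y using Submodule.span_induction with
    | mem y hy =>
      obtain ⟨k, hk, rfl⟩ := hy
      exact hB j hj k hk
    | zero => exact Commute.zero_right _
    | add y z _ _ hy hz => exact hy.add_right hz
    | smul c y _ hy => exact hy.smul_right c
  induction basisSpan_eq_top hd x using Submodule.span_induction with
  | mem x hx =>
    obtain ⟨j, hj, rfl⟩ := hx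
    exact h1 j hj
  | zero => exact Commute.zero_left _
  | add x z _ _ hx hz => exact hx.add_left hz
  | smul c x _ hx => exact hx.smul_left c

end presented

/-! ### The isomorphism -/

section iso
variable {s : ℂˣ}

/-- The map from the free algebra to `A_W`. -/
def freeHom (hs : 2 < orderOf s) : Free (orderOf s) →ₐ[LaurentPolynomial ℤ] AW s :=
  FreeAlgebra.lift _ fun g => match g with
    | Gen.s => aS hs
    | Gen.C i => aC s (i + 1)

theorem freeHom_genS (hs : 2 < orderOf s) : freeHom hs (genS _) = aS hs :=
  FreeAlgebra.lift_ι_apply _ _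

theorem freeHom_genC (hs : 2 < orderOf s) {i : ℕ} (hi : i < orderOf s) :
    freeHom hs (genC _ i) = aC s i := by
  cases i with
  | zero => rw [genC, map_one, aC_zero hs]
  | succ i =>
    rw [genC, dif_pos (by omega)]
    exact FreeAlgebra.lift_ι_apply _ _

theorem freeHom_rel (hs : 2 < orderOf s) ⦃x y : Free (orderOf s)⦄ (h : Rel (orderOf s) x y) :
    freeHom hs x = freeHom hs y := by
  cases h with
  | s_pow => rw [map_pow, map_one, freeHom_genS, aS_pow]
  | C_comm i j hi hj =>
    rw [map_mul, map_mul, freeHom_genC hs (by omega), freeHom_genC hs (by omega),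
      aC_commute hs (by omega) (by omega)]
  | s_comm i hi =>
    rw [map_mul, map_mul, freeHom_genC hs (by omega), freeHom_genS, aS_mul_aC hs (by omega)]
  | C_one_mul i hi =>
    rw [map_mul, map_add, map_mul, freeHom_genC hs (by omega), freeHom_genC hs (by omega),
      freeHom_genC hs (by omega), freeHom_genC hs (by omega), freeHom_genS,
      aC_one_mul hs hi.1 (by omega)]
  | C_one_mul_last =>
    rw [map_mul, map_smul, freeHom_genC hs (by omega), freeHom_genC hs (by omega),
      aC_one_mul_last hs]
  | s_mul_last => rw [map_mul, freeHom_genC hs (by omega), freeHom_genS, aS_mul_last]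

/-- The map from the presented algebra to `A_W`. -/
def presentedHom (hs : 2 < orderOf s) : Presented (orderOf s) →ₐ[LaurentPolynomial ℤ] AW s :=
  RingQuot.liftAlgHom _ ⟨freeHom hs, freeHom_rel hs⟩

theorem presentedHom_toPresented (hs : 2 < orderOf s) (x : Free (orderOf s)) :
    presentedHom hs (toPresented _ x) = freeHom hs x :=
  RingQuot.liftAlgHom_mkAlgHom_apply _ _ _ _

theorem presentedHom_surjective (hs : 2 < orderOf s) : Function.Surjective (presentedHom hs) := by
  intro x
  refine mem_of_generators hs (presentedHom hs).range ⟨toPresented _ (genS _), ?_⟩ (fun i hi =>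
    ⟨toPresented _ (genC _ i), ?_⟩) x
  · exact (presentedHom_toPresented hs _).trans (freeHom_genS hs)
  · exact (presentedHom_toPresented hs _).trans (freeHom_genC hs hi)

/-- The spanning elements `s ^ a C_i` go to the classes `v ^ i ⟨𝒪(s ^ a {e, …, s ^ i})⟩`. The sets
are pairwise distinct, so these images are linearly independent. -/
theorem presentedHom_injective (hs : 2 < orderOf s) : Function.Injective (presentedHom hs) := by
  rw [injective_iff_map_eq_zero]
  intro z hz
  obtain ⟨c, rfl⟩ := (Submodule.mem_span_image_finset_iff_exists_fun _).1 (basisSpan_eq_top hs z)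
  have hlt : ∀ j : basisIndex (orderOf s), j.1.2 < orderOf s := fun j => by
    have := le_of_mem_basisIndex j.2
    omega
  have hB : ∀ j : basisIndex (orderOf s), presentedHom hs (prB _ j) =
      (LaurentPolynomial.T (j.1.2 : ℤ) : LaurentPolynomial ℤ) •
        cls s (O (cyc s j.1.1 j.1.2)) (BW_cyc hs _ (hlt j)) := fun j => by
    rw [← aS_pow_mul_aC hs _ (hlt j), prB, map_mul, map_pow, prS, prC, presentedHom_toPresented,
      presentedHom_toPresented, freeHom_genS, freeHom_genC hs (hlt j)]
  rw [map_sum] at hz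
  simp only [map_smul, hB, smul_smul] at hz
  have h := coeff_eq_zero_of_sum_cls (by omega) Finset.univ
    (fun j : basisIndex (orderOf s) => cyc s j.1.1 j.1.2) (fun _ => finite_cyc s _ _)
    (fun _ => nonempty_cyc s _ _)
    (fun j _ k _ h => Subtype.ext (cyc_injOn (by omega) j.2 k.2 h))
    (fun j => BW_cyc hs _ (hlt j)) _ hz
  refine Finset.sum_eq_zero fun j hj => ?_
  have h1 := h j hj
  -- Independence yields `c j v ^ i = 0`, and `v ^ i` is a unit.
  have h2 : c j = 0 := by
    have h3 : c j * LaurentPolynomial.T (j.1.2 : ℤ) * LaurentPolynomial.T (-(j.1.2 : ℤ)) = 0 := by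
      rw [h1, zero_mul]
    rwa [mul_assoc, ← LaurentPolynomial.T_add, add_neg_cancel, LaurentPolynomial.T_zero,
      mul_one] at h3
  rw [h2, zero_smul]

/-- The presentation of `A_W`. -/
def presentedEquiv (hs : 2 < orderOf s) : Presented (orderOf s) ≃ₐ[LaurentPolynomial ℤ] AW s :=
  AlgEquiv.ofBijective (presentedHom hs) ⟨presentedHom_injective hs, presentedHom_surjective hs⟩

theorem AW_commute (hs : 2 < orderOf s) (x y : AW s) : x * y = y * x := by
  obtain ⟨x, rfl⟩ := presentedHom_surjective hs x
  obtain ⟨y, rfl⟩ := presentedHom_surjective hs y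
  rw [← map_mul, ← map_mul, (presented_commute hs x y).eq]

theorem oc_singleton_mem (hs : 2 < orderOf s) (x : Subgroup.zpowers s) :
    oc {(x : ℂˣ)} ∈ BWClasses s := by
  obtain ⟨k, -, hk⟩ := (mem_powersLE_iff_mem_zpowers (by omega)).2 x.2
  rw [hk, ← oc_singleton_pow]
  exact pow_mem (oc_s_mem hs) k

/-- The homomorphism `x ↦ ⟨𝒪(x)⟩`. -/
def groupHom (hs : 2 < orderOf s) : Subgroup.zpowers s →* AW s where
  toFun x := cl (oc_singleton_mem hs x)
  map_one' := by
    rw [← cl_one]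
    exact cl_congr _ _ oc_one
  map_mul' x y := by
    rw [← cl_mul]
    exact cl_congr _ _ (oc_singleton_mul_singleton x y).symm

/-- The singletons `{x}`, `x ∈ W`, are distinct, so the classes of the `𝒪(x)` are linearly
independent. -/
theorem groupHom_lift_injective (hs : 2 < orderOf s) : Function.Injective
    (MonoidAlgebra.lift (LaurentPolynomial ℤ) (AW s) (Subgroup.zpowers s) (groupHom hs)) := by
  rw [injective_iff_map_eq_zero]
  intro f hf
  rw [MonoidAlgebra.lift_apply, Finsupp.sum] at hf
  have h := coeff_eq_zero_of_sum_cls (by omega) f.coeff.support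
    (fun x : Subgroup.zpowers s => {(x : ℂˣ)}) (fun _ => Set.finite_singleton _)
    (fun _ => Set.singleton_nonempty _)
    (fun x _ y _ h => Subtype.ext (Set.singleton_injective h))
    (fun x => BW.of_isoClass (oc_singleton_mem hs x)) f.coeff hf
  ext x
  by_cases hx : x ∈ f.coeff.support
  · rw [h x hx]; rfl
  · rw [Finsupp.notMem_support_iff.1 hx]; rfl

end iso

end RankOne

end

/-! ### The main theorem -/

theorem mainTheorem2 (d : ℕ) (hd : 2 < d) (s : ℂˣ) (hs : orderOf s = d) :
    ∃ (hO : RankOne.BW s (RankOne.GrBimod.O {s}))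
      (hC : ∀ i : ℕ, 1 ≤ i → i ≤ d - 1 →
        RankOne.BW s ((RankOne.GrBimod.O (RankOne.powersLE s i)).shift i)),
      -- the presentation
      (∃ φ : RankOne.Presented d ≃ₐ[LaurentPolynomial ℤ] RankOne.AW s,
        φ (RankOne.toPresented d (RankOne.genS d)) = RankOne.cls s (RankOne.GrBimod.O {s}) hO ∧
        ∀ (i : ℕ) (h₁ : 1 ≤ i) (h₂ : i ≤ d - 1),
          φ (RankOne.toPresented d (RankOne.genC d i)) =
            RankOne.cls s ((RankOne.GrBimod.O (RankOne.powersLE s i)).shift i) (hC i h₁ h₂)) ∧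
      -- commutativity
      (∀ x y : RankOne.AW s, x * y = y * x) ∧
      -- the group algebra of `W` embeds, with `s` mapped to the class of `𝒪(s)`
      (∃ ψ : MonoidAlgebra (LaurentPolynomial ℤ) (Subgroup.zpowers s) →ₐ[LaurentPolynomial ℤ]
          RankOne.AW s,
        Function.Injective ψ ∧
        ψ (MonoidAlgebra.of _ _ ⟨s, Subgroup.mem_zpowers s⟩) =
          RankOne.cls s (RankOne.GrBimod.O {s}) hO) := by
  subst hs
  have hP : ∀ i : ℕ, 1 ≤ i → i ≤ orderOf s - 1 →
      RankOne.BW s (RankOne.GrBimod.O (RankOne.powersLE s i)) := fun i _ h₂ =>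
    RankOne.BW.of_isoClass (RankOne.oc_powersLE_mem (by omega))
  refine ⟨RankOne.BW.of_isoClass (RankOne.oc_s_mem hd), fun i h₁ h₂ => (hP i h₁ h₂).shift i,
    ⟨RankOne.presentedEquiv hd, ?_, fun i h₁ h₂ => ?_⟩, RankOne.AW_commute hd,
    MonoidAlgebra.lift _ _ _ (RankOne.groupHom hd), RankOne.groupHom_lift_injective hd, ?_⟩
  · exact (RankOne.presentedHom_toPresented hd _).trans (RankOne.freeHom_genS hd)
  · refine (RankOne.presentedHom_toPresented hd _).trans
      ((RankOne.freeHom_genC hd (by omega)).trans ?_)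
    rw [RankOne.aC, RankOne.aP_eq (by omega)]
    exact RankOne.T_smul_cls (hP i h₁ h₂) i
  · exact MonoidAlgebra.lift_of _ _
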